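/- **Setting.** Let $D\subset\mathbb R^2$ be open and let $S$ be a smooth field of endomorphisms of $TD$ with smooth, everywhere distinct real eigenvalue functions $A,B$ (labelled in either order); put $U=1/A$, $V=1/B$. For a function $f$ write $df=d'f+d''f$, where $d'f=df\circ\frac{S-B}{A-B}$ and $d''f=df\circ\frac{S-A}{B-A}$. Assume that $A,B$ vanish nowhere (invertibility) and that $d''A$, $d'B$ vanish nowhere (nondegeneracy), and put $$\theta_1=\frac{A\,d'B}{B(B-A)},\qquad \theta_2=\frac{B\,d''A}{A(A-B)} .$$ $S$ is *of Type I* if there are functions $K_2,K_{21}$ with $$d\theta_1=\theta_1\wedge\theta_2,\qquad d\theta_2=K_2\,\theta_2\wedge\theta_1,\qquad dK_2=K_{21}\theta_1+2(K_2-1)\theta_2,$$ or if the same holds with $\theta_1$ and $\theta_2$ interchanged. *Principal coordinates* on an open set $R\subset D$ are smooth functions $(x,y)$ mapping $R$ diffeomorphically onto an open coordinate rectangle with $S=A\,\partial_x\otimes dx+B\,\partial_y\otimes dy$. They are *natural*, with associated smooth functions $\phi_0,\phi_1$ on $x(R)$, if $\phi_0\phi_1'-\phi_1\phi_0'=1$,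 both $\Phi=\phi_1(x)-y\phi_0(x)$ and $\Phi'=\phi_1'(x)-y\phi_0'(x)$ are positive on $R$, and $$\theta_1=\frac{\Phi'}{\Phi}\,dx,\qquad \theta_2=\frac{-dy}{\Phi\,\Phi'} .$$ A *realization* of $S$ on $R$ is a smooth immersion $\mathbf x:R\to\mathbb E^3$ with smooth unit normal $\mathbf n$ whose shape operator is $S$, i.e. $-d\mathbf n(v)\cdot d\mathbf x(w)=d\mathbf x(v)\cdot d\mathbf x(Sw)=d\mathbf x(Sv)\cdot d\mathbf x(w)$. A function on $R$ is *computable by quadratures* from $(x,y)$ if it is obtained in finitely many steps from $x,y,A,B$ and real constants by field operations, square roots of positive functions, $\exp$, $\sin$, $\cos$, partial differentiation with respect to $x,y$, substitution of a constant for one of the coordinates $x,y$, and quadrature (passing from a closed form $P\,dx+Q\,dy$ with already computed $P,Q$ to a primitive of it). **Theorem.** Let $S$ be of Type I on $D$. 1. Let $(x,y)$ be any principal coordinates on $R\subset D$. Then: * there are natural principal coordinates $(\xi,\eta)$ on $R$ (for $S$, possibly after interchanging the labels of the two eigenvalues), with functions $\phi_0,\phi_1$, such that $\xi,\eta,\phi_0(\xi),\phi_1(\xi)$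 are computable by quadratures from $(x,y)$; * for every realization $(\mathbf x,\mathbf n)$ of $S$ on $R$, the components of $\mathbf e_3=\mathbf n$ are computable by quadratures, one has $$\mathbf x=-\int U\,\frac{\partial\mathbf e_3}{\partial x}\,dx+V\,\frac{\partial\mathbf e_3}{\partial y}\,dy ,$$ and hence the components of $\mathbf x$ are computable by quadratures. 2. Let $(x,y)$ be natural principal coordinates on $R\subset D$ with functions $\phi_0,\phi_1$. For constants $c_0,c_1,c_2$ put $$a=-1-c_0\phi_0^2-2c_1\phi_0\phi_1-c_2\phi_1^2,\qquad b=\frac{c_0+2c_1y+c_2y^2}{(\phi_1'-y\phi_0')^2},\qquad \sigma=\frac{\sqrt{c_1^2-c_0c_2}}{(1+a)\sqrt a}\,dx ,$$ and suppose $a>0$ and $b>0$ on $R$. Then there is a function $s$ on $R$ with $ds=\sigma$, and for each such $s$ let $$\mathbf e_3=\begin{pmatrix}\cos s\,\dfrac{\sqrt a}{\sqrt{1+a}}-\sin s\;\tau\\[2mm] \dfrac{\sqrt{c_0+2c_1y+c_2y^2}}{(\phi_1-y\phi_0)\sqrt{c_1^2-c_0c_2}}\\[2mm] \sin s\,\dfrac{\sqrt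 a}{\sqrt{1+a}}+\cos s\;\tau\end{pmatrix},\qquad \tau=\frac{c_0\phi_0+c_1(\phi_1+y\phi_0)+c_2y\phi_1}{(\phi_1-y\phi_0)\sqrt{1+a}\sqrt{c_1^2-c_0c_2}} .$$ The form $U\,\partial_x\mathbf e_3\,dx+V\,\partial_y\mathbf e_3\,dy$ has a primitive on $R$, and for every primitive, with $\mathbf x$ its negative, $(\mathbf x,\mathbf e_3)$ is a realization of $S$ on $R$. Conversely, for every realization $(\mathbf x,\mathbf n)$ of $S$ on $R$ there are constants $c_0,c_1,c_2$ with $a,b>0$ on $R$, a function $s$ with $ds=\sigma$, and an orthogonal transformation $M$ of $\mathbb E^3$ such that $\mathbf n=M\mathbf e_3$ and $\mathbf x=-\int U\,\partial_x\mathbf n\,dx+V\,\partial_y\mathbf n\,dy$. -/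

import Mathlib

open scoped ContDiff

/-- Euclidean `3`-space. -/
abbrev E3 : Type := EuclideanSpace ℝ (Fin 3)

/-! ### Forms and operators on plane domains -/

/-- The exterior derivative of a `1`-form, evaluated on two constant vector fields. -/
noncomputable def extD (θ : ℝ × ℝ → (ℝ × ℝ →L[ℝ] ℝ)) (p u v : ℝ × ℝ) : ℝ :=
  fderiv ℝ θ p u v - fderiv ℝ θ p v u

/-- The wedge product of two covectors. -/
def wedge (α β : ℝ × ℝ →L[ℝ] ℝ) (u v : ℝ × ℝ) : ℝ :=
  α u * β v - α v * β u

/-- `S` is a smooth field of endomorphisms on `D` whose eigenvalues are everywhere distinct and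
given by the smooth functions `A` and `B` (in this order, which is an arbitrary choice). -/
structure HasPrincipalCurvatures (D : Set (ℝ × ℝ)) (S : ℝ × ℝ → (ℝ × ℝ →L[ℝ] ℝ × ℝ))
    (A B : ℝ × ℝ → ℝ) : Prop where
  smooth_op : ContDiffOn ℝ ∞ S D
  smooth_fst : ContDiffOn ℝ ∞ A D
  smooth_snd : ContDiffOn ℝ ∞ B D
  eigen_fst : ∀ p ∈ D, Module.End.HasEigenvalue (S p : (ℝ × ℝ) →ₗ[ℝ] ℝ × ℝ) (A p)
  eigen_snd : ∀ p ∈ D, Module.End.HasEigenvalue (S p : (ℝ × ℝ) →ₗ[ℝ] ℝ × ℝ) (B p)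
  ne : ∀ p ∈ D, A p ≠ B p

/-- `d'f`: the differential of `f` composed with the projection `(S - B) / (A - B)` onto the
`A`-eigenline along the `B`-eigenline. The other part `d''f` of the differential is obtained by
interchanging `A` and `B`. -/
noncomputable def dPrin (S : ℝ × ℝ → (ℝ × ℝ →L[ℝ] ℝ × ℝ)) (A B f : ℝ × ℝ → ℝ) (p : ℝ × ℝ) :
    ℝ × ℝ →L[ℝ] ℝ :=
  (A p - B p)⁻¹ • (fderiv ℝ f p).comp (S p - B p • ContinuousLinearMap.id ℝ (ℝ × ℝ))

/-- The form `θ₁ = A d'B / (B (B - A))`. -/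
noncomputable def theta₁ (S : ℝ × ℝ → (ℝ × ℝ →L[ℝ] ℝ × ℝ)) (A B : ℝ × ℝ → ℝ) (p : ℝ × ℝ) :
    ℝ × ℝ →L[ℝ] ℝ :=
  (A p / (B p * (B p - A p))) • dPrin S A B B p

/-- The form `θ₂ = B d''A / (A (A - B))`. -/
noncomputable def theta₂ (S : ℝ × ℝ → (ℝ × ℝ →L[ℝ] ℝ × ℝ)) (A B : ℝ × ℝ → ℝ) (p : ℝ × ℝ) :
    ℝ × ℝ →L[ℝ] ℝ :=
  (B p / (A p * (A p - B p))) • dPrin S B A A p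

/-- The structure equations `dθ₁ = θ₁ ∧ θ₂`, `dθ₂ = K₂ θ₂ ∧ θ₁`,
`dK₂ = K₂₁ θ₁ + 2 (K₂ - 1) θ₂` on `D`. -/
def SatisfiesFirstSystem (D : Set (ℝ × ℝ)) (θ₁ θ₂ : ℝ × ℝ → (ℝ × ℝ →L[ℝ] ℝ)) : Prop :=
  ∃ K₂ K₂₁ : ℝ × ℝ → ℝ, ContDiffOn ℝ ∞ K₂ D ∧ ∀ p ∈ D,
    (∀ u v, extD θ₁ p u v = wedge (θ₁ p) (θ₂ p) u v) ∧
    (∀ u v, extD θ₂ p u v = K₂ p * wedge (θ₂ p) (θ₁ p) u v) ∧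
    fderiv ℝ K₂ p = K₂₁ p • θ₁ p + (2 * (K₂ p - 1)) • θ₂ p

/-- `S` is a Type I operator on `D`, with eigenvalues labelled `A`, `B`: it is invertible
(`A`, `B` nonvanishing), nondegenerate (`d''A`, `d'B` nonvanishing), and its coframing satisfies
either the first system or the dual one, in which the two principal families are interchanged. -/
structure IsTypeI (D : Set (ℝ × ℝ)) (S : ℝ × ℝ → (ℝ × ℝ →L[ℝ] ℝ × ℝ))
    (A B : ℝ × ℝ → ℝ) : Prop where
  curvatures : HasPrincipalCurvatures D S A B
  fst_ne_zero : ∀ p ∈ D, A p ≠ 0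
  snd_ne_zero : ∀ p ∈ D, B p ≠ 0
  nondeg_fst : ∀ p ∈ D, dPrin S B A A p ≠ 0
  nondeg_snd : ∀ p ∈ D, dPrin S A B B p ≠ 0
  system : SatisfiesFirstSystem D (theta₁ S A B) (theta₂ S A B) ∨
    SatisfiesFirstSystem D (theta₂ S A B) (theta₁ S A B)

/-! ### Realizations -/

/-- `(X, n)` is a normally oriented immersion of `R` into Euclidean space with shape operator `S`,
i.e. `II(v, w) = I(v, S w) = I(S v, w)` with `I = dX · dX` and `II = - dn · dX`. -/
structure IsRealization (R : Set (ℝ × ℝ)) (S : ℝ × ℝ → (ℝ × ℝ →L[ℝ] ℝ × ℝ))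
    (X n : ℝ × ℝ → E3) : Prop where
  smooth : ContDiffOn ℝ ∞ X R
  smooth_normal : ContDiffOn ℝ ∞ n R
  immersion : ∀ p ∈ R, Function.Injective (fderiv ℝ X p)
  unit : ∀ p ∈ R, ‖n p‖ = 1
  normal : ∀ p ∈ R, ∀ v, inner ℝ (n p) (fderiv ℝ X p v) = 0
  shape : ∀ p ∈ R, ∀ v w,
    -inner ℝ (fderiv ℝ n p v) (fderiv ℝ X p w) =
        inner ℝ (fderiv ℝ X p v) (fderiv ℝ X p (S p w)) ∧
    -inner ℝ (fderiv ℝ n p v) (fderiv ℝ X p w) =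
        inner ℝ (fderiv ℝ X p (S p v)) (fderiv ℝ X p w)

/-! ### Principal coordinates -/

/-- `df = P dx + Q dy` on `R`. For a given coordinate system `(x, y)` on the open set `R`, this
says both that `P = ∂f/∂x`, `Q = ∂f/∂y`, and that `f` is a primitive of the form `P dx + Q dy`. -/
def HasDifferential {F : Type*} [NormedAddCommGroup F] [NormedSpace ℝ F]
    (R : Set (ℝ × ℝ)) (x y : ℝ × ℝ → ℝ) (f P Q : ℝ × ℝ → F) : Prop :=
  ∀ p ∈ R, HasFDerivAt f
    ((fderiv ℝ x p).smulRight (P p) + (fderiv ℝ y p).smulRight (Q p)) p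

/-- `(x, y)` are principal coordinates on the open set `R`, mapping it diffeomorphically onto an
open coordinate rectangle, in which `S = A ∂/∂x ⊗ dx + B ∂/∂y ⊗ dy`
(equivalently `dx ∘ S = A dx` and `dy ∘ S = B dy`). -/
structure IsPrincipalCoordinates (R : Set (ℝ × ℝ)) (S : ℝ × ℝ → (ℝ × ℝ →L[ℝ] ℝ × ℝ))
    (A B x y : ℝ × ℝ → ℝ) : Prop where
  isOpen : IsOpen R
  smooth_fst : ContDiffOn ℝ ∞ x R
  smooth_snd : ContDiffOn ℝ ∞ y R
  indep : ∀ p ∈ R, LinearIndependent ℝ ![fderiv ℝ x p, fderiv ℝ y p]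
  injOn : Set.InjOn (fun p => (x p, y p)) R
  rectangle : ∃ I J : Set ℝ, IsOpen I ∧ I.OrdConnected ∧ IsOpen J ∧ J.OrdConnected ∧
    (fun p => (x p, y p)) '' R = I ×ˢ J
  diag_fst : ∀ p ∈ R, (fderiv ℝ x p).comp (S p) = A p • fderiv ℝ x p
  diag_snd : ∀ p ∈ R, (fderiv ℝ y p).comp (S p) = B p • fderiv ℝ y p

/-- `φ₁(x) - y φ₀(x)`. -/
def natNum (φ₀ φ₁ : ℝ → ℝ) (x y : ℝ × ℝ → ℝ) (p : ℝ × ℝ) : ℝ :=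
  φ₁ (x p) - y p * φ₀ (x p)

/-- `φ₁'(x) - y φ₀'(x)`. -/
noncomputable def natDen (φ₀ φ₁ : ℝ → ℝ) (x y : ℝ × ℝ → ℝ) (p : ℝ × ℝ) : ℝ :=
  deriv φ₁ (x p) - y p * deriv φ₀ (x p)

/-- `(x, y)` are natural principal coordinates on `R` with associated functions `φ₀`, `φ₁`:
`φ₀ φ₁' - φ₁ φ₀' = 1` (so that both solve one equation `φ'' + μ φ = 0`), the functions
`φ₁ - y φ₀` and `φ₁' - y φ₀'` are positive, and
`θ₁ = (φ₁' - y φ₀') dx / (φ₁ - y φ₀)`, `θ₂ = - dy / ((φ₁ - y φ₀) (φ₁' - y φ₀'))`. -/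
structure IsNaturalPrincipalCoordinates (R : Set (ℝ × ℝ)) (S : ℝ × ℝ → (ℝ × ℝ →L[ℝ] ℝ × ℝ))
    (A B x y : ℝ × ℝ → ℝ) (φ₀ φ₁ : ℝ → ℝ) : Prop
    extends IsPrincipalCoordinates R S A B x y where
  smooth_phi₀ : ContDiffOn ℝ ∞ φ₀ (x '' R)
  smooth_phi₁ : ContDiffOn ℝ ∞ φ₁ (x '' R)
  wronskian : ∀ r ∈ x '' R, φ₀ r * deriv φ₁ r - φ₁ r * deriv φ₀ r = 1
  num_pos : ∀ p ∈ R, 0 < natNum φ₀ φ₁ x y p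
  den_pos : ∀ p ∈ R, 0 < natDen φ₀ φ₁ x y p
  theta₁_eq : ∀ p ∈ R, theta₁ S A B p =
    (natDen φ₀ φ₁ x y p / natNum φ₀ φ₁ x y p) • fderiv ℝ x p
  theta₂_eq : ∀ p ∈ R, theta₂ S A B p =
    (-1 / (natNum φ₀ φ₁ x y p * natDen φ₀ φ₁ x y p)) • fderiv ℝ y p

/-! ### The explicit Gauss map -/

/-- `a = -1 - c₀ φ₀² - 2 c₁ φ₀ φ₁ - c₂ φ₁²`. -/
def coeffA (φ₀ φ₁ : ℝ → ℝ) (c₀ c₁ c₂ : ℝ) (x : ℝ × ℝ → ℝ) (p : ℝ × ℝ) : ℝ :=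
  -1 - c₀ * φ₀ (x p) ^ 2 - 2 * c₁ * φ₀ (x p) * φ₁ (x p) - c₂ * φ₁ (x p) ^ 2

/-- `b = (c₀ + 2 c₁ y + c₂ y²) / (φ₁' - y φ₀')²`. -/
noncomputable def coeffB (φ₀ φ₁ : ℝ → ℝ) (c₀ c₁ c₂ : ℝ) (x y : ℝ × ℝ → ℝ) (p : ℝ × ℝ) : ℝ :=
  (c₀ + 2 * c₁ * y p + c₂ * y p ^ 2) / natDen φ₀ φ₁ x y p ^ 2

/-- The coefficient of `σ = √(c₁² - c₀ c₂) / ((1 + a) √a) dx`. -/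
noncomputable def sigmaCoeff (φ₀ φ₁ : ℝ → ℝ) (c₀ c₁ c₂ : ℝ) (x : ℝ × ℝ → ℝ) (p : ℝ × ℝ) : ℝ :=
  √(c₁ ^ 2 - c₀ * c₂) / ((1 + coeffA φ₀ φ₁ c₀ c₁ c₂ x p) * √(coeffA φ₀ φ₁ c₀ c₁ c₂ x p))

/-- The component of the Gauss map along the unit tangent of the great circle of centers:
`(c₀ φ₀ + c₁ (φ₁ + y φ₀) + c₂ y φ₁) / ((φ₁ - y φ₀) √(1 + a) √(c₁² - c₀ c₂))`. -/
noncomputable def tangentCoeff (φ₀ φ₁ : ℝ → ℝ) (c₀ c₁ c₂ : ℝ) (x y : ℝ × ℝ → ℝ)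
    (p : ℝ × ℝ) : ℝ :=
  (c₀ * φ₀ (x p) + c₁ * (φ₁ (x p) + y p * φ₀ (x p)) + c₂ * y p * φ₁ (x p)) /
    (natNum φ₀ φ₁ x y p * √(1 + coeffA φ₀ φ₁ c₀ c₁ c₂ x p) * √(c₁ ^ 2 - c₀ * c₂))

/-- The component of the Gauss map along the spherical center moving on the great circle:
`√a / √(1 + a)`. -/
noncomputable def centerCoeff (φ₀ φ₁ : ℝ → ℝ) (c₀ c₁ c₂ : ℝ) (x : ℝ × ℝ → ℝ)
    (p : ℝ × ℝ) : ℝ :=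
  √(coeffA φ₀ φ₁ c₀ c₁ c₂ x p) / √(1 + coeffA φ₀ φ₁ c₀ c₁ c₂ x p)

/-- The explicit Gauss map `e₃` built from the quadrature `s = ∫ σ`. -/
noncomputable def gaussMap (φ₀ φ₁ : ℝ → ℝ) (c₀ c₁ c₂ : ℝ) (x y s : ℝ × ℝ → ℝ)
    (p : ℝ × ℝ) : E3 :=
  !₂[Real.cos (s p) * centerCoeff φ₀ φ₁ c₀ c₁ c₂ x p
        - Real.sin (s p) * tangentCoeff φ₀ φ₁ c₀ c₁ c₂ x y p,
    √(c₀ + 2 * c₁ * y p + c₂ * y p ^ 2) / (natNum φ₀ φ₁ x y p * √(c₁ ^ 2 - c₀ * c₂)),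
    Real.sin (s p) * centerCoeff φ₀ φ₁ c₀ c₁ c₂ x p
        + Real.cos (s p) * tangentCoeff φ₀ φ₁ c₀ c₁ c₂ x y p]

/-- Admissible data for the explicit construction on `R`: constants for which `a` and `b` are
positive, and a function `s` obtained by the quadrature `ds = σ`. -/
structure IsAdmissible (R : Set (ℝ × ℝ)) (x y : ℝ × ℝ → ℝ) (φ₀ φ₁ : ℝ → ℝ) (c₀ c₁ c₂ : ℝ)
    (s : ℝ × ℝ → ℝ) : Prop where
  pos_a : ∀ p ∈ R, 0 < coeffA φ₀ φ₁ c₀ c₁ c₂ x p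
  pos_b : ∀ p ∈ R, 0 < coeffB φ₀ φ₁ c₀ c₁ c₂ x y p
  quadrature : HasDifferential R x y s (sigmaCoeff φ₀ φ₁ c₀ c₁ c₂ x) 0

/-- `X = - ∫ U (∂n/∂x) dx + V (∂n/∂y) dy` on `R`, where `U = 1/A`, `V = 1/B`. -/
def IsRealizationIntegral (R : Set (ℝ × ℝ)) (A B x y : ℝ × ℝ → ℝ) (n X : ℝ × ℝ → E3) : Prop :=
  ∃ nx ny : ℝ × ℝ → E3, HasDifferential R x y n nx ny ∧
    HasDifferential R x y X (fun p => -((A p)⁻¹ • nx p)) (fun p => -((B p)⁻¹ • ny p))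

/-! ### Computability by quadratures -/

/-- The functions on `R` that can be computed by quadratures from the coordinates `x`, `y` and the
eigenvalue functions `A`, `B`: those obtained in finitely many steps from `x`, `y`, `A`, `B` and
constants by the field operations, square roots of positive functions, the elementary functions
`exp`, `sin` and `cos`, differentiation, restriction to a single coordinate line
(substituting a constant for one coordinate; used only when `(x, y)` maps `R` bijectively onto a
rectangle), and quadrature, i.e. passing from a form
`P dx + Q dy` with known coefficients to a primitive of it. -/
inductive ByQuadratures (R : Set (ℝ × ℝ)) (A B x y : ℝ × ℝ → ℝ) : (ℝ × ℝ → ℝ) → Prop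
  | coord_fst : ByQuadratures R A B x y x
  | coord_snd : ByQuadratures R A B x y y
  | curv_fst : ByQuadratures R A B x y A
  | curv_snd : ByQuadratures R A B x y B
  | const (c : ℝ) : ByQuadratures R A B x y (fun _ => c)
  | add {f g : ℝ × ℝ → ℝ} : ByQuadratures R A B x y f → ByQuadratures R A B x y g →
      ByQuadratures R A B x y (fun p => f p + g p)
  | mul {f g : ℝ × ℝ → ℝ} : ByQuadratures R A B x y f → ByQuadratures R A B x y g →
      ByQuadratures R A B x y (fun p => f p * g p)
  | inv {f : ℝ × ℝ → ℝ} : ByQuadratures R A B x y f → (∀ p ∈ R, f p ≠ 0) →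
      ByQuadratures R A B x y (fun p => (f p)⁻¹)
  | sqrt {f : ℝ × ℝ → ℝ} : ByQuadratures R A B x y f → (∀ p ∈ R, 0 < f p) →
      ByQuadratures R A B x y (fun p => √(f p))
  | exp {f : ℝ × ℝ → ℝ} : ByQuadratures R A B x y f →
      ByQuadratures R A B x y (fun p => Real.exp (f p))
  | sin {f : ℝ × ℝ → ℝ} : ByQuadratures R A B x y f →
      ByQuadratures R A B x y (fun p => Real.sin (f p))
  | cos {f : ℝ × ℝ → ℝ} : ByQuadratures R A B x y f →
      ByQuadratures R A B x y (fun p => Real.cos (f p))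
  | deriv_fst {f P Q : ℝ × ℝ → ℝ} : ByQuadratures R A B x y f → HasDifferential R x y f P Q →
      ByQuadratures R A B x y P
  | deriv_snd {f P Q : ℝ × ℝ → ℝ} : ByQuadratures R A B x y f → HasDifferential R x y f P Q →
      ByQuadratures R A B x y Q
  | restrict_snd {f g : ℝ × ℝ → ℝ} {q : ℝ × ℝ} : ByQuadratures R A B x y g → q ∈ R →
      (∀ p ∈ R, ∀ p' ∈ R, x p' = x p → y p' = y q → f p = g p') →
      ByQuadratures R A B x y f
  | restrict_fst {f g : ℝ × ℝ → ℝ} {q : ℝ × ℝ} : ByQuadratures R A B x y g → q ∈ R →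
      (∀ p ∈ R, ∀ p' ∈ R, y p' = y p → x p' = x q → f p = g p') →
      ByQuadratures R A B x y f
  | quadrature {f P Q : ℝ × ℝ → ℝ} : ByQuadratures R A B x y P → ByQuadratures R A B x y Q →
      HasDifferential R x y f P Q → ByQuadratures R A B x y f
  | congr {f g : ℝ × ℝ → ℝ} : ByQuadratures R A B x y f → (∀ p ∈ R, f p = g p) →
      ByQuadratures R A B x y g

/-! In natural coordinates write F = φ₁ - yφ₀ and H = φ₁' - yφ₀' = F_x. A realization is governed by
its Gauss map n: the Weingarten equations n_x = -A X_x, n_y = -B X_y make X a primitive of -(U n_x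
dx + V n_y dy). Using the Codazzi equations for U_y and V_x, closedness of this form becomes the
single equation n_xy = n_x/(FH) - (H/F) n_y. It says exactly that c = n + (F/H) n_x does not depend
on y. Since c·n = 1, each y-curve of n lies in a fixed plane and is a circular arc; `IsGaussField`
records this geometry.

Put |c - n|² = 1/a and |n_y|² = 1/(F²Q). Then a depends on x alone and Q on y alone. Expanding c' in
the orthogonal frame n, c - n, n_y gives Q = kF² + a'FH - (1 + a)H² with k, a functions of x
(`IsGaussField.Q_eq`). For each x this is a quadratic polynomial in y, and it cannot vary with x, so
its coefficients are constants c₀, 2c₁, c₂; evaluation where F vanishes recovers a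
(`IsGaussField.exists_constants`). The frame obeys a linear total differential system whose
coefficients involve only F, H, a, Q, so these functions determine n up to an orthogonal map
(`IsGaussField.exists_isometry`). The explicit map realizes every admissible a, Q
(`IsNaturalPrincipalCoordinates.gaussField`), and every such field integrates to an immersion; this
is part 2.

For part 1, write θ₁ = P dx in arbitrary principal coordinates. The Type I equations say that P
satisfies a Riccati equation P_x = -P² + kP + m with k, m functions of x alone. The values of P on
one line y = const are a particular solution, so the associated linear equation is solved by
quadratures and reduction of order. A change of x removing the first-order term gives φ₀, φ₁ with
Wronskian 1, and the natural y is the projective parameter labelling the Riccati solutions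
(`IsPrincipalCoordinates.exists_natural`). The explicit Gauss map then uses only permitted
operations and one further quadrature. -/

/-! ### Rectangular charts and their inverses -/

/-- `(x, y)` are smooth coordinates on the open set `R`, mapping it onto a coordinate rectangle. -/
structure IsRectangularChart (R : Set (ℝ × ℝ)) (x y : ℝ × ℝ → ℝ) : Prop where
  isOpen : IsOpen R
  smooth_fst : ContDiffOn ℝ ∞ x R
  smooth_snd : ContDiffOn ℝ ∞ y R
  indep : ∀ p ∈ R, LinearIndependent ℝ ![fderiv ℝ x p, fderiv ℝ y p]
  injOn : Set.InjOn (fun p => (x p, y p)) R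
  rectangle : ∃ I J : Set ℝ, IsOpen I ∧ I.OrdConnected ∧ IsOpen J ∧ J.OrdConnected ∧
    (fun p => (x p, y p)) '' R = I ×ˢ J

theorem IsPrincipalCoordinates.isRectangularChart {R : Set (ℝ × ℝ)}
    {S : ℝ × ℝ → (ℝ × ℝ →L[ℝ] ℝ × ℝ)} {A B x y : ℝ × ℝ → ℝ}
    (h : IsPrincipalCoordinates R S A B x y) : IsRectangularChart R x y :=
  ⟨h.isOpen, h.smooth_fst, h.smooth_snd, h.indep, h.injOn, h.rectangle⟩

/-- `G` is a smooth inverse of the chart `(x, y) : R → I × J`. -/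
structure IsChartInverse (R : Set (ℝ × ℝ)) (x y : ℝ × ℝ → ℝ) (I J : Set ℝ)
    (G : ℝ × ℝ → ℝ × ℝ) : Prop where
  isOpen : IsOpen R
  isOpen_fst : IsOpen I
  isOpen_snd : IsOpen J
  ordConnected_fst : I.OrdConnected
  ordConnected_snd : J.OrdConnected
  smooth_x : ContDiffOn ℝ ∞ x R
  smooth_y : ContDiffOn ℝ ∞ y R
  smooth : ContDiffOn ℝ ∞ G (I ×ˢ J)
  x_mem : ∀ p ∈ R, x p ∈ I
  y_mem : ∀ p ∈ R, y p ∈ J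
  maps : ∀ s ∈ I, ∀ t ∈ J, G (s, t) ∈ R
  left_inv : ∀ p ∈ R, G (x p, y p) = p
  x_apply : ∀ s ∈ I, ∀ t ∈ J, x (G (s, t)) = s
  y_apply : ∀ s ∈ I, ∀ t ∈ J, y (G (s, t)) = t

theorem bijective_prod_of_linearIndependent (a b : ℝ × ℝ →L[ℝ] ℝ)
    (h : LinearIndependent ℝ ![a, b]) : Function.Bijective (a.prod b) := by
  have hinj : Function.Injective (a.prod b) := by
    rw [injective_iff_map_eq_zero]
    intro v hv
    have h1 : a v = 0 := congrArg Prod.fst hv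
    have h2 : b v = 0 := congrArg Prod.snd hv
    by_contra hne
    have ha : ∀ (c : ℝ × ℝ →L[ℝ] ℝ) (u : ℝ × ℝ), c u = u.1 * c (1, 0) + u.2 * c (0, 1) := by
      intro c u
      have : u = u.1 • ((1, 0) : ℝ × ℝ) + u.2 • ((0, 1) : ℝ × ℝ) := by ext <;> simp
      conv_lhs => rw [this, map_add, map_smul, map_smul]
      rfl
    have hz : a (1, 0) * b (0, 1) - a (0, 1) * b (1, 0) = 0 := by
      rw [ha] at h1 h2
      by_cases hv1 : v.1 = 0
      · have hv2 : v.2 ≠ 0 := fun h => hne (Prod.ext hv1 h)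
        apply mul_left_cancel₀ hv2
        linear_combination b (1, 0) * (-h1) + a (1, 0) * h2
      · apply mul_left_cancel₀ hv1
        linear_combination b (0, 1) * h1 - a (0, 1) * h2
    rw [LinearIndependent.pair_iff] at h
    -- Vanishing of the determinant makes both coefficient pairs linear relations between `a` and
    -- `b`; independence then kills both components of `a`, and `a = 0` is itself a relation.
    have e1 := h (b (1, 0)) (-a (1, 0)) (by
      ext <;> simp <;> linarith)
    have e2 := h (b (0, 1)) (-a (0, 1)) (by
      ext <;> simp <;> linarith)
    have := h 1 0 (by
      ext <;> simp <;> linarith [e1.2, e2.2])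
    simp at this
  exact ⟨hinj, (LinearMap.injective_iff_surjective (f := (a.prod b : ℝ × ℝ →ₗ[ℝ] ℝ × ℝ))).1 hinj⟩

/-- The inverse function theorem makes the chart open near every point of `R`. With injectivity the
local inverses fit into one global inverse, which is smooth because each local one is. -/
theorem IsRectangularChart.exists_inverse {R : Set (ℝ × ℝ)} {x y : ℝ × ℝ → ℝ}
    (h : IsRectangularChart R x y) : ∃ I J G, IsChartInverse R x y I J G := by
  obtain ⟨I, J, hI, hI', hJ, hJ', him⟩ := h.rectangle
  set Ψ : ℝ × ℝ → ℝ × ℝ := fun p => (x p, y p) with hΨ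
  have hs : ContDiffOn ℝ ∞ Ψ R := h.smooth_fst.prodMk h.smooth_snd
  have hsa : ∀ p ∈ R, ContDiffAt ℝ ∞ Ψ p := fun p hp => hs.contDiffAt (h.isOpen.mem_nhds hp)
  have hd : ∀ p ∈ R, ∃ e : (ℝ × ℝ) ≃L[ℝ] (ℝ × ℝ),
      HasFDerivAt Ψ (e : ℝ × ℝ →L[ℝ] ℝ × ℝ) p := by
    intro p hp
    obtain ⟨hi, hsj⟩ := bijective_prod_of_linearIndependent _ _ (h.indep p hp)
    refine ⟨ContinuousLinearEquiv.ofBijective ((fderiv ℝ x p).prod (fderiv ℝ y p))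
      (LinearMap.ker_eq_bot.2 hi) (LinearMap.range_eq_top.2 hsj), ?_⟩
    have h1 := ((h.smooth_fst.contDiffAt (h.isOpen.mem_nhds hp)).differentiableAt
      (by simp)).hasFDerivAt
    have h2 := ((h.smooth_snd.contDiffAt (h.isOpen.mem_nhds hp)).differentiableAt
      (by simp)).hasFDerivAt
    exact h1.prodMk h2
  have hopen : IsOpenMap (R.domRestrict Ψ) := by
    rw [isOpenMap_iff_nhds_le]
    rintro ⟨p, hp⟩
    obtain ⟨e, he⟩ := hd p hp
    have h1 : HasStrictFDerivAt Ψ (e : ℝ × ℝ →L[ℝ] ℝ × ℝ) p :=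
      (hsa p hp).hasStrictFDerivAt' he (by simp)
    have h2 := h1.map_nhds_eq_of_equiv
    have h3 : Filter.map (R.domRestrict Ψ) (nhds ⟨p, hp⟩) = nhds (Ψ p) := by
      rw [← h2, ← map_nhds_subtype_coe_eq_nhds hp (h.isOpen.mem_nhds hp), Filter.map_map]
      rfl
    exact h3.ge
  let e₀ : PartialEquiv (ℝ × ℝ) (ℝ × ℝ) := h.injOn.toPartialEquiv
  let e := OpenPartialHomeomorph.ofContinuousOpenRestrict e₀ hs.continuousOn hopen h.isOpen
  have het : e.target = I ×ˢ J := him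
  have hcoe : ∀ p, e p = Ψ p := fun p => rfl
  have hmem : ∀ s ∈ I, ∀ t ∈ J, (s, t) ∈ e.target := fun s hs t ht => by
    rw [het]; exact ⟨hs, ht⟩
  have hmem' : ∀ p ∈ R, Ψ p ∈ I ×ˢ J := fun p hp => him ▸ ⟨p, hp, rfl⟩
  refine ⟨I, J, e.symm, h.isOpen, hI, hJ, hI', hJ', h.smooth_fst, h.smooth_snd, ?_,
    fun p hp => (hmem' p hp).1, fun p hp => (hmem' p hp).2,
    fun s hs t ht => e.map_target (hmem s hs t ht), fun p hp => e.left_inv hp,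
    fun s hs t ht => congrArg Prod.fst (e.right_inv (hmem s hs t ht)),
    fun s hs t ht => congrArg Prod.snd (e.right_inv (hmem s hs t ht))⟩
  rintro ⟨s, t⟩ ⟨hs, ht⟩
  obtain ⟨e', he'⟩ := hd _ (e.map_target (hmem s hs t ht))
  exact (e.contDiffAt_symm (hmem s hs t ht) he'
    (hsa _ (e.map_target (hmem s hs t ht)))).contDiffWithinAt

namespace IsChartInverse

variable {R : Set (ℝ × ℝ)} {x y : ℝ × ℝ → ℝ} {I J : Set ℝ} {G : ℝ × ℝ → ℝ × ℝ}
variable {E : Type*} [NormedAddCommGroup E] [NormedSpace ℝ E]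

theorem hasFDerivAt_x (h : IsChartInverse R x y I J G) {p : ℝ × ℝ} (hp : p ∈ R) :
    HasFDerivAt x (fderiv ℝ x p) p :=
  ((h.smooth_x.contDiffAt (h.isOpen.mem_nhds hp)).differentiableAt (by simp)).hasFDerivAt

theorem hasFDerivAt_y (h : IsChartInverse R x y I J G) {p : ℝ × ℝ} (hp : p ∈ R) :
    HasFDerivAt y (fderiv ℝ y p) p :=
  ((h.smooth_y.contDiffAt (h.isOpen.mem_nhds hp)).differentiableAt (by simp)).hasFDerivAt

theorem isOpen_prod (h : IsChartInverse R x y I J G) : IsOpen (I ×ˢ J) :=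
  h.isOpen_fst.prod h.isOpen_snd

theorem convex_prod (h : IsChartInverse R x y I J G) : Convex ℝ (I ×ˢ J) :=
  h.ordConnected_fst.convex.prod h.ordConnected_snd.convex

theorem hasFDerivAt_inv (h : IsChartInverse R x y I J G) {s t : ℝ} (hs : s ∈ I) (ht : t ∈ J) :
    HasFDerivAt G (fderiv ℝ G (s, t)) (s, t) :=
  ((h.smooth.contDiffAt (h.isOpen_prod.mem_nhds ⟨hs, ht⟩)).differentiableAt (by simp)).hasFDerivAt

theorem fderiv_x_comp (h : IsChartInverse R x y I J G) {s t : ℝ} (hs : s ∈ I) (ht : t ∈ J) :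
    (fderiv ℝ x (G (s, t))).comp (fderiv ℝ G (s, t)) = ContinuousLinearMap.fst ℝ ℝ ℝ := by
  have h1 := (h.hasFDerivAt_x (h.maps s hs t ht)).comp (s, t) (h.hasFDerivAt_inv hs ht)
  refine h1.unique (hasFDerivAt_fst.congr_of_eventuallyEq ?_)
  filter_upwards [h.isOpen_prod.mem_nhds ⟨hs, ht⟩] with q hq using h.x_apply _ hq.1 _ hq.2

theorem fderiv_y_comp (h : IsChartInverse R x y I J G) {s t : ℝ} (hs : s ∈ I) (ht : t ∈ J) :
    (fderiv ℝ y (G (s, t))).comp (fderiv ℝ G (s, t)) = ContinuousLinearMap.snd ℝ ℝ ℝ := by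
  have h1 := (h.hasFDerivAt_y (h.maps s hs t ht)).comp (s, t) (h.hasFDerivAt_inv hs ht)
  refine h1.unique (hasFDerivAt_snd.congr_of_eventuallyEq ?_)
  filter_upwards [h.isOpen_prod.mem_nhds ⟨hs, ht⟩] with q hq using h.y_apply _ hq.1 _ hq.2

theorem eq_sum_frame (h : IsChartInverse R x y I J G) {p : ℝ × ℝ} (hp : p ∈ R) (v : ℝ × ℝ) :
    v = fderiv ℝ x p v • fderiv ℝ G (x p, y p) (1, 0) +
      fderiv ℝ y p v • fderiv ℝ G (x p, y p) (0, 1) := by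
  have hG : HasFDerivAt G (fderiv ℝ G (x p, y p)) (x p, y p) :=
    h.hasFDerivAt_inv (h.x_mem p hp) (h.y_mem p hp)
  have h1 := hG.comp p ((h.hasFDerivAt_x hp).prodMk (h.hasFDerivAt_y hp))
  have h2 := h1.unique ((hasFDerivAt_id p).congr_of_eventuallyEq (by
    filter_upwards [h.isOpen.mem_nhds hp] with q hq using h.left_inv q hq))
  have h3 := congrArg (fun L => L v) h2
  simp only [ContinuousLinearMap.comp_apply, ContinuousLinearMap.prod_apply,
    ContinuousLinearMap.id_apply] at h3
  rw [← map_smul, ← map_smul, ← map_add]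
  simpa using h3.symm

/-- A differential in the chart `(x, y)`, transported to the coordinate rectangle. -/
theorem hasFDerivAt_comp (h : IsChartInverse R x y I J G) {f P Q : ℝ × ℝ → E}
    (hf : HasDifferential R x y f P Q) {s t : ℝ} (hs : s ∈ I) (ht : t ∈ J) :
    HasFDerivAt (f ∘ G) ((ContinuousLinearMap.fst ℝ ℝ ℝ).smulRight (P (G (s, t))) +
      (ContinuousLinearMap.snd ℝ ℝ ℝ).smulRight (Q (G (s, t)))) (s, t) := by
  have h1 := (hf _ (h.maps s hs t ht)).comp (s, t) (h.hasFDerivAt_inv hs ht)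
  refine h1.congr_fderiv ?_
  rw [← h.fderiv_x_comp hs ht, ← h.fderiv_y_comp hs ht]
  rfl

/-- A differential on the coordinate rectangle, transported to the chart domain. -/
theorem hasDifferential_comp (h : IsChartInverse R x y I J G) {g : ℝ × ℝ → E}
    {P Q : ℝ × ℝ → E} (hg : ∀ p ∈ R, HasFDerivAt g
      ((ContinuousLinearMap.fst ℝ ℝ ℝ).smulRight (P p) +
      (ContinuousLinearMap.snd ℝ ℝ ℝ).smulRight (Q p)) (x p, y p)) :
    HasDifferential R x y (fun p => g (x p, y p)) P Q := by
  intro p hp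
  exact (hg p hp).comp p ((h.hasFDerivAt_x hp).prodMk (h.hasFDerivAt_y hp))

/-- The partial derivatives are the values of df on the two columns of the derivative of the inverse
chart, which also shows that they are smooth. -/
theorem exists_partials (h : IsChartInverse R x y I J G) {f : ℝ × ℝ → E}
    (hf : ContDiffOn ℝ ∞ f R) : ∃ P Q : ℝ × ℝ → E, ContDiffOn ℝ ∞ P R ∧ ContDiffOn ℝ ∞ Q R ∧
      HasDifferential R x y f P Q := by
  have hdf : ContDiffOn ℝ ∞ (fderiv ℝ f) R :=
    ((contDiffOn_infty_iff_fderiv_of_isOpen h.isOpen).1 hf).2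
  have hdG : ContDiffOn ℝ ∞ (fun p => fderiv ℝ G (x p, y p)) R :=
    ((contDiffOn_infty_iff_fderiv_of_isOpen h.isOpen_prod).1 h.smooth).2.comp
      (h.smooth_x.prodMk h.smooth_y) (fun p hp => ⟨h.x_mem p hp, h.y_mem p hp⟩)
  refine ⟨fun p => fderiv ℝ f p (fderiv ℝ G (x p, y p) (1, 0)),
    fun p => fderiv ℝ f p (fderiv ℝ G (x p, y p) (0, 1)),
    hdf.clm_apply (hdG.clm_apply contDiffOn_const),
    hdf.clm_apply (hdG.clm_apply contDiffOn_const), ?_⟩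
  intro p hp
  refine ((hf.contDiffAt
    (h.isOpen.mem_nhds hp)).differentiableAt (by simp)).hasFDerivAt.congr_fderiv ?_
  refine ContinuousLinearMap.ext fun v => ?_
  conv_lhs => rw [h.eq_sum_frame hp v]
  simp only [map_add, map_smul]
  rfl

theorem unique (h : IsChartInverse R x y I J G) {f P Q P' Q' : ℝ × ℝ → E}
    (hf : HasDifferential R x y f P Q) (hf' : HasDifferential R x y f P' Q') {p : ℝ × ℝ}
    (hp : p ∈ R) : P p = P' p ∧ Q p = Q' p := by
  have h1 := (h.hasFDerivAt_comp hf (h.x_mem p hp) (h.y_mem p hp)).unique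
    (h.hasFDerivAt_comp hf' (h.x_mem p hp) (h.y_mem p hp))
  rw [h.left_inv p hp] at h1
  have e1 := congrArg (fun L => L (1, 0)) h1
  have e2 := congrArg (fun L => L (0, 1)) h1
  simpa using And.intro e1 e2

theorem mixed_partials (h : IsChartInverse R x y I J G) {f P Q P₁ P₂ Q₁ Q₂ : ℝ × ℝ → E}
    (hf : HasDifferential R x y f P Q) (hP : HasDifferential R x y P P₁ P₂)
    (hQ : HasDifferential R x y Q Q₁ Q₂) {p : ℝ × ℝ} (hp : p ∈ R) : P₂ p = Q₁ p := by
  have hs := h.x_mem p hp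
  have ht := h.y_mem p hp
  have h1 : ∀ᶠ q in nhds (x p, y p), HasFDerivAt (f ∘ G)
      ((ContinuousLinearMap.fst ℝ ℝ ℝ).smulRight ((P ∘ G) q) +
      (ContinuousLinearMap.snd ℝ ℝ ℝ).smulRight ((Q ∘ G) q)) q := by
    filter_upwards [h.isOpen_prod.mem_nhds ⟨hs, ht⟩] with q hq
    exact h.hasFDerivAt_comp hf hq.1 hq.2
  have h2 := ((ContinuousLinearMap.smulRightL ℝ (ℝ × ℝ) E
    (ContinuousLinearMap.fst ℝ ℝ ℝ)).hasFDerivAt.comp (x p, y p)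
      (h.hasFDerivAt_comp hP hs ht)).add
    ((ContinuousLinearMap.smulRightL ℝ (ℝ × ℝ) E
    (ContinuousLinearMap.snd ℝ ℝ ℝ)).hasFDerivAt.comp (x p, y p)
      (h.hasFDerivAt_comp hQ hs ht))
  have h3 := second_derivative_symmetric_of_eventually h1 h2 (0, 1) (1, 0)
  simpa [h.left_inv p hp] using h3

theorem eq_of_hasDifferential_zero (h : IsChartInverse R x y I J G) {f : ℝ × ℝ → E}
    (hf : HasDifferential R x y f 0 0) {p p' : ℝ × ℝ} (hp : p ∈ R) (hp' : p' ∈ R) :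
    f p = f p' := by
  have h1 := h.convex_prod.isPreconnected
  have h2 := h.isOpen_prod.is_const_of_fderiv_eq_zero (𝕜 := ℝ) h1 (f := f ∘ G)
    (fun q hq => (h.hasFDerivAt_comp hf hq.1 hq.2).differentiableAt.differentiableWithinAt)
    (fun q hq => by rw [(h.hasFDerivAt_comp hf hq.1 hq.2).fderiv]; ext <;> simp)
    (x := (x p, y p)) (y := (x p', y p'))
    ⟨h.x_mem p hp, h.y_mem p hp⟩ ⟨h.x_mem p' hp', h.y_mem p' hp'⟩
  simpa [h.left_inv p hp, h.left_inv p' hp'] using h2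

/-- This uses the rectangle: the two points are joined by a y-line lying entirely in `R`, along
which f has zero derivative. -/
theorem eq_of_x_eq (h : IsChartInverse R x y I J G) {f P : ℝ × ℝ → E}
    (hf : HasDifferential R x y f P 0) {p p' : ℝ × ℝ} (hp : p ∈ R) (hp' : p' ∈ R)
    (hx : x p = x p') : f p = f p' := by
  have h1 : ∀ t ∈ J, HasDerivAt (fun t => f (G (x p, t))) 0 t := by
    intro t ht
    have := (h.hasFDerivAt_comp hf (h.x_mem p hp) ht).comp_hasDerivAt t
      ((hasDerivAt_const t (x p)).prodMk (hasDerivAt_id t))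
    simpa [Function.comp_def] using this
  have h2 := h.isOpen_snd.is_const_of_deriv_eq_zero h.ordConnected_snd.isPreconnected
    (f := fun t => f (G (x p, t)))
    (fun t ht => (h1 t ht).differentiableAt.differentiableWithinAt)
    (fun t ht => (h1 t ht).deriv) (h.y_mem p hp) (h.y_mem p' hp')
  simp only [h.left_inv p hp] at h2
  rw [h2, hx, h.left_inv p' hp']

/-- Poincaré's lemma on a coordinate rectangle. -/
theorem exists_primitive [CompleteSpace E] (h : IsChartInverse R x y I J G)
    {P Q P₁ P₂ Q₁ Q₂ : ℝ × ℝ → E}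
    (hP : HasDifferential R x y P P₁ P₂)
    (hQ : HasDifferential R x y Q Q₁ Q₂) (hclosed : ∀ p ∈ R, P₂ p = Q₁ p) :
    ∃ f, HasDifferential R x y f P Q := by
  have h2 : ∀ q ∈ I ×ˢ J, _ := fun q hq => ((ContinuousLinearMap.smulRightL ℝ (ℝ × ℝ) E
    (ContinuousLinearMap.fst ℝ ℝ ℝ)).hasFDerivAt.comp q
      (h.hasFDerivAt_comp hP hq.1 hq.2)).add
    ((ContinuousLinearMap.smulRightL ℝ (ℝ × ℝ) E
    (ContinuousLinearMap.snd ℝ ℝ ℝ)).hasFDerivAt.comp q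
      (h.hasFDerivAt_comp hQ hq.1 hq.2))
  obtain ⟨g, hg⟩ := h.convex_prod.exists_forall_hasFDerivAt_of_fderiv_symmetric h.isOpen_prod
    (fun q hq => (h2 q hq).differentiableAt.differentiableWithinAt) (fun q hq u v => by
      rw [(h2 q hq).fderiv]
      have := hclosed _ (h.maps _ hq.1 _ hq.2)
      simp [this, smul_smul, mul_comm]
      abel)
  refine ⟨fun p => g (x p, y p), h.hasDifferential_comp fun p hp => ?_⟩
  have := hg (x p, y p) ⟨h.x_mem p hp, h.y_mem p hp⟩
  simpa [h.left_inv p hp] using this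

/-- Restriction of a function to the coordinate line through `q` along which `y` is constant. -/
theorem restrict (h : IsChartInverse R x y I J G) {q : ℝ × ℝ} (hq : q ∈ R)
    {f P Q : ℝ × ℝ → E} (hf : HasDifferential R x y f P Q) :
    HasDifferential R x y (fun p => f (G (x p, y q))) (fun p => P (G (x p, y q))) 0 := by
  refine h.hasDifferential_comp (g := fun z => f (G (z.1, y q))) fun p hp => ?_
  have h1 := h.hasFDerivAt_comp hf (h.x_mem p hp) (h.y_mem q hq)
  have h2 : HasFDerivAt (fun z : ℝ × ℝ => (z.1, y q))
      ((ContinuousLinearMap.fst ℝ ℝ ℝ).prod 0) (x p, y p) :=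
    hasFDerivAt_fst.prodMk (hasFDerivAt_const (y q) ((x p, y p) : ℝ × ℝ))
  refine (HasFDerivAt.comp (x p, y p) h1 h2).congr_fderiv ?_
  ext <;> simp

theorem contDiffOn (h : IsChartInverse R x y I J G) {f P Q : ℝ × ℝ → E}
    (hf : HasDifferential R x y f P Q) (hP : ContDiffOn ℝ ∞ P R) (hQ : ContDiffOn ℝ ∞ Q R) :
    ContDiffOn ℝ ∞ f R := by
  rw [contDiffOn_infty_iff_fderiv_of_isOpen h.isOpen]
  refine ⟨fun p hp => (hf p hp).differentiableAt.differentiableWithinAt, ?_⟩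
  have hx := ((contDiffOn_infty_iff_fderiv_of_isOpen h.isOpen).1 h.smooth_x).2
  have hy := ((contDiffOn_infty_iff_fderiv_of_isOpen h.isOpen).1 h.smooth_y).2
  exact ((hx.smulRight hP).add (hy.smulRight hQ)).congr fun p hp => (hf p hp).fderiv

theorem isPreconnected (h : IsChartInverse R x y I J G) : IsPreconnected R := by
  have := h.convex_prod.isPreconnected.image G h.smooth.continuousOn
  convert this
  ext p
  refine ⟨fun hp => ⟨(x p, y p), ⟨h.x_mem p hp, h.y_mem p hp⟩, h.left_inv p hp⟩, ?_⟩
  rintro ⟨q, hq, rfl⟩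
  exact h.maps _ hq.1 _ hq.2

end IsChartInverse

/-! ### Calculus of differentials in a chart -/

namespace HasDifferential

variable {R : Set (ℝ × ℝ)} {x y : ℝ × ℝ → ℝ}
variable {E : Type*} [NormedAddCommGroup E] [NormedSpace ℝ E]

theorem congr {f P Q P' Q' : ℝ × ℝ → E} (hf : HasDifferential R x y f P Q)
    (hP : ∀ p ∈ R, P p = P' p) (hQ : ∀ p ∈ R, Q p = Q' p) : HasDifferential R x y f P' Q' :=
  fun p hp => by rw [← hP p hp, ← hQ p hp]; exact hf p hp

theorem congr_fun (hR : IsOpen R) {f g P Q : ℝ × ℝ → E} (hf : HasDifferential R x y f P Q)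
    (hfg : ∀ p ∈ R, f p = g p) : HasDifferential R x y g P Q := fun p hp =>
  (hf p hp).congr_of_eventuallyEq (by
    filter_upwards [hR.mem_nhds hp] with q hq using (hfg q hq).symm)

theorem const (c : E) : HasDifferential R x y (fun _ => c) 0 0 := fun p _ => by
  simpa using hasFDerivAt_const c p

theorem add {f P Q g P' Q' : ℝ × ℝ → E} (hf : HasDifferential R x y f P Q)
    (hg : HasDifferential R x y g P' Q') :
    HasDifferential R x y (fun p => f p + g p) (fun p => P p + P' p) (fun p => Q p + Q' p) :=
  fun p hp => by
    refine ((hf p hp).add (hg p hp)).congr_fderiv (ContinuousLinearMap.ext fun v => ?_)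
    simp only [add_apply, ContinuousLinearMap.smulRight_apply, smul_add]
    abel

theorem neg {f P Q : ℝ × ℝ → E} (hf : HasDifferential R x y f P Q) :
    HasDifferential R x y (fun p => -f p) (fun p => -P p) (fun p => -Q p) :=
  fun p hp => by
    refine (hf p hp).neg.congr_fderiv (ContinuousLinearMap.ext fun v => ?_)
    simp only [add_apply, neg_apply, ContinuousLinearMap.smulRight_apply, smul_neg]
    abel

theorem sub {f P Q g P' Q' : ℝ × ℝ → E} (hf : HasDifferential R x y f P Q)
    (hg : HasDifferential R x y g P' Q') :
    HasDifferential R x y (fun p => f p - g p) (fun p => P p - P' p) (fun p => Q p - Q' p) := by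
  simpa only [sub_eq_add_neg] using hf.add hg.neg

theorem smul {f P Q : ℝ × ℝ → ℝ} {g P' Q' : ℝ × ℝ → E} (hf : HasDifferential R x y f P Q)
    (hg : HasDifferential R x y g P' Q') :
    HasDifferential R x y (fun p => f p • g p) (fun p => f p • P' p + P p • g p)
      (fun p => f p • Q' p + Q p • g p) := fun p hp => by
    refine ((hf p hp).smul (hg p hp)).congr_fderiv (ContinuousLinearMap.ext fun v => ?_)
    simp only [add_apply, _root_.smul_apply, ContinuousLinearMap.smulRight_apply,
      smul_eq_mul]
    module

theorem mul {f P Q g P' Q' : ℝ × ℝ → ℝ} (hf : HasDifferential R x y f P Q)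
    (hg : HasDifferential R x y g P' Q') :
    HasDifferential R x y (fun p => f p * g p) (fun p => f p * P' p + P p * g p)
      (fun p => f p * Q' p + Q p * g p) := hf.smul hg

theorem inner {f P Q g P' Q' : ℝ × ℝ → E3} (hf : HasDifferential R x y f P Q)
    (hg : HasDifferential R x y g P' Q') :
    HasDifferential R x y (fun p => inner ℝ (f p) (g p))
      (fun p => inner ℝ (f p) (P' p) + inner ℝ (P p) (g p))
      (fun p => inner ℝ (f p) (Q' p) + inner ℝ (Q p) (g p)) := fun p hp => by
    refine ((hf p hp).inner ℝ (hg p hp)).congr_fderiv (ContinuousLinearMap.ext fun v => ?_)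
    simp [inner_add_left, inner_add_right, inner_smul_left, inner_smul_right]
    ring

theorem comp {f P Q : ℝ × ℝ → ℝ} {φ : ℝ → ℝ} {φ' : ℝ × ℝ → ℝ}
    (hf : HasDifferential R x y f P Q) (hφ : ∀ p ∈ R, HasDerivAt φ (φ' p) (f p)) :
    HasDifferential R x y (fun p => φ (f p)) (fun p => φ' p * P p) (fun p => φ' p * Q p) :=
  fun p hp => by
    refine ((hφ p hp).comp_hasFDerivAt p (hf p hp)).congr_fderiv
      (ContinuousLinearMap.ext fun v => ?_)
    simp
    ring

theorem inv {f P Q : ℝ × ℝ → ℝ} (hf : HasDifferential R x y f P Q) (h0 : ∀ p ∈ R, f p ≠ 0) :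
    HasDifferential R x y (fun p => (f p)⁻¹) (fun p => -P p / f p ^ 2)
      (fun p => -Q p / f p ^ 2) :=
  (hf.comp fun p hp => hasDerivAt_inv (h0 p hp)).congr (fun p _ => by ring) (fun p _ => by ring)

theorem div {f P Q g P' Q' : ℝ × ℝ → ℝ} (hf : HasDifferential R x y f P Q)
    (hg : HasDifferential R x y g P' Q') (h0 : ∀ p ∈ R, g p ≠ 0) :
    HasDifferential R x y (fun p => f p / g p) (fun p => (P p * g p - f p * P' p) / g p ^ 2)
      (fun p => (Q p * g p - f p * Q' p) / g p ^ 2) := by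
  simp only [div_eq_mul_inv (f _)]
  refine (hf.mul (hg.inv h0)).congr (fun p hp => ?_) (fun p hp => ?_) <;>
  · have := h0 p hp
    field_simp
    ring

theorem sqrt {f P Q : ℝ × ℝ → ℝ} (hf : HasDifferential R x y f P Q) (h0 : ∀ p ∈ R, 0 < f p) :
    HasDifferential R x y (fun p => √(f p)) (fun p => P p / (2 * √(f p)))
      (fun p => Q p / (2 * √(f p))) :=
  (hf.comp fun p hp => Real.hasDerivAt_sqrt (h0 p hp).ne').congr
    (fun p _ => by ring) (fun p _ => by ring)

theorem exp {f P Q : ℝ × ℝ → ℝ} (hf : HasDifferential R x y f P Q) :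
    HasDifferential R x y (fun p => Real.exp (f p)) (fun p => Real.exp (f p) * P p)
      (fun p => Real.exp (f p) * Q p) := hf.comp fun p _ => Real.hasDerivAt_exp (f p)

theorem sin {f P Q : ℝ × ℝ → ℝ} (hf : HasDifferential R x y f P Q) :
    HasDifferential R x y (fun p => Real.sin (f p)) (fun p => Real.cos (f p) * P p)
      (fun p => Real.cos (f p) * Q p) := hf.comp fun p _ => Real.hasDerivAt_sin (f p)

theorem cos {f P Q : ℝ × ℝ → ℝ} (hf : HasDifferential R x y f P Q) :
    HasDifferential R x y (fun p => Real.cos (f p)) (fun p => -Real.sin (f p) * P p)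
      (fun p => -Real.sin (f p) * Q p) := hf.comp fun p _ => Real.hasDerivAt_cos (f p)

/-- Differentials of maps to Euclidean space are computed componentwise. -/
theorem of_components {f P Q : ℝ × ℝ → E3}
    (h : ∀ i, HasDifferential R x y (fun p => f p i) (fun p => P p i) (fun p => Q p i)) :
    HasDifferential R x y f P Q := fun p hp => by
  rw [← hasFDerivWithinAt_univ, hasFDerivWithinAt_euclidean]
  intro i
  rw [hasFDerivWithinAt_univ]
  refine (h i p hp).congr_fderiv (ContinuousLinearMap.ext fun v => ?_)
  simp

theorem component {f P Q : ℝ × ℝ → E3} (h : HasDifferential R x y f P Q) (i : Fin 3) :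
    HasDifferential R x y (fun p => f p i) (fun p => P p i) (fun p => Q p i) := fun p hp => by
  have h1 := h p hp
  rw [← hasFDerivWithinAt_univ, hasFDerivWithinAt_euclidean] at h1
  have h2 := h1 i
  rw [hasFDerivWithinAt_univ] at h2
  refine h2.congr_fderiv (ContinuousLinearMap.ext fun v => ?_)
  simp

/-- The differential with the two coordinates interchanged. -/
theorem swap {f P Q : ℝ × ℝ → E} (h : HasDifferential R x y f P Q) :
    HasDifferential R y x f Q P := fun p hp => (h p hp).congr_fderiv (add_comm _ _)

end HasDifferential

namespace IsChartInverse

variable {R : Set (ℝ × ℝ)} {x y : ℝ × ℝ → ℝ} {I J : Set ℝ} {G : ℝ × ℝ → ℝ × ℝ}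
variable {E : Type*} [NormedAddCommGroup E] [NormedSpace ℝ E]

theorem hasDifferential_x (h : IsChartInverse R x y I J G) :
    HasDifferential R x y x (fun _ => 1) (fun _ => 0) := fun p hp =>
  (h.hasFDerivAt_x hp).congr_fderiv (by ext <;> simp)

theorem hasDifferential_y (h : IsChartInverse R x y I J G) :
    HasDifferential R x y y (fun _ => 0) (fun _ => 1) := fun p hp =>
  (h.hasFDerivAt_y hp).congr_fderiv (by ext <;> simp)

theorem contDiffOn_partials (h : IsChartInverse R x y I J G) {f P Q : ℝ × ℝ → E}
    (hf : ContDiffOn ℝ ∞ f R) (hd : HasDifferential R x y f P Q) :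
    ContDiffOn ℝ ∞ P R ∧ ContDiffOn ℝ ∞ Q R := by
  obtain ⟨P', Q', hP', hQ', hd'⟩ := h.exists_partials hf
  exact ⟨hP'.congr fun p hp => (h.unique hd hd' hp).1, hQ'.congr fun p hp => (h.unique hd hd' hp).2⟩

end IsChartInverse

/-! ### Orthogonal frames of Euclidean space -/

section OrthogonalFrames

theorem exists_orthonormalBasis_of_orthonormal {w : Fin 3 → E3} (hw : Orthonormal ℝ w) :
    ∃ b : OrthonormalBasis (Fin 3) ℝ E3, ⇑b = w := by
  have hc : Fintype.card (Fin 3) = Module.finrank ℝ E3 := by simp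
  have := (basisOfOrthonormalOfCardEqFinrank hw hc).span_eq
  rw [coe_basisOfOrthonormalOfCardEqFinrank] at this
  exact ⟨OrthonormalBasis.mk hw this.ge, OrthonormalBasis.coe_mk hw this.ge⟩

/-- An orthogonal frame `n, e, v` with squared lengths `1`, `1 / a`, `1 / d`. -/
structure IsOrthogonalFrame (n e v : E3) (a d : ℝ) : Prop where
  pos_a : 0 < a
  pos_d : 0 < d
  nn : inner ℝ n n = (1 : ℝ)
  ee : inner ℝ e e = a⁻¹
  vv : inner ℝ v v = d⁻¹
  ne : inner ℝ n e = (0 : ℝ)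
  nv : inner ℝ n v = (0 : ℝ)
  ev : inner ℝ e v = (0 : ℝ)

variable {n e v : E3} {a d : ℝ}

theorem IsOrthogonalFrame.exists_basis (h : IsOrthogonalFrame n e v a d) :
    ∃ b : OrthonormalBasis (Fin 3) ℝ E3, b 0 = n ∧ b 1 = √a • e ∧ b 2 = √d • v := by
  have ha := Real.mul_self_sqrt h.pos_a.le
  have hd := Real.mul_self_sqrt h.pos_d.le
  have hw : Orthonormal ℝ ![n, √a • e, √d • v] := by
    rw [orthonormal_iff_ite]
    intro i j
    fin_cases i <;> fin_cases j <;>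
      simp [inner_smul_left, inner_smul_right, h.ne, h.nv, h.ev,
        real_inner_comm n e, real_inner_comm n v, real_inner_comm e v]
    · rw [← sq_eq_sq₀ (norm_nonneg _) zero_le_one, ← real_inner_self_eq_norm_sq, h.nn]; norm_num
    · rw [← sq_eq_sq₀ (norm_nonneg _) zero_le_one, ← real_inner_self_eq_norm_sq,
        inner_smul_left, inner_smul_right, h.ee]
      simp [← mul_assoc, ha, h.pos_a.ne']
    · rw [← sq_eq_sq₀ (norm_nonneg _) zero_le_one, ← real_inner_self_eq_norm_sq,
        inner_smul_left, inner_smul_right, h.vv]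
      simp [← mul_assoc, hd, h.pos_d.ne']
  obtain ⟨b, hb⟩ := exists_orthonormalBasis_of_orthonormal hw
  exact ⟨b, by simp [hb], by simp [hb], by simp [hb]⟩

theorem IsOrthogonalFrame.expand (h : IsOrthogonalFrame n e v a d) (z : E3) :
    z = inner ℝ n z • n + (a * inner ℝ e z) • e + (d * inner ℝ v z) • v := by
  obtain ⟨b, h0, h1, h2⟩ := h.exists_basis
  have := b.sum_repr' z
  rw [Fin.sum_univ_three, h0, h1, h2] at this
  conv_lhs => rw [← this]
  rw [inner_smul_left, inner_smul_left, smul_smul, smul_smul]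
  simp only [conj_trivial]
  rw [mul_right_comm, Real.mul_self_sqrt h.pos_a.le, mul_right_comm,
    Real.mul_self_sqrt h.pos_d.le]

theorem IsOrthogonalFrame.inner_self (h : IsOrthogonalFrame n e v a d) (z : E3) :
    inner ℝ z z = inner ℝ n z ^ 2 + a * inner ℝ e z ^ 2 + d * inner ℝ v z ^ 2 := by
  conv_lhs => arg 2; rw [h.expand z]
  simp only [inner_add_left, inner_smul_left, conj_trivial]
  ring

/-- Both frames become orthonormal bases after the same rescaling by √a and √d, so the map carrying
the primed frame to the unprimed one is orthogonal; the weights come from that rescaling. -/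
theorem IsOrthogonalFrame.exists_isometry {n' e' v' : E3} (h : IsOrthogonalFrame n e v a d)
    (h' : IsOrthogonalFrame n' e' v' a d) : ∃ M : E3 ≃ₗᵢ[ℝ] E3, ∀ u,
      M u = inner ℝ n' u • n + (a * inner ℝ e' u) • e + (d * inner ℝ v' u) • v := by
  obtain ⟨b, h0, h1, h2⟩ := h.exists_basis
  obtain ⟨b', h0', h1', h2'⟩ := h'.exists_basis
  have ha := Real.mul_self_sqrt h.pos_a.le
  have hd := Real.mul_self_sqrt h.pos_d.le
  refine ⟨b'.equiv b (Equiv.refl _), fun u => ?_⟩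
  conv_lhs => rw [← b'.sum_repr' u]
  rw [map_sum, Fin.sum_univ_three]
  simp only [map_smul, OrthonormalBasis.equiv_apply_basis, Equiv.refl_apply]
  rw [h0, h1, h2, h0', h1', h2']
  simp only [inner_smul_left, conj_trivial, smul_smul]
  rw [mul_right_comm, ha, mul_right_comm, hd]

end OrthogonalFrames

/-! ### Gauss maps in natural coordinates -/

/-- The functions `F = φ₁ - y φ₀` and `H = φ₁' - y φ₀'`, with `f = φ₀`, `g = φ₀'`. -/
structure IsNaturalPair (R : Set (ℝ × ℝ)) (x y F H f g : ℝ × ℝ → ℝ) : Prop where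
  smooth_F : ContDiffOn ℝ ∞ F R
  smooth_H : ContDiffOn ℝ ∞ H R
  diff_F : HasDifferential R x y F H (fun p => -f p)
  diff_H : ∃ Hx, HasDifferential R x y H Hx (fun p => -g p)
  det : ∀ p ∈ R, f p * H p - g p * F p = 1
  pos_F : ∀ p ∈ R, 0 < F p
  pos_H : ∀ p ∈ R, 0 < H p

/-- The Wronskian relation `det` is what turns the y-derivative of H/F into 1/F²; it becomes the
coefficient of c - n in `diff_v`. -/
theorem IsNaturalPair.diff_quotient {R : Set (ℝ × ℝ)} {x y F H f g : ℝ × ℝ → ℝ}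
    (h : IsNaturalPair R x y F H f g) :
    ∃ px, HasDifferential R x y (fun p => H p / F p) px (fun p => (F p ^ 2)⁻¹) := by
  obtain ⟨Hx, hH⟩ := h.diff_H
  refine ⟨_, (hH.div h.diff_F fun p hp => (h.pos_F p hp).ne').congr (fun _ _ => rfl)
    fun p hp => ?_⟩
  rw [div_eq_mul_inv]
  linear_combination (F p ^ 2)⁻¹ * h.det p hp

/-- A unit vector field `n` with third fundamental form `θ₁² / a + θ₂² / b`, diagonal in the
natural coordinates; `c` is the pole of the plane of the `y`-curve, `v = n_y`, and
`Q = b (φ₁' - y φ₀')²`. -/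
structure IsGaussField (R : Set (ℝ × ℝ)) (x y F H : ℝ × ℝ → ℝ) (n c v : ℝ × ℝ → E3)
    (a Q : ℝ × ℝ → ℝ) : Prop where
  smooth : ContDiffOn ℝ ∞ n R
  smooth_c : ContDiffOn ℝ ∞ c R
  smooth_v : ContDiffOn ℝ ∞ v R
  diff_n : HasDifferential R x y n (fun p => (H p / F p) • (c p - n p)) v
  diff_c : ∃ c', HasDifferential R x y c c' 0
  pos_a : ∀ p ∈ R, 0 < a p
  pos_Q : ∀ p ∈ R, 0 < Q p
  unit : ∀ p ∈ R, inner ℝ (n p) (n p) = (1 : ℝ)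
  orth : ∀ p ∈ R, inner ℝ (c p - n p) (v p) = (0 : ℝ)
  inner_e : ∀ p ∈ R, inner ℝ (c p - n p) (c p - n p) = (a p)⁻¹
  inner_v : ∀ p ∈ R, inner ℝ (v p) (v p) = (F p ^ 2 * Q p)⁻¹

namespace IsGaussField

variable {R : Set (ℝ × ℝ)} {x y F H f g : ℝ × ℝ → ℝ} {I J : Set ℝ} {G : ℝ × ℝ → ℝ × ℝ}
variable {n c v : ℝ × ℝ → E3} {a Q : ℝ × ℝ → ℝ}

/-- Orthogonality of n to the other two vectors comes from differentiating |n|² = 1, where H/F ≠ 0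
allows passing from n_x to c - n. -/
theorem frame (h : IsGaussField R x y F H n c v a Q) (hG : IsChartInverse R x y I J G)
    (hN : IsNaturalPair R x y F H f g) {p : ℝ × ℝ} (hp : p ∈ R) :
    IsOrthogonalFrame (n p) (c p - n p) (v p) (a p) (F p ^ 2 * Q p) := by
  have h1 := (h.diff_n.inner h.diff_n).congr_fun hG.isOpen h.unit
  have h2 := hG.unique h1 (HasDifferential.const (1 : ℝ)) hp
  have hF := hN.pos_F p hp
  have hH := hN.pos_H p hp
  have h3 : inner ℝ (n p) (c p - n p) = (0 : ℝ) := by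
    have := h2.1
    rw [inner_smul_left, inner_smul_right, real_inner_comm (n p)] at this
    simp only [conj_trivial, Pi.zero_apply] at this
    have h4 : H p / F p ≠ 0 := by positivity
    apply mul_left_cancel₀ h4
    linarith
  have h4 : inner ℝ (n p) (v p) = (0 : ℝ) := by
    have := h2.2
    rw [real_inner_comm (n p) (v p)] at this
    simp only [Pi.zero_apply] at this
    linarith
  exact ⟨h.pos_a p hp, mul_pos (by positivity) (h.pos_Q p hp), h.unit p hp, h.inner_e p hp,
    h.inner_v p hp, h3, h4, h.orth p hp⟩

theorem diff_v (h : IsGaussField R x y F H n c v a Q) (hG : IsChartInverse R x y I J G)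
    (hN : IsNaturalPair R x y F H f g) : ∃ v', HasDifferential R x y v
      (fun p => (F p ^ 2)⁻¹ • (c p - n p) - (H p / F p) • v p) v' := by
  obtain ⟨v₁, v₂, -, -, hv⟩ := hG.exists_partials h.smooth_v
  obtain ⟨c', hc⟩ := h.diff_c
  obtain ⟨px, hpx⟩ := hN.diff_quotient
  refine ⟨v₂, hv.congr (fun p hp => ?_) fun _ _ => rfl⟩
  rw [← hG.mixed_partials h.diff_n (hpx.smul (hc.sub h.diff_n)) hv hp]
  simp only [Pi.zero_apply]
  module

theorem inner_c_n (h : IsGaussField R x y F H n c v a Q) (hG : IsChartInverse R x y I J G)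
    (hN : IsNaturalPair R x y F H f g) {p : ℝ × ℝ} (hp : p ∈ R) :
    inner ℝ (c p) (n p) = (1 : ℝ) := by
  have := (h.frame hG hN hp).ne
  rw [inner_sub_right, h.unit p hp, real_inner_comm] at this
  linarith

theorem inner_c_v (h : IsGaussField R x y F H n c v a Q) (hG : IsChartInverse R x y I J G)
    (hN : IsNaturalPair R x y F H f g) {p : ℝ × ℝ} (hp : p ∈ R) :
    inner ℝ (c p) (v p) = (0 : ℝ) := by
  have h1 := (h.frame hG hN hp).ev
  rw [inner_sub_left, (h.frame hG hN hp).nv] at h1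
  linarith

theorem inner_c_e (h : IsGaussField R x y F H n c v a Q) (hG : IsChartInverse R x y I J G)
    (hN : IsNaturalPair R x y F H f g) {p : ℝ × ℝ} (hp : p ∈ R) :
    inner ℝ (c p) (c p - n p) = (a p)⁻¹ := by
  have h1 := (h.frame hG hN hp).ee
  rw [inner_sub_left, (h.frame hG hN hp).ne] at h1
  linarith

/-- Since c·n = 1, one has 1/a = |c|² - 1; thus a inherits independence of y from c. -/
theorem diff_a (h : IsGaussField R x y F H n c v a Q) (hG : IsChartInverse R x y I J G)
    (hN : IsNaturalPair R x y F H f g) {c' : ℝ × ℝ → E3} (hc : HasDifferential R x y c c' 0) :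
    HasDifferential R x y a (fun p => -(2 * a p ^ 2 * inner ℝ (c p) (c' p))) 0 := by
  have h1 := ((hc.inner hc).sub (HasDifferential.const (1 : ℝ))).congr_fun (g := fun p => (a p)⁻¹)
    hG.isOpen (fun p hp => by
      rw [← h.inner_c_e hG hN hp, inner_sub_right, h.inner_c_n hG hN hp])
  have h2 := (h1.inv fun p hp => inv_ne_zero (h.pos_a p hp).ne').congr_fun hG.isOpen
    (fun p _ => inv_inv (a p))
  refine h2.congr (fun p hp => ?_) (fun p hp => ?_)
  · have := h.pos_a p hp
    simp only [Pi.zero_apply, real_inner_comm (c p) (c' p)]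
    field_simp
    ring
  · simp

/-- By `diff_v` the x-derivative of F v is (c - n)/F, which is orthogonal to v. Hence |F v|² = 1/Q
does not depend on x. -/
theorem diff_Q (h : IsGaussField R x y F H n c v a Q) (hG : IsChartInverse R x y I J G)
    (hN : IsNaturalPair R x y F H f g) : ∃ Qy, HasDifferential R x y Q 0 Qy := by
  obtain ⟨v', hv⟩ := h.diff_v hG hN
  have h1 : HasDifferential R x y Q _ _ :=
    (((hN.diff_F.mul hN.diff_F).mul (hv.inner hv)).inv (fun p hp => by
      have := (h.frame hG hN hp).pos_d
      have h2 := hN.pos_F p hp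
      rw [h.inner_v p hp]; positivity)).congr_fun hG.isOpen (fun p hp => by
        have := h.pos_Q p hp
        have h2 := hN.pos_F p hp
        rw [h.inner_v p hp]
        field_simp)
  refine ⟨_, h1.congr (fun p hp => ?_) (fun _ _ => rfl)⟩
  have h2 := hN.pos_F p hp
  simp only [Pi.zero_apply, inner_sub_right, inner_sub_left, inner_smul_left, inner_smul_right,
    conj_trivial]
  rw [div_eq_zero_iff]
  left
  have h3 := (h.frame hG hN hp).ev
  have h4 := (h.frame hG hN hp).nv
  have h5 := h.inner_c_v hG hN hp
  rw [real_inner_comm (n p) (v p), real_inner_comm (c p) (v p), h4, h5]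
  field_simp
  ring

theorem inner_c'_n (h : IsGaussField R x y F H n c v a Q) (hG : IsChartInverse R x y I J G)
    (hN : IsNaturalPair R x y F H f g) {c' : ℝ × ℝ → E3} (hc : HasDifferential R x y c c' 0)
    {p : ℝ × ℝ} (hp : p ∈ R) : inner ℝ (n p) (c' p) = -(H p / F p / a p) := by
  have h1 := (hc.inner h.diff_n).congr_fun hG.isOpen (fun p hp => h.inner_c_n hG hN hp)
  have h2 := (hG.unique h1 (HasDifferential.const (1 : ℝ)) hp).1
  simp only [inner_smul_right, h.inner_c_e hG hN hp, Pi.zero_apply] at h2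
  rw [real_inner_comm]
  linear_combination h2

theorem inner_c'_v (h : IsGaussField R x y F H n c v a Q) (hG : IsChartInverse R x y I J G)
    (hN : IsNaturalPair R x y F H f g) {c' : ℝ × ℝ → E3} (hc : HasDifferential R x y c c' 0)
    {p : ℝ × ℝ} (hp : p ∈ R) : inner ℝ (v p) (c' p) = -((F p ^ 2)⁻¹ / a p) := by
  obtain ⟨v', hv⟩ := h.diff_v hG hN
  have h1 := (hc.inner hv).congr_fun hG.isOpen (fun p hp => h.inner_c_v hG hN hp)
  have h2 := (hG.unique h1 (HasDifferential.const (0 : ℝ)) hp).1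
  rw [inner_sub_right (c p), inner_smul_right, inner_smul_right, h.inner_c_e hG hN hp,
    h.inner_c_v hG hN hp] at h2
  simp only [Pi.zero_apply] at h2
  rw [real_inner_comm]
  linear_combination h2

theorem inner_c'_e (h : IsGaussField R x y F H n c v a Q) (hG : IsChartInverse R x y I J G)
    (hN : IsNaturalPair R x y F H f g) {c' : ℝ × ℝ → E3} (hc : HasDifferential R x y c c' 0)
    {a' a₂ : ℝ × ℝ → ℝ} (ha : HasDifferential R x y a a' a₂)
    {p : ℝ × ℝ} (hp : p ∈ R) :
    inner ℝ (c p - n p) (c' p) = -(a' p / (2 * a p ^ 2)) + H p / F p / a p := by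
  have h1 := (hG.unique ha (h.diff_a hG hN hc) hp).1
  have := h.pos_a p hp
  rw [inner_sub_left, h.inner_c'_n hG hN hc hp, h1]
  field_simp
  ring

/-- Parseval for c' in the orthogonal frame: the components follow by differentiating c·n = 1, c·v =
0 and |c|² = 1 + 1/a. The weight F²Q of v enters |c'|² linearly, so the identity can be solved for
Q. -/
theorem Q_eq (h : IsGaussField R x y F H n c v a Q) (hG : IsChartInverse R x y I J G)
    (hN : IsNaturalPair R x y F H f g) {c' : ℝ × ℝ → E3} (hc : HasDifferential R x y c c' 0)
    {a' a₂ : ℝ × ℝ → ℝ} (ha : HasDifferential R x y a a' a₂)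
    {p : ℝ × ℝ} (hp : p ∈ R) :
    Q p = (a p ^ 2 * inner ℝ (c' p) (c' p) - a' p ^ 2 / (4 * a p)) * F p ^ 2 +
      a' p * (F p * H p) - (1 + a p) * H p ^ 2 := by
  have h1 := h.pos_a p hp
  have h2 := hN.pos_F p hp
  rw [(h.frame hG hN hp).inner_self (c' p), h.inner_c'_n hG hN hc hp, h.inner_c'_v hG hN hc hp,
    h.inner_c'_e hG hN hc ha hp]
  field_simp
  ring

/-- With `diff_n` and `diff_v_of_diff` this closes the frame equations: the coefficients involve
only F, H, a, Q and their derivatives, not the particular field. -/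
theorem diff_e (h : IsGaussField R x y F H n c v a Q) (hG : IsChartInverse R x y I J G)
    (hN : IsNaturalPair R x y F H f g) {a' a₂ : ℝ × ℝ → ℝ} (ha : HasDifferential R x y a a' a₂) :
    HasDifferential R x y (fun p => c p - n p)
      (fun p => (-(H p / F p / a p)) • n p + (-(a' p / (2 * a p))) • (c p - n p) +
        (-(Q p / a p)) • v p) (fun p => -v p) := by
  obtain ⟨c', hc⟩ := h.diff_c
  refine (hc.sub h.diff_n).congr (fun p hp => ?_) (fun p _ => by simp)
  have h1 := h.pos_a p hp
  have h2 := hN.pos_F p hp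
  rw [(h.frame hG hN hp).expand (c' p), h.inner_c'_n hG hN hc hp, h.inner_c'_v hG hN hc hp,
    h.inner_c'_e hG hN hc ha hp]
  match_scalars <;> field_simp <;> ring

theorem diff_v_of_diff (h : IsGaussField R x y F H n c v a Q) (hG : IsChartInverse R x y I J G)
    (hN : IsNaturalPair R x y F H f g) {d₁ d₂ : ℝ × ℝ → ℝ}
    (hd : HasDifferential R x y (fun p => F p ^ 2 * Q p) d₁ d₂) :
    HasDifferential R x y v
      (fun p => (F p ^ 2)⁻¹ • (c p - n p) - (H p / F p) • v p)
      (fun p => (-(F p ^ 2 * Q p)⁻¹) • n p + (a p / (F p ^ 2 * Q p)) • (c p - n p) +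
        (-(d₂ p / (2 * (F p ^ 2 * Q p)))) • v p) := by
  obtain ⟨v', hv⟩ := h.diff_v hG hN
  refine hv.congr (fun p hp => rfl) (fun p hp => ?_)
  have hfr := h.frame hG hN hp
  have h1 := h.pos_a p hp
  have h2 := hN.pos_F p hp
  have h3 := h.pos_Q p hp
  have e1 : inner ℝ (n p) (v' p) = -(F p ^ 2 * Q p)⁻¹ := by
    have e := (h.diff_n.inner hv).congr_fun hG.isOpen (fun p hp => (h.frame hG hN hp).nv)
    have e' := (hG.unique e (HasDifferential.const (0 : ℝ)) hp).2
    rw [hfr.vv] at e'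
    simp only [Pi.zero_apply] at e'
    linarith
  have e2 : inner ℝ (c p) (v' p) = (0 : ℝ) := by
    obtain ⟨c', hc⟩ := h.diff_c
    have e := (hc.inner hv).congr_fun hG.isOpen (fun p hp => h.inner_c_v hG hN hp)
    have e' := (hG.unique e (HasDifferential.const (0 : ℝ)) hp).2
    simpa using e'
  have e3 : inner ℝ (v p) (v' p) = -(d₂ p / (2 * (F p ^ 2 * Q p) ^ 2)) := by
    have e := (hv.inner hv).congr_fun hG.isOpen h.inner_v
    have e' := (hG.unique e (hd.inv fun p hp => (h.frame hG hN hp).pos_d.ne') hp).2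
    rw [real_inner_comm (v p) (v' p)] at e'
    have : (-(d₂ p / (2 * (F p ^ 2 * Q p) ^ 2)) : ℝ) = (-d₂ p / (F p ^ 2 * Q p) ^ 2) / 2 := by
      field_simp
    rw [this, ← e']
    ring
  rw [hfr.expand (v' p), e1, e3, inner_sub_left, e1, e2]
  match_scalars <;> field_simp <;> ring

/-- Gauss maps with the same third fundamental form differ by an orthogonal transformation. -/
theorem exists_isometry {n' c' v' : ℝ × ℝ → E3} (h : IsGaussField R x y F H n c v a Q)
    (h' : IsGaussField R x y F H n' c' v' a Q) (hG : IsChartInverse R x y I J G)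
    (hN : IsNaturalPair R x y F H f g) (hne : R.Nonempty) :
    ∃ M : E3 ≃ₗᵢ[ℝ] E3, ∀ p ∈ R, n p = M (n' p) := by
  obtain ⟨p₀, hp₀⟩ := hne
  obtain ⟨c₁, hc₁⟩ := h.diff_c
  have ha := h.diff_a hG hN hc₁
  set a' : ℝ × ℝ → ℝ := fun p => -(2 * a p ^ 2 * inner ℝ (c p) (c₁ p))
  obtain ⟨Qy, hQ⟩ := h.diff_Q hG hN
  have hd : HasDifferential R x y (fun p => F p ^ 2 * Q p) _ _ :=
    ((hN.diff_F.mul hN.diff_F).mul hQ).congr_fun hG.isOpen (fun p _ => by ring)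
  obtain ⟨d₂, hd⟩ : ∃ d₂, HasDifferential R x y (fun p => F p ^ 2 * Q p)
      (fun p => 2 * F p * H p * Q p) d₂ :=
    ⟨_, hd.congr (fun p _ => by simp only [Pi.zero_apply]; ring) fun _ _ => rfl⟩
  obtain ⟨M, hM⟩ := (h.frame hG hN hp₀).exists_isometry (h'.frame hG hN hp₀)
  refine ⟨M, fun p hp => ?_⟩
  -- At each point this is the orthogonal map from the primed to the unprimed frame, applied to a
  -- fixed u. Both frames satisfy the same linear system, so the map does not vary; at `p₀` it is
  -- `M`.
  have key : ∀ u : E3, HasDifferential R x y (fun p => inner ℝ (n' p) u • n p +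
      (a p * inner ℝ (c' p - n' p) u) • (c p - n p) +
      (F p ^ 2 * Q p * inner ℝ (v' p) u) • v p) 0 0 := by
    intro u
    have hu := HasDifferential.const (R := R) (x := x) (y := y) u
    have e1 := (h'.diff_n.inner hu).smul h.diff_n
    have e2 := (ha.mul ((h'.diff_e hG hN ha).inner hu)).smul (h.diff_e hG hN ha)
    have e3 := (hd.mul ((h'.diff_v_of_diff hG hN hd).inner hu)).smul (h.diff_v_of_diff hG hN hd)
    refine ((e1.add e2).add e3).congr (fun p hp => ?_) (fun p hp => ?_)
    all_goals
      have h1 := h.pos_a p hp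
      have h2 := hN.pos_F p hp
      have h3 := h.pos_Q p hp
      simp only [Pi.zero_apply, inner_zero_right, inner_add_left, inner_sub_left, inner_neg_left,
        inner_smul_left, conj_trivial]
      match_scalars <;> field_simp <;> ring
  have := hG.eq_of_hasDifferential_zero (key (n' p)) hp₀ hp
  rw [← hM, h'.unit p hp, real_inner_comm, (h'.frame hG hN hp).ne, real_inner_comm,
    (h'.frame hG hN hp).nv] at this
  rw [this]
  simp

end IsGaussField

theorem quadratic_coeffs_eq_zero {J : Set ℝ} (hJ : IsOpen J) {t₀ : ℝ} (ht₀ : t₀ ∈ J) {α β γ : ℝ}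
    (h : ∀ t ∈ J, α + β * t + γ * t ^ 2 = 0) : α = 0 ∧ β = 0 ∧ γ = 0 := by
  obtain ⟨ε, hε, hb⟩ := Metric.isOpen_iff.1 hJ t₀ ht₀
  have h1 := h t₀ ht₀
  have h2 := h (t₀ + ε / 2) (hb (by simp [abs_of_pos hε]; linarith))
  have h3 := h (t₀ - ε / 2) (hb (by simp [abs_of_pos hε]; linarith))
  have hγ : γ = 0 := by
    have : ε ^ 2 * γ = 0 := by linear_combination 2 * h2 + 2 * h3 - 4 * h1
    simpa [hε.ne'] using this
  subst hγ
  have hβ : β = 0 := by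
    have : ε * β = 0 := by linear_combination h2 - h3
    simpa [hε.ne'] using this
  subst hβ
  exact ⟨by linarith, rfl, rfl⟩

namespace IsChartInverse

variable {R : Set (ℝ × ℝ)} {x y : ℝ × ℝ → ℝ} {I J : Set ℝ} {G : ℝ × ℝ → ℝ × ℝ}
variable {E : Type*} [NormedAddCommGroup E] [NormedSpace ℝ E]

theorem swap (h : IsChartInverse R x y I J G) :
    IsChartInverse R y x J I (fun q => G (q.2, q.1)) where
  isOpen := h.isOpen
  isOpen_fst := h.isOpen_snd
  isOpen_snd := h.isOpen_fst
  ordConnected_fst := h.ordConnected_snd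
  ordConnected_snd := h.ordConnected_fst
  smooth_x := h.smooth_y
  smooth_y := h.smooth_x
  smooth := h.smooth.comp (contDiffOn_snd.prodMk contDiffOn_fst) fun _ hq => ⟨hq.2, hq.1⟩
  x_mem := h.y_mem
  y_mem := h.x_mem
  maps := fun s hs t ht => h.maps t ht s hs
  left_inv := h.left_inv
  x_apply := fun s hs t ht => h.y_apply t ht s hs
  y_apply := fun s hs t ht => h.x_apply t ht s hs

theorem eq_of_y_eq (h : IsChartInverse R x y I J G) {f Q : ℝ × ℝ → E}
    (hf : HasDifferential R x y f 0 Q) {p p' : ℝ × ℝ} (hp : p ∈ R) (hp' : p' ∈ R)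
    (hy : y p = y p') : f p = f p' := h.swap.eq_of_x_eq hf.swap hp hp' hy

theorem isOpen_image_x (h : IsChartInverse R x y I J G) : IsOpen (x '' R) := by
  rw [isOpen_iff_mem_nhds]
  rintro _ ⟨p, hp, rfl⟩
  filter_upwards [h.isOpen_fst.mem_nhds (h.x_mem p hp)] with s hs
  exact ⟨G (s, y p), h.maps s hs _ (h.y_mem p hp), h.x_apply s hs _ (h.y_mem p hp)⟩

/-- The coordinate vector fields. -/
theorem exists_coordinate_vectors (h : IsChartInverse R x y I J G) {p : ℝ × ℝ} (hp : p ∈ R) :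
    ∃ e₁ e₂ : ℝ × ℝ, fderiv ℝ x p e₁ = 1 ∧ fderiv ℝ y p e₁ = 0 ∧ fderiv ℝ x p e₂ = 0 ∧
      fderiv ℝ y p e₂ = 1 ∧ ∀ v, v = fderiv ℝ x p v • e₁ + fderiv ℝ y p v • e₂ := by
  have h1 := h.fderiv_x_comp (h.x_mem p hp) (h.y_mem p hp)
  have h2 := h.fderiv_y_comp (h.x_mem p hp) (h.y_mem p hp)
  rw [h.left_inv p hp] at h1 h2
  exact ⟨_, _, congrArg (fun L => L (1, 0)) h1, congrArg (fun L => L (1, 0)) h2,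
    congrArg (fun L => L (0, 1)) h1, congrArg (fun L => L (0, 1)) h2, h.eq_sum_frame hp⟩

end IsChartInverse

theorem HasDifferential.fderiv_apply {R : Set (ℝ × ℝ)} {x y : ℝ × ℝ → ℝ} {E : Type*}
    [NormedAddCommGroup E] [NormedSpace ℝ E] {f P Q : ℝ × ℝ → E}
    (h : HasDifferential R x y f P Q) {p : ℝ × ℝ} (hp : p ∈ R) (v : ℝ × ℝ) :
    fderiv ℝ f p v = fderiv ℝ x p v • P p + fderiv ℝ y p v • Q p := by
  rw [(h p hp).fderiv]
  rfl

/-- The explicit shape of the third fundamental form of a Gauss map. -/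
theorem IsGaussField.exists_constants {R : Set (ℝ × ℝ)} {x y F H f₀ g₀ f₁ g₁ : ℝ × ℝ → ℝ}
    {I J : Set ℝ} {G : ℝ × ℝ → ℝ × ℝ} {n c v : ℝ × ℝ → E3} {a Q : ℝ × ℝ → ℝ}
    (h : IsGaussField R x y F H n c v a Q) (hG : IsChartInverse R x y I J G)
    (hN : IsNaturalPair R x y F H f₀ g₀)
    (hF : ∀ p ∈ R, F p = f₁ p - y p * f₀ p) (hH : ∀ p ∈ R, H p = g₁ p - y p * g₀ p)
    (h0 : ∀ p ∈ R, ∀ p' ∈ R, x p = x p' →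
      f₀ p = f₀ p' ∧ g₀ p = g₀ p' ∧ f₁ p = f₁ p' ∧ g₁ p = g₁ p') (hne : R.Nonempty) :
    ∃ c₀ c₁ c₂ : ℝ, ∀ p ∈ R,
      a p = -1 - c₀ * f₀ p ^ 2 - 2 * c₁ * f₀ p * f₁ p - c₂ * f₁ p ^ 2 ∧
      Q p = c₀ + 2 * c₁ * y p + c₂ * y p ^ 2 := by
  obtain ⟨p₀, hp₀⟩ := hne
  obtain ⟨c', hc⟩ := h.diff_c
  have hc's := (hG.contDiffOn_partials h.smooth_c hc).1
  obtain ⟨c₁, c₂, -, -, hc'⟩ := hG.exists_partials hc's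
  have hc'0 : HasDifferential R x y c' c₁ 0 := hc'.congr (fun _ _ => rfl) fun p hp =>
    hG.mixed_partials hc hc' (HasDifferential.const 0) hp
  have ha := h.diff_a hG hN hc
  set a' : ℝ × ℝ → ℝ := fun p => -(2 * a p ^ 2 * inner ℝ (c p) (c' p)) with ha'
  set k : ℝ × ℝ → ℝ := fun p => a p ^ 2 * inner ℝ (c' p) (c' p) - a' p ^ 2 / (4 * a p) with hk
  have hx : ∀ p ∈ R, ∀ p' ∈ R, x p = x p' → a p = a p' ∧ a' p = a' p' ∧ k p = k p' := by
    intro p hp p' hp' hxx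
    have e1 := hG.eq_of_x_eq ha hp hp' hxx
    have e2 := hG.eq_of_x_eq hc hp hp' hxx
    have e3 := hG.eq_of_x_eq hc'0 hp hp' hxx
    simp only [ha', hk, e1, e2, e3, and_self]
  -- On the y-line through p the coefficients k, a', a are frozen, so Q is a quadratic polynomial in
  -- the second coordinate t.
  have hQ : ∀ p ∈ R, ∀ t ∈ J, Q (G (x p, t)) = k p * (f₁ p - t * f₀ p) ^ 2 +
      a' p * ((f₁ p - t * f₀ p) * (g₁ p - t * g₀ p)) - (1 + a p) * (g₁ p - t * g₀ p) ^ 2 := by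
    intro p hp t ht
    have hq := hG.maps _ (hG.x_mem p hp) t ht
    have hxq := hG.x_apply _ (hG.x_mem p hp) t ht
    obtain ⟨e1, e2, e3⟩ := hx _ hq p hp hxq
    obtain ⟨e4, e5, e6, e7⟩ := h0 _ hq p hp hxq
    rw [h.Q_eq hG hN hc ha hq, hF _ hq, hH _ hq, e4, e5, e6, e7,
      hG.y_apply _ (hG.x_mem p hp) t ht, ← e1, ← e2, ← e3]
  obtain ⟨Qy, hQy⟩ := h.diff_Q hG hN
  -- The constants are read off from the polynomial on the y-line through `p₀`; the middle one is
  -- half the coefficient of t.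
  refine ⟨k p₀ * f₁ p₀ ^ 2 + a' p₀ * f₁ p₀ * g₁ p₀ - (1 + a p₀) * g₁ p₀ ^ 2,
    -k p₀ * f₀ p₀ * f₁ p₀ - a' p₀ * (f₀ p₀ * g₁ p₀ + f₁ p₀ * g₀ p₀) / 2 +
      (1 + a p₀) * g₀ p₀ * g₁ p₀,
    k p₀ * f₀ p₀ ^ 2 + a' p₀ * f₀ p₀ * g₀ p₀ - (1 + a p₀) * g₀ p₀ ^ 2, fun p hp => ?_⟩
  have hQQ : ∀ t ∈ J, Q (G (x p, t)) = Q (G (x p₀, t)) := fun t ht =>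
    hG.eq_of_y_eq hQy (hG.maps _ (hG.x_mem p hp) t ht) (hG.maps _ (hG.x_mem p₀ hp₀) t ht) (by
      rw [hG.y_apply _ (hG.x_mem p hp) t ht, hG.y_apply _ (hG.x_mem p₀ hp₀) t ht])
  constructor
  · have hdet := hN.det p hp
    rw [hF p hp, hH p hp] at hdet
    have hdet : f₀ p * g₁ p - f₁ p * g₀ p = 1 := by linear_combination hdet
    obtain ⟨e1, e2, e3⟩ := quadratic_coeffs_eq_zero hG.isOpen_snd (hG.y_mem p hp)
      (α := k p * f₁ p ^ 2 + a' p * f₁ p * g₁ p - (1 + a p) * g₁ p ^ 2 -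
        (k p₀ * f₁ p₀ ^ 2 + a' p₀ * f₁ p₀ * g₁ p₀ - (1 + a p₀) * g₁ p₀ ^ 2))
      (β := (-2 * k p * f₀ p * f₁ p - a' p * (f₀ p * g₁ p + f₁ p * g₀ p) +
        2 * (1 + a p) * g₀ p * g₁ p) - (-2 * k p₀ * f₀ p₀ * f₁ p₀ -
        a' p₀ * (f₀ p₀ * g₁ p₀ + f₁ p₀ * g₀ p₀) + 2 * (1 + a p₀) * g₀ p₀ * g₁ p₀))
      (γ := k p * f₀ p ^ 2 + a' p * f₀ p * g₀ p - (1 + a p) * g₀ p ^ 2 -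
        (k p₀ * f₀ p₀ ^ 2 + a' p₀ * f₀ p₀ * g₀ p₀ - (1 + a p₀) * g₀ p₀ ^ 2))
      (fun t ht => by
        have := hQQ t ht
        rw [hQ p hp t ht, hQ p₀ hp₀ t ht] at this
        linear_combination this)
    -- Homogeneous evaluation of the polynomial at t = f₁/f₀, the zero of F, without dividing by f₀.
    -- There only -(1 + a)H² survives, and the Wronskian gives f₀H = 1.
    linear_combination (-f₀ p ^ 2) * e1 - f₀ p * f₁ p * e2 - f₁ p ^ 2 * e3 -
      (1 + a p) * (f₀ p * g₁ p - f₁ p * g₀ p + 1) * hdet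
  · have := hQQ _ (hG.y_mem p hp)
    rw [hG.left_inv p hp] at this
    rw [this, hQ p₀ hp₀ _ (hG.y_mem p hp)]
    ring

/-! ### Curvature equations -/

theorem IsPrincipalCoordinates.swap {R : Set (ℝ × ℝ)} {S : ℝ × ℝ → (ℝ × ℝ →L[ℝ] ℝ × ℝ)}
    {A B x y : ℝ × ℝ → ℝ} (h : IsPrincipalCoordinates R S A B x y) :
    IsPrincipalCoordinates R S B A y x where
  isOpen := h.isOpen
  smooth_fst := h.smooth_snd
  smooth_snd := h.smooth_fst
  indep := fun p hp => by
    have := h.indep p hp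
    rw [LinearIndependent.pair_iff] at this ⊢
    intro s t hst
    exact (this t s (by rwa [add_comm])).symm
  injOn := fun p hp q hq hpq => h.injOn hp hq (by simpa [and_comm] using hpq)
  rectangle := by
    obtain ⟨I, J, h1, h2, h3, h4, h5⟩ := h.rectangle
    refine ⟨J, I, h3, h4, h1, h2, ?_⟩
    rw [← Set.image_swap_prod, ← h5, Set.image_image]
    rfl
  diag_fst := h.diag_snd
  diag_snd := h.diag_fst

/-- Relabelling the eigenvalues exchanges θ₁ and θ₂, hence the two systems. This reduces the dual
case to the first system. -/
theorem IsTypeI.swap {D : Set (ℝ × ℝ)} {S : ℝ × ℝ → (ℝ × ℝ →L[ℝ] ℝ × ℝ)} {A B : ℝ × ℝ → ℝ}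
    (h : IsTypeI D S A B) : IsTypeI D S B A where
  curvatures := ⟨h.curvatures.smooth_op, h.curvatures.smooth_snd, h.curvatures.smooth_fst,
    h.curvatures.eigen_snd, h.curvatures.eigen_fst, fun p hp => (h.curvatures.ne p hp).symm⟩
  fst_ne_zero := h.snd_ne_zero
  snd_ne_zero := h.fst_ne_zero
  nondeg_fst := h.nondeg_snd
  nondeg_snd := h.nondeg_fst
  system := h.system.symm

section Curvature

variable {D R : Set (ℝ × ℝ)} {S : ℝ × ℝ → (ℝ × ℝ →L[ℝ] ℝ × ℝ)} {A B x y : ℝ × ℝ → ℝ}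
  {I J : Set ℝ} {G : ℝ × ℝ → ℝ × ℝ}

theorem IsPrincipalCoordinates.dPrin_eq (h : IsPrincipalCoordinates R S A B x y)
    {f P Q : ℝ × ℝ → ℝ} (hf : HasDifferential R x y f P Q) {p : ℝ × ℝ} (hp : p ∈ R)
    (hne : A p ≠ B p) : dPrin S A B f p = P p • fderiv ℝ x p := by
  refine ContinuousLinearMap.ext fun v => ?_
  have h1 := congrArg (fun L => L v) (h.diag_fst p hp)
  have h2 := congrArg (fun L => L v) (h.diag_snd p hp)
  simp only [ContinuousLinearMap.comp_apply, _root_.smul_apply, smul_eq_mul] at h1 h2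
  have h3 : A p - B p ≠ 0 := sub_ne_zero.2 hne
  simp only [dPrin, _root_.smul_apply, ContinuousLinearMap.comp_apply, hf.fderiv_apply hp,
    sub_apply, ContinuousLinearMap.id_apply, map_sub, map_smul, smul_eq_mul, h1, h2]
  field_simp
  ring

theorem IsPrincipalCoordinates.theta₁_eq (h : IsPrincipalCoordinates R S A B x y)
    {P Q : ℝ × ℝ → ℝ} (hf : HasDifferential R x y B P Q) {p : ℝ × ℝ} (hp : p ∈ R)
    (hne : A p ≠ B p) :
    theta₁ S A B p = (A p / (B p * (B p - A p)) * P p) • fderiv ℝ x p := by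
  rw [theta₁, h.dPrin_eq hf hp hne, smul_smul]

theorem IsPrincipalCoordinates.theta₂_eq (h : IsPrincipalCoordinates R S A B x y)
    {P Q : ℝ × ℝ → ℝ} (hf : HasDifferential R x y A P Q) {p : ℝ × ℝ} (hp : p ∈ R)
    (hne : A p ≠ B p) :
    theta₂ S A B p = (B p / (A p * (A p - B p)) * Q p) • fderiv ℝ y p :=
  h.swap.theta₁_eq hf.swap hp hne.symm

/-- The Codazzi equation for `1 / B` in terms of the coefficient `P` of `θ₁ = P dx`. -/
theorem IsPrincipalCoordinates.diff_inv_snd (h : IsPrincipalCoordinates R S A B x y)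
    (hS : IsTypeI D S A B) (hR : R ⊆ D) (hG : IsChartInverse R x y I J G) {P : ℝ × ℝ → ℝ}
    (hP : ∀ p ∈ R, theta₁ S A B p = P p • fderiv ℝ x p) :
    ∃ Vy, HasDifferential R x y (fun p => (B p)⁻¹)
      (fun p => -(P p * ((A p)⁻¹ - (B p)⁻¹))) Vy := by
  obtain ⟨B₁, B₂, -, -, hB⟩ := hG.exists_partials (hS.curvatures.smooth_snd.mono hR)
  refine ⟨_, (hB.inv fun p hp => hS.snd_ne_zero p (hR hp)).congr (fun p hp => ?_) fun _ _ => rfl⟩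
  have hne := hS.curvatures.ne p (hR hp)
  have h1 := hP p hp
  rw [h.theta₁_eq hB hp hne] at h1
  obtain ⟨e₁, e₂, he, -⟩ := hG.exists_coordinate_vectors hp
  have h2 := congrArg (fun L => L e₁) h1
  simp only [_root_.smul_apply, he, smul_eq_mul, mul_one] at h2
  rw [← h2]
  have hA := hS.fst_ne_zero p (hR hp)
  have hB := hS.snd_ne_zero p (hR hp)
  have hAB : B p - A p ≠ 0 := sub_ne_zero.2 hne.symm
  field_simp

theorem IsPrincipalCoordinates.diff_inv_fst (h : IsPrincipalCoordinates R S A B x y)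
    (hS : IsTypeI D S A B) (hR : R ⊆ D) (hG : IsChartInverse R x y I J G) {Q : ℝ × ℝ → ℝ}
    (hQ : ∀ p ∈ R, theta₂ S A B p = Q p • fderiv ℝ y p) :
    ∃ Ux, HasDifferential R x y (fun p => (A p)⁻¹) Ux
      (fun p => Q p * ((A p)⁻¹ - (B p)⁻¹)) := by
  obtain ⟨Ux, hU⟩ := h.swap.diff_inv_snd hS.swap hR hG.swap hQ
  exact ⟨Ux, hU.swap.congr (fun _ _ => rfl) fun p _ => by ring⟩

/-! ### Realizations and Gauss maps -/

/-- Weingarten equations: orthogonality and the relation between the Gauss map and the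
immersion in principal coordinates. -/
theorem IsRealization.weingarten (h : IsPrincipalCoordinates R S A B x y)
    (hS : IsTypeI D S A B) (hR : R ⊆ D) (hG : IsChartInverse R x y I J G)
    {X n X₁ X₂ n₁ n₂ : ℝ × ℝ → E3} (hX : IsRealization R S X n)
    (hd : HasDifferential R x y X X₁ X₂) (hn : HasDifferential R x y n n₁ n₂)
    {p : ℝ × ℝ} (hp : p ∈ R) :
    n₁ p = -(A p • X₁ p) ∧ n₂ p = -(B p • X₂ p) ∧ inner ℝ (X₁ p) (X₂ p) = (0 : ℝ) ∧
      X₁ p ≠ 0 ∧ X₂ p ≠ 0 := by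
  obtain ⟨e₁, e₂, hx1, hy1, hx2, hy2, hsum⟩ := hG.exists_coordinate_vectors hp
  have hS1 : S p e₁ = A p • e₁ := by
    have h1 := congrArg (fun L => L e₁) (h.diag_fst p hp)
    have h2 := congrArg (fun L => L e₁) (h.diag_snd p hp)
    simp only [ContinuousLinearMap.comp_apply, _root_.smul_apply, hx1, hy1] at h1 h2
    rw [hsum (S p e₁), h1, h2]; simp
  have hS2 : S p e₂ = B p • e₂ := by
    have h1 := congrArg (fun L => L e₂) (h.diag_fst p hp)
    have h2 := congrArg (fun L => L e₂) (h.diag_snd p hp)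
    simp only [ContinuousLinearMap.comp_apply, _root_.smul_apply, hx2, hy2] at h1 h2
    rw [hsum (S p e₂), h1, h2]; simp
  have dX1 : fderiv ℝ X p e₁ = X₁ p := by simp [hd.fderiv_apply hp, hx1, hy1]
  have dX2 : fderiv ℝ X p e₂ = X₂ p := by simp [hd.fderiv_apply hp, hx2, hy2]
  have dn1 : fderiv ℝ n p e₁ = n₁ p := by simp [hn.fderiv_apply hp, hx1, hy1]
  have dn2 : fderiv ℝ n p e₂ = n₂ p := by simp [hn.fderiv_apply hp, hx2, hy2]
  have hX1 : X₁ p ≠ 0 := fun h0 => by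
    have : e₁ = 0 := hX.immersion p hp (by rw [dX1, h0, map_zero])
    simp [this] at hx1
  have hX2 : X₂ p ≠ 0 := fun h0 => by
    have : e₂ = 0 := hX.immersion p hp (by rw [dX2, h0, map_zero])
    simp [this] at hy2
  have s11 := (hX.shape p hp e₁ e₁).1
  have s12 := hX.shape p hp e₁ e₂
  have s21 := hX.shape p hp e₂ e₁
  have s22 := (hX.shape p hp e₂ e₂).1
  simp only [hS1, hS2, map_smul, dX1, dX2, dn1, dn2, inner_smul_left, inner_smul_right,
    conj_trivial] at s11 s12 s21 s22
  -- The two expressions for the second fundamental form on (e₁, e₂) carry the factors A and B, so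
  -- their difference is (A - B) X_x·X_y = 0.
  have hX12 : inner ℝ (X₁ p) (X₂ p) = (0 : ℝ) := by
    have hne : A p - B p ≠ 0 := sub_ne_zero.2 (hS.curvatures.ne p (hR hp))
    apply mul_left_cancel₀ hne
    linarith [s12.1, s12.2]
  have hX21 : inner ℝ (X₂ p) (X₁ p) = (0 : ℝ) := by rw [real_inner_comm, hX12]
  have nX1 := hX.normal p hp e₁
  have nX2 := hX.normal p hp e₂
  rw [dX1] at nX1
  rw [dX2] at nX2
  have hu : ∀ p ∈ R, inner ℝ (n p) (n p) = (1 : ℝ) := fun p hp => by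
    rw [real_inner_self_eq_norm_sq, hX.unit p hp, one_pow]
  have hnn := hG.unique ((hn.inner hn).congr_fun hG.isOpen hu) (HasDifferential.const (1 : ℝ)) hp
  rw [real_inner_comm (n p), real_inner_comm (n p)] at hnn
  simp only [Pi.zero_apply] at hnn
  have hf : IsOrthogonalFrame (n p) (X₁ p) (X₂ p) (inner ℝ (X₁ p) (X₁ p))⁻¹
      (inner ℝ (X₂ p) (X₂ p))⁻¹ :=
    ⟨inv_pos.2 (real_inner_self_pos.2 hX1), inv_pos.2 (real_inner_self_pos.2 hX2), hu p hp,
      by simp, by simp, nX1, nX2, hX12⟩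
  have p1 := (inv_pos.1 hf.pos_a).ne'
  have p2 := (inv_pos.1 hf.pos_d).ne'
  refine ⟨?_, ?_, hX12, hX1, hX2⟩
  · rw [hf.expand (n₁ p)]
    have i0 : inner ℝ (n p) (n₁ p) = (0 : ℝ) := by linarith [hnn.1]
    have i1 : inner ℝ (X₁ p) (n₁ p) = -(A p * inner ℝ (X₁ p) (X₁ p)) := by
      rw [real_inner_comm]; linarith
    have i2 : inner ℝ (X₂ p) (n₁ p) = (0 : ℝ) := by
      rw [real_inner_comm]; have := s12.1; rw [hX12] at this; linarith
    rw [i0, i1, i2]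
    match_scalars <;> field_simp
    ring
  · rw [hf.expand (n₂ p)]
    have i0 : inner ℝ (n p) (n₂ p) = (0 : ℝ) := by linarith [hnn.2]
    have i1 : inner ℝ (X₂ p) (n₂ p) = -(B p * inner ℝ (X₂ p) (X₂ p)) := by
      rw [real_inner_comm]; linarith
    have i2 : inner ℝ (X₁ p) (n₂ p) = (0 : ℝ) := by
      rw [real_inner_comm]; have := s21.1; rw [hX21] at this; linarith
    rw [i0, i1, i2]
    match_scalars <;> field_simp
    ring

/-- The immersion is recovered from the Gauss map. -/
theorem IsRealization.isRealizationIntegral (h : IsPrincipalCoordinates R S A B x y)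
    (hS : IsTypeI D S A B) (hR : R ⊆ D) (hG : IsChartInverse R x y I J G)
    {X n : ℝ × ℝ → E3} (hX : IsRealization R S X n) : IsRealizationIntegral R A B x y n X := by
  obtain ⟨X₁, X₂, -, -, hd⟩ := hG.exists_partials hX.smooth
  obtain ⟨n₁, n₂, -, -, hn⟩ := hG.exists_partials hX.smooth_normal
  refine ⟨n₁, n₂, hn, hd.congr (fun p hp => ?_) (fun p hp => ?_)⟩
  · rw [(hX.weingarten h hS hR hG hd hn hp).1, smul_neg, neg_neg, smul_smul,
      inv_mul_cancel₀ (hS.fst_ne_zero p (hR hp)), one_smul]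
  · rw [(hX.weingarten h hS hR hG hd hn hp).2.1, smul_neg, neg_neg, smul_smul,
      inv_mul_cancel₀ (hS.snd_ne_zero p (hR hp)), one_smul]

variable {F H f g : ℝ × ℝ → ℝ}

/-- The Gauss map of a realization. -/
theorem IsRealization.exists_gaussField (h : IsPrincipalCoordinates R S A B x y)
    (hS : IsTypeI D S A B) (hR : R ⊆ D) (hG : IsChartInverse R x y I J G)
    (hN : IsNaturalPair R x y F H f g)
    (h1 : ∀ p ∈ R, theta₁ S A B p = (H p / F p) • fderiv ℝ x p)
    (h2 : ∀ p ∈ R, theta₂ S A B p = (-1 / (F p * H p)) • fderiv ℝ y p)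
    {X n : ℝ × ℝ → E3} (hX : IsRealization R S X n) :
    ∃ c v a Q, IsGaussField R x y F H n c v a Q := by
  obtain ⟨X₁, X₂, -, -, hd⟩ := hG.exists_partials hX.smooth
  obtain ⟨n₁, n₂, hs1, hs2, hn⟩ := hG.exists_partials hX.smooth_normal
  obtain ⟨n₁₁, n₁₂, -, -, hn1⟩ := hG.exists_partials hs1
  obtain ⟨n₂₁, n₂₂, -, -, hn2⟩ := hG.exists_partials hs2
  obtain ⟨Vy, hV⟩ := h.diff_inv_snd hS hR hG h1
  obtain ⟨Ux, hU⟩ := h.diff_inv_fst hS hR hG h2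
  have hw := fun p (hp : p ∈ R) => hX.weingarten h hS hR hG hd hn hp
  have hdd : HasDifferential R x y X (fun p => (-1 : ℝ) • ((A p)⁻¹ • n₁ p))
      (fun p => (-1 : ℝ) • ((B p)⁻¹ • n₂ p)) := by
    refine hd.congr (fun p hp => ?_) (fun p hp => ?_)
    · rw [(hw p hp).1, smul_neg, smul_smul, inv_mul_cancel₀ (hS.fst_ne_zero p (hR hp))]; simp
    · rw [(hw p hp).2.1, smul_neg, smul_smul, inv_mul_cancel₀ (hS.snd_ne_zero p (hR hp))]; simp
  -- Equality of the mixed derivatives of X, with the Codazzi values of U_y and V_x inserted; the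
  -- common factor U - V cancels since A ≠ B.
  have hmix : ∀ p ∈ R, n₁₂ p = (1 / (F p * H p)) • n₁ p - (H p / F p) • n₂ p := by
    intro p hp
    have e1 := hG.mixed_partials hn hn1 hn2 hp
    have e2 := hG.mixed_partials hdd ((HasDifferential.const (-1 : ℝ)).smul (hU.smul hn1))
      ((HasDifferential.const (-1 : ℝ)).smul (hV.smul hn2)) hp
    simp only [Pi.zero_apply, zero_smul, add_zero] at e2
    rw [← e1] at e2
    have hne : (A p)⁻¹ - (B p)⁻¹ ≠ 0 :=
      sub_ne_zero.2 fun he => hS.curvatures.ne p (hR hp) (inv_injective he)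
    refine smul_right_injective _ hne ?_
    have e3 := smul_right_injective E3 (by norm_num : (-1 : ℝ) ≠ 0) e2
    have hF := (hN.pos_F p hp).ne'
    have hH := (hN.pos_H p hp).ne'
    rw [← sub_eq_zero] at e3 ⊢
    rw [← e3]
    match_scalars <;> field_simp
  have hF := fun p (hp : p ∈ R) => (hN.pos_F p hp).ne'
  have hH := fun p (hp : p ∈ R) => (hN.pos_H p hp).ne'
  obtain ⟨Hx, hHx⟩ := hN.diff_H
  have hq : ∀ p ∈ R, (H p / F p) * (F p / H p) = 1 := fun p hp => by
    have := hF p hp; have := hH p hp; field_simp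
  have hn1ne : ∀ p ∈ R, n₁ p ≠ 0 := fun p hp => by
    rw [(hw p hp).1, neg_ne_zero]
    exact smul_ne_zero (hS.fst_ne_zero p (hR hp)) (hw p hp).2.2.2.1
  have hn2ne : ∀ p ∈ R, n₂ p ≠ 0 := fun p hp => by
    rw [(hw p hp).2.1, neg_ne_zero]
    exact smul_ne_zero (hS.snd_ne_zero p (hR hp)) (hw p hp).2.2.2.2
  have hpos : ∀ p ∈ R, 0 < inner ℝ ((F p / H p) • n₁ p) ((F p / H p) • n₁ p) := fun p hp =>
    real_inner_self_pos.2 (smul_ne_zero (div_ne_zero (hF p hp) (hH p hp)) (hn1ne p hp))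
  have hposv : ∀ p ∈ R, 0 < inner ℝ (n₂ p) (n₂ p) := fun p hp =>
    real_inner_self_pos.2 (hn2ne p hp)
  have hc := hn.add ((hN.diff_F.div hHx hH).smul hn1)
  -- The choice of c makes n_x = (H/F)(c - n) hold automatically. Its y-derivative vanishes by
  -- `hmix` together with (F/H)_y = -1/H², the Wronskian relation.
  refine ⟨fun p => n p + (F p / H p) • n₁ p, n₂,
    fun p => (inner ℝ ((F p / H p) • n₁ p) ((F p / H p) • n₁ p))⁻¹,
    fun p => (F p ^ 2 * inner ℝ (n₂ p) (n₂ p))⁻¹, hX.smooth_normal,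
    hX.smooth_normal.add ((hN.smooth_F.div hN.smooth_H hH).smul hs1), hs2,
    hn.congr (fun p hp => by rw [add_sub_cancel_left, smul_smul, hq p hp, one_smul])
      (fun _ _ => rfl), ⟨_, hc.congr (fun _ _ => rfl) fun p hp => ?_⟩,
    fun p hp => inv_pos.2 (hpos p hp), fun p hp => ?_, fun p hp => ?_, fun p hp => ?_,
    fun p hp => ?_, fun p hp => ?_⟩
  · have := hF p hp
    have := hH p hp
    have hdet := hN.det p hp
    rw [hmix p hp]
    simp only [Pi.zero_apply]
    match_scalars
    · field_simp; ring
    · field_simp; linear_combination -hdet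
  · have := hposv p hp; have := hN.pos_F p hp; positivity
  · rw [real_inner_self_eq_norm_sq, hX.unit p hp, one_pow]
  · rw [add_sub_cancel_left, (hw p hp).1, (hw p hp).2.1]
    simp [inner_smul_left, inner_smul_right, (hw p hp).2.2.1]
  · rw [add_sub_cancel_left, inv_inv]
  · have := hposv p hp; have := hN.pos_F p hp; field_simp

/-- A Gauss map with the right third fundamental form integrates to an immersion. -/
theorem IsGaussField.exists_integral (h : IsPrincipalCoordinates R S A B x y)
    (hS : IsTypeI D S A B) (hR : R ⊆ D) (hG : IsChartInverse R x y I J G)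
    (hN : IsNaturalPair R x y F H f g)
    (h1 : ∀ p ∈ R, theta₁ S A B p = (H p / F p) • fderiv ℝ x p)
    (h2 : ∀ p ∈ R, theta₂ S A B p = (-1 / (F p * H p)) • fderiv ℝ y p)
    {n c v : ℝ × ℝ → E3} {a Q : ℝ × ℝ → ℝ} (hn : IsGaussField R x y F H n c v a Q) :
    ∃ X, IsRealizationIntegral R A B x y n X := by
  obtain ⟨Vy, hV⟩ := h.diff_inv_snd hS hR hG h1
  obtain ⟨Ux, hU⟩ := h.diff_inv_fst hS hR hG h2
  obtain ⟨px, hp⟩ := hN.diff_quotient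
  obtain ⟨v', hv⟩ := hn.diff_v hG hN
  obtain ⟨c', hc⟩ := hn.diff_c
  -- The closedness argument is the equation for n_xy read backwards: the Codazzi terms, each
  -- proportional to U - V, cancel (U - V) n_xy.
  obtain ⟨X, hX⟩ := hG.exists_primitive (hU.smul (hp.smul (hc.sub hn.diff_n))).neg
    (hV.smul hv).neg (fun p hp => by
      have hF := (hN.pos_F p hp).ne'
      have hH := (hN.pos_H p hp).ne'
      simp only [Pi.zero_apply]
      match_scalars <;> field_simp <;> ring)
  exact ⟨X, _, _, hn.diff_n, hX⟩

/-- The vectors n_x, n_y are nonzero, mutually orthogonal and orthogonal to n, while X_x = -U n_x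
and X_y = -V n_y. Pairing dX with n_x and n_y gives injectivity, and both shape identities become
diagonal. -/
theorem IsGaussField.isRealization (h : IsPrincipalCoordinates R S A B x y)
    (hS : IsTypeI D S A B) (hR : R ⊆ D) (hG : IsChartInverse R x y I J G)
    (hN : IsNaturalPair R x y F H f g)
    {n c v : ℝ × ℝ → E3} {a Q : ℝ × ℝ → ℝ} (hn : IsGaussField R x y F H n c v a Q)
    {X : ℝ × ℝ → E3} (hX : IsRealizationIntegral R A B x y n X) : IsRealization R S X n := by
  obtain ⟨n₁, n₂, hd, hX⟩ := hX
  obtain ⟨hs1, hs2⟩ := hG.contDiffOn_partials hn.smooth hd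
  have hA := fun p (hp : p ∈ R) => hS.fst_ne_zero p (hR hp)
  have hB := fun p (hp : p ∈ R) => hS.snd_ne_zero p (hR hp)
  have e1 : ∀ p ∈ R, n₁ p = (H p / F p) • (c p - n p) := fun p hp =>
    (hG.unique hd hn.diff_n hp).1
  have e2 : ∀ p ∈ R, n₂ p = v p := fun p hp => (hG.unique hd hn.diff_n hp).2
  have hfr := fun p (hp : p ∈ R) => hn.frame hG hN hp
  have i12 : ∀ p ∈ R, inner ℝ (n₁ p) (n₂ p) = (0 : ℝ) := fun p hp => by
    rw [e1 p hp, e2 p hp, inner_smul_left, (hfr p hp).ev, mul_zero]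
  have i21 : ∀ p ∈ R, inner ℝ (n₂ p) (n₁ p) = (0 : ℝ) := fun p hp => by
    rw [real_inner_comm, i12 p hp]
  have hn1 : ∀ p ∈ R, 0 < inner ℝ (n₁ p) (n₁ p) := fun p hp => by
    have := hN.pos_F p hp
    have := hN.pos_H p hp
    have := hn.pos_a p hp
    rw [e1 p hp, inner_smul_left, inner_smul_right, (hfr p hp).ee, conj_trivial]
    positivity
  have hn2 : ∀ p ∈ R, 0 < inner ℝ (n₂ p) (n₂ p) := fun p hp => by
    rw [e2 p hp, (hfr p hp).vv]
    exact inv_pos.2 (hfr p hp).pos_d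
  refine ⟨hG.contDiffOn hX (((hS.curvatures.smooth_fst.mono hR).inv hA).smul hs1).neg
    (((hS.curvatures.smooth_snd.mono hR).inv hB).smul hs2).neg, hn.smooth, fun p hp => ?_,
    fun p hp => ?_, fun p hp u => ?_, fun p hp u w => ?_⟩
  · obtain ⟨e₁, e₂, -, -, -, -, hsum⟩ := hG.exists_coordinate_vectors hp
    rw [injective_iff_map_eq_zero]
    intro u hu
    rw [hX.fderiv_apply hp] at hu
    have j1 := congrArg (fun z => inner ℝ (n₁ p) z) hu
    have j2 := congrArg (fun z => inner ℝ (n₂ p) z) hu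
    simp only [smul_neg, inner_add_right, inner_neg_right, inner_smul_right, i12 p hp, i21 p hp,
      inner_zero_right, mul_zero, neg_zero, add_zero, zero_add, neg_eq_zero, mul_eq_zero,
      (hn1 p hp).ne', (hn2 p hp).ne', inv_eq_zero, hA p hp, hB p hp, or_false] at j1 j2
    rw [hsum u, j1, j2]
    simp
  · rw [← sq_eq_sq₀ (norm_nonneg _) zero_le_one, ← real_inner_self_eq_norm_sq, hn.unit p hp,
      one_pow]
  · rw [hX.fderiv_apply hp]
    simp only [e1 p hp, e2 p hp, smul_neg, inner_add_right, inner_neg_right, inner_smul_right,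
      (hfr p hp).ne, (hfr p hp).nv]
    simp
  · have h1 := congrArg (fun L => L w) (h.diag_fst p hp)
    have h2 := congrArg (fun L => L w) (h.diag_snd p hp)
    have h3 := congrArg (fun L => L u) (h.diag_fst p hp)
    have h4 := congrArg (fun L => L u) (h.diag_snd p hp)
    simp only [ContinuousLinearMap.comp_apply, _root_.smul_apply, smul_eq_mul] at h1 h2 h3 h4
    have hA := hA p hp
    have hB := hB p hp
    simp only [hX.fderiv_apply hp, hd.fderiv_apply hp, h1, h2, h3, h4, smul_neg, inner_add_right,
      inner_add_left, inner_neg_right, inner_neg_left, inner_smul_right, inner_smul_left,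
      conj_trivial, i12 p hp, i21 p hp]
    constructor <;> field_simp <;> ring

end Curvature

/-! ### The explicit Gauss map in natural coordinates -/

namespace IsNaturalPrincipalCoordinates

variable {D R : Set (ℝ × ℝ)} {S : ℝ × ℝ → (ℝ × ℝ →L[ℝ] ℝ × ℝ)} {A B x y : ℝ × ℝ → ℝ}
  {φ₀ φ₁ : ℝ → ℝ} {I J : Set ℝ} {G : ℝ × ℝ → ℝ × ℝ}

theorem diff_comp_x (hG : IsChartInverse R x y I J G) {φ : ℝ → ℝ}
    (hφ : ContDiffOn ℝ ∞ φ (x '' R)) :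
    HasDifferential R x y (fun p => φ (x p)) (fun p => deriv φ (x p)) 0 := by
  refine (hG.hasDifferential_x.comp (φ' := fun p => deriv φ (x p)) fun p hp => ?_).congr
    (fun p _ => by simp) (fun p _ => by simp)
  exact ((hφ.contDiffAt (hG.isOpen_image_x.mem_nhds ⟨p, hp, rfl⟩)).differentiableAt
    (by simp)).hasDerivAt

theorem contDiffOn_deriv (hG : IsChartInverse R x y I J G) {φ : ℝ → ℝ}
    (hφ : ContDiffOn ℝ ∞ φ (x '' R)) : ContDiffOn ℝ ∞ (deriv φ) (x '' R) :=
  ((contDiffOn_infty_iff_deriv_of_isOpen hG.isOpen_image_x).1 hφ).2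

theorem isNaturalPair (h : IsNaturalPrincipalCoordinates R S A B x y φ₀ φ₁)
    (hG : IsChartInverse R x y I J G) :
    IsNaturalPair R x y (natNum φ₀ φ₁ x y) (natDen φ₀ φ₁ x y) (fun p => φ₀ (x p))
      (fun p => deriv φ₀ (x p)) := by
  have h0' := contDiffOn_deriv hG h.smooth_phi₀
  have h1' := contDiffOn_deriv hG h.smooth_phi₁
  have c := fun {φ : ℝ → ℝ} (hφ : ContDiffOn ℝ ∞ φ (x '' R)) =>
    hφ.comp hG.smooth_x (Set.mapsTo_image x R)
  have d := fun {φ : ℝ → ℝ} (hφ : ContDiffOn ℝ ∞ φ (x '' R)) => diff_comp_x hG hφ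
  refine ⟨(c h.smooth_phi₁).sub (hG.smooth_y.mul (c h.smooth_phi₀)),
    (c h1').sub (hG.smooth_y.mul (c h0')),
    ((d h.smooth_phi₁).sub (hG.hasDifferential_y.mul (d h.smooth_phi₀))).congr
      (fun p _ => by simp [natDen]) (fun p _ => by simp),
    ⟨_, ((d h1').sub (hG.hasDifferential_y.mul (d h0'))).congr (fun _ _ => rfl)
      (fun p _ => by simp)⟩, fun p hp => ?_, h.num_pos, h.den_pos⟩
  simp only [natNum, natDen]
  linear_combination h.wronskian (x p) ⟨p, hp, rfl⟩

section GaussMap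

variable {c₀ c₁ c₂ : ℝ} {s : ℝ × ℝ → ℝ}

theorem diff_coeffA (h : IsNaturalPrincipalCoordinates R S A B x y φ₀ φ₁)
    (hG : IsChartInverse R x y I J G) :
    HasDifferential R x y (coeffA φ₀ φ₁ c₀ c₁ c₂ x) (fun p => -2 * (
      c₀ * φ₀ (x p) * deriv φ₀ (x p) + c₁ * (φ₀ (x p) * deriv φ₁ (x p) +
        φ₁ (x p) * deriv φ₀ (x p)) + c₂ * φ₁ (x p) * deriv φ₁ (x p))) 0 := by
  have d0 := diff_comp_x hG h.smooth_phi₀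
  have d1 := diff_comp_x hG h.smooth_phi₁
  have k := fun c : ℝ => HasDifferential.const (R := R) (x := x) (y := y) c
  refine ((((k (-1)).sub ((k c₀).mul (d0.mul d0))).sub (((k (2 * c₁)).mul (d0.mul d1)))).sub
    ((k c₂).mul (d1.mul d1))).congr_fun hG.isOpen (fun p _ => ?_) |>.congr (fun p _ => ?_)
      (fun p _ => ?_)
  · simp only [coeffA]; ring
  · simp only [Pi.zero_apply]; ring
  · simp

theorem smooth_coeffA (h : IsNaturalPrincipalCoordinates R S A B x y φ₀ φ₁)
    (hG : IsChartInverse R x y I J G) : ContDiffOn ℝ ∞ (coeffA φ₀ φ₁ c₀ c₁ c₂ x) R := by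
  have d0 := h.smooth_phi₀.comp hG.smooth_x (Set.mapsTo_image x R)
  have d1 := h.smooth_phi₁.comp hG.smooth_x (Set.mapsTo_image x R)
  exact ((contDiffOn_const.sub (contDiffOn_const.mul (d0.pow 2))).sub
    ((contDiffOn_const.mul d0).mul d1)).sub (contDiffOn_const.mul (d1.pow 2))

/-- The coefficient of σ depends only on x, so σ is closed on the rectangle. -/
theorem exists_admissible (h : IsNaturalPrincipalCoordinates R S A B x y φ₀ φ₁)
    (hG : IsChartInverse R x y I J G) (ha : ∀ p ∈ R, 0 < coeffA φ₀ φ₁ c₀ c₁ c₂ x p)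
    (hb : ∀ p ∈ R, 0 < coeffB φ₀ φ₁ c₀ c₁ c₂ x y p) :
    ∃ s : ℝ × ℝ → ℝ, IsAdmissible R x y φ₀ φ₁ c₀ c₁ c₂ s := by
  have k := fun c : ℝ => HasDifferential.const (R := R) (x := x) (y := y) c
  have hA := h.diff_coeffA (c₀ := c₀) (c₁ := c₁) (c₂ := c₂) hG
  have hσ : HasDifferential R x y (sigmaCoeff φ₀ φ₁ c₀ c₁ c₂ x) _ _ :=
    (k (√(c₁ ^ 2 - c₀ * c₂))).div (((k 1).add hA).mul (hA.sqrt ha)) (fun p hp => by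
      have := ha p hp
      positivity)
  obtain ⟨s, hs⟩ := hG.exists_primitive hσ (HasDifferential.const (0 : ℝ)) (fun p hp => by simp)
  exact ⟨s, ha, hb, hs⟩

/-- The discriminant identity for binary quadratic forms. -/
theorem discriminant_identity (f₀ f₁ c₀ c₁ c₂ t : ℝ) :
    (c₀ * f₀ + c₁ * (f₁ + t * f₀) + c₂ * t * f₁) ^ 2 +
      (c₀ + 2 * c₁ * t + c₂ * t ^ 2) *
        (1 + (-1 - c₀ * f₀ ^ 2 - 2 * c₁ * f₀ * f₁ - c₂ * f₁ ^ 2)) =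
      (c₁ ^ 2 - c₀ * c₂) * (f₁ - t * f₀) ^ 2 := by ring

theorem quadratic_pos (h : IsNaturalPrincipalCoordinates R S A B x y φ₀ φ₁)
    (hs : IsAdmissible R x y φ₀ φ₁ c₀ c₁ c₂ s) {p : ℝ × ℝ} (hp : p ∈ R) :
    0 < c₀ + 2 * c₁ * y p + c₂ * y p ^ 2 := by
  have h1 := hs.pos_b p hp
  rw [coeffB, div_pos_iff_of_pos_right (pow_pos (h.den_pos p hp) 2)] at h1
  exact h1

/-- The left side of `discriminant_identity` is a square plus a product of two positive numbers.
Thus admissibility already forces the root in σ and e₃ to be nonzero at points of `R`. -/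
theorem discriminant_pos (h : IsNaturalPrincipalCoordinates R S A B x y φ₀ φ₁)
    (hs : IsAdmissible R x y φ₀ φ₁ c₀ c₁ c₂ s) {p : ℝ × ℝ} (hp : p ∈ R) :
    0 < c₁ ^ 2 - c₀ * c₂ := by
  have h1 := h.quadratic_pos hs hp
  have h2 := hs.pos_a p hp
  have h3 := h.num_pos p hp
  have h4 := discriminant_identity (φ₀ (x p)) (φ₁ (x p)) c₀ c₁ c₂ (y p)
  rw [coeffA] at h2
  rw [natNum] at h3
  refine pos_of_mul_pos_left (b := (φ₁ (x p) - y p * φ₀ (x p)) ^ 2) ?_ (by positivity)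
  rw [← h4]
  have : 0 < 1 + (-1 - c₀ * φ₀ (x p) ^ 2 - 2 * c₁ * φ₀ (x p) * φ₁ (x p) - c₂ * φ₁ (x p) ^ 2) := by
    linarith
  positivity

theorem one_add_coeffA_pos (hs : IsAdmissible R x y φ₀ φ₁ c₀ c₁ c₂ s) {p : ℝ × ℝ} (hp : p ∈ R) :
    0 < 1 + coeffA φ₀ φ₁ c₀ c₁ c₂ x p := by
  have := hs.pos_a p hp
  positivity

theorem sqrt_discriminant_pos (h : IsNaturalPrincipalCoordinates R S A B x y φ₀ φ₁)
    (hs : IsAdmissible R x y φ₀ φ₁ c₀ c₁ c₂ s) {p : ℝ × ℝ} (hp : p ∈ R) :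
    0 < √(c₁ ^ 2 - c₀ * c₂) := Real.sqrt_pos.2 (h.discriminant_pos hs hp)

/-- The derivative is put in the form needed later. With u = (cos s, 0, sin s) it is the u-component
of n_x = (H/F)(c - n) for c = u/C, C the center coefficient; `diff_tangent` and `diff_height` supply
the other two components. -/
theorem diff_center (h : IsNaturalPrincipalCoordinates R S A B x y φ₀ φ₁)
    (hG : IsChartInverse R x y I J G) (hs : IsAdmissible R x y φ₀ φ₁ c₀ c₁ c₂ s) :
    HasDifferential R x y (centerCoeff φ₀ φ₁ c₀ c₁ c₂ x)
      (fun p => tangentCoeff φ₀ φ₁ c₀ c₁ c₂ x y p * sigmaCoeff φ₀ φ₁ c₀ c₁ c₂ x p +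
        natDen φ₀ φ₁ x y p / natNum φ₀ φ₁ x y p *
          ((centerCoeff φ₀ φ₁ c₀ c₁ c₂ x p)⁻¹ - centerCoeff φ₀ φ₁ c₀ c₁ c₂ x p)) 0 := by
  have hA := h.diff_coeffA (c₀ := c₀) (c₁ := c₁) (c₂ := c₂) hG
  have k := HasDifferential.const (R := R) (x := x) (y := y) (1 : ℝ)
  have h1 := fun p (hp : p ∈ R) => one_add_coeffA_pos hs hp
  have hC : HasDifferential R x y (centerCoeff φ₀ φ₁ c₀ c₁ c₂ x) _ _ :=
    (hA.sqrt hs.pos_a).div ((k.add hA).sqrt h1) (fun p hp => (Real.sqrt_pos.2 (h1 p hp)).ne')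
  refine hC.congr (fun p hp => ?_) (fun p hp => by simp)
  have ha := Real.sqrt_pos.2 (hs.pos_a p hp)
  have hh := Real.sqrt_pos.2 (h1 p hp)
  have hw := h.sqrt_discriminant_pos hs hp
  have hF := h.num_pos p hp
  have ea := Real.sq_sqrt (hs.pos_a p hp).le
  have eh := Real.sq_sqrt (h1 p hp).le
  have hW := h.wronskian (x p) ⟨p, hp, rfl⟩
  simp only [tangentCoeff, sigmaCoeff, centerCoeff, Pi.zero_apply, zero_add]
  have e1 : √(1 + coeffA φ₀ φ₁ c₀ c₁ c₂ x p) ^ 2 = 1 + √(coeffA φ₀ φ₁ c₀ c₁ c₂ x p) ^ 2 := by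
    rw [ea, eh]
  -- By the Wronskian, (1, y) = Hφ - Fφ' for φ = (φ₀, φ₁). Pairing this with φ under the bilinear
  -- form with coefficients c₀, c₁, c₂, whose value on (φ, φ) is -(1 + a), gives the identity.
  have e2 : natNum φ₀ φ₁ x y p * -(c₀ * φ₀ (x p) * deriv φ₀ (x p) + c₁ * (φ₀ (x p) *
        deriv φ₁ (x p) + φ₁ (x p) * deriv φ₀ (x p)) + c₂ * φ₁ (x p) * deriv φ₁ (x p)) -
      (c₀ * φ₀ (x p) + c₁ * (φ₁ (x p) + y p * φ₀ (x p)) + c₂ * y p * φ₁ (x p)) =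
      √(1 + coeffA φ₀ φ₁ c₀ c₁ c₂ x p) ^ 2 * natDen φ₀ φ₁ x y p := by
    rw [eh]
    simp only [natNum, natDen, coeffA]
    linear_combination (c₀ * φ₀ (x p) + c₁ * (φ₁ (x p) + y p * φ₀ (x p)) + c₂ * y p * φ₁ (x p)) * hW
  generalize √(1 + coeffA φ₀ φ₁ c₀ c₁ c₂ x p) = rh at *
  rw [← eh]
  generalize √(coeffA φ₀ φ₁ c₀ c₁ c₂ x p) = ra at *
  generalize natNum φ₀ φ₁ x y p = F at *
  generalize natDen φ₀ φ₁ x y p = H at *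
  field_simp
  linear_combination e2 - ((c₀ * φ₀ (x p) * deriv φ₀ (x p) + c₁ * (φ₀ (x p) * deriv φ₁ (x p) +
    φ₁ (x p) * deriv φ₀ (x p)) + c₂ * φ₁ (x p) * deriv φ₁ (x p)) * F + rh ^ 2 * H) * e1

theorem diff_tangent (h : IsNaturalPrincipalCoordinates R S A B x y φ₀ φ₁)
    (hG : IsChartInverse R x y I J G) (hs : IsAdmissible R x y φ₀ φ₁ c₀ c₁ c₂ s) :
    HasDifferential R x y (tangentCoeff φ₀ φ₁ c₀ c₁ c₂ x y)
      (fun p => -(natDen φ₀ φ₁ x y p / natNum φ₀ φ₁ x y p * tangentCoeff φ₀ φ₁ c₀ c₁ c₂ x y p) -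
        centerCoeff φ₀ φ₁ c₀ c₁ c₂ x p * sigmaCoeff φ₀ φ₁ c₀ c₁ c₂ x p)
      (fun p => -(√(1 + coeffA φ₀ φ₁ c₀ c₁ c₂ x p) /
        (natNum φ₀ φ₁ x y p ^ 2 * √(c₁ ^ 2 - c₀ * c₂)))) := by
  have hA := h.diff_coeffA (c₀ := c₀) (c₁ := c₁) (c₂ := c₂) hG
  have k := fun c : ℝ => HasDifferential.const (R := R) (x := x) (y := y) c
  have h1 := fun p (hp : p ∈ R) => one_add_coeffA_pos hs hp
  have d0 := diff_comp_x hG h.smooth_phi₀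
  have d1 := diff_comp_x hG h.smooth_phi₁
  have dy := hG.hasDifferential_y
  have hτ : HasDifferential R x y (tangentCoeff φ₀ φ₁ c₀ c₁ c₂ x y) _ _ :=
    ((((k c₀).mul d0).add ((k c₁).mul (d1.add (dy.mul d0)))).add (((k c₂).mul dy).mul d1)).div
      (((h.isNaturalPair hG).diff_F.mul (((k 1).add hA).sqrt h1)).mul (k √(c₁ ^ 2 - c₀ * c₂)))
      (fun p hp => by
        have := h.num_pos p hp
        have := Real.sqrt_pos.2 (h1 p hp)
        have := h.sqrt_discriminant_pos hs hp
        positivity)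
  refine hτ.congr (fun p hp => ?_) (fun p hp => ?_)
  all_goals
    have ha := Real.sqrt_pos.2 (hs.pos_a p hp)
    have hh := Real.sqrt_pos.2 (h1 p hp)
    have hw := h.sqrt_discriminant_pos hs hp
    have hF := h.num_pos p hp
    have ea := Real.sq_sqrt (hs.pos_a p hp).le
    have eh := Real.sq_sqrt (h1 p hp).le
    have ew := Real.sq_sqrt (h.discriminant_pos hs hp).le
    have hW := h.wronskian (x p) ⟨p, hp, rfl⟩
    simp only [tangentCoeff, sigmaCoeff, centerCoeff, Pi.zero_apply, zero_add, zero_mul, mul_zero,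
      add_zero, mul_one, zero_div]
  -- A Lagrange identity for the same bilinear form on φ, φ' and (1, y): the determinants that
  -- appear are 1 (the Wronskian) and -F.
  · have e : √(1 + coeffA φ₀ φ₁ c₀ c₁ c₂ x p) ^ 2 * (c₀ * deriv φ₀ (x p) + c₁ * (deriv φ₁ (x p) +
        y p * deriv φ₀ (x p)) + c₂ * y p * deriv φ₁ (x p)) +
        (c₀ * φ₀ (x p) + c₁ * (φ₁ (x p) + y p * φ₀ (x p)) + c₂ * y p * φ₁ (x p)) *
        (c₀ * φ₀ (x p) * deriv φ₀ (x p) + c₁ * (φ₀ (x p) *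
        deriv φ₁ (x p) + φ₁ (x p) * deriv φ₀ (x p)) + c₂ * φ₁ (x p) * deriv φ₁ (x p)) +
        √(c₁ ^ 2 - c₀ * c₂) ^ 2 * natNum φ₀ φ₁ x y p = 0 := by
      rw [ew, eh]
      simp only [natNum, coeffA]
      linear_combination (-(c₁ ^ 2 - c₀ * c₂) * (φ₁ (x p) - y p * φ₀ (x p))) * hW
    generalize √(1 + coeffA φ₀ φ₁ c₀ c₁ c₂ x p) = rh at *
    rw [← eh]
    generalize √(coeffA φ₀ φ₁ c₀ c₁ c₂ x p) = ra at *
    generalize √(c₁ ^ 2 - c₀ * c₂) = w at *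
    generalize natNum φ₀ φ₁ x y p = F at *
    generalize natDen φ₀ φ₁ x y p = H at *
    field_simp
    linear_combination F * e
  · have e : (c₁ * φ₀ (x p) + c₂ * φ₁ (x p)) * natNum φ₀ φ₁ x y p + φ₀ (x p) *
        (c₀ * φ₀ (x p) + c₁ * (φ₁ (x p) + y p * φ₀ (x p)) + c₂ * y p * φ₁ (x p)) =
        -√(1 + coeffA φ₀ φ₁ c₀ c₁ c₂ x p) ^ 2 := by
      rw [eh]
      simp only [natNum, coeffA]
      ring
    generalize √(1 + coeffA φ₀ φ₁ c₀ c₁ c₂ x p) = rh at *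
    generalize √(c₁ ^ 2 - c₀ * c₂) = w at *
    generalize natNum φ₀ φ₁ x y p = F at *
    field_simp
    linear_combination e

theorem diff_height (h : IsNaturalPrincipalCoordinates R S A B x y φ₀ φ₁)
    (hG : IsChartInverse R x y I J G) (hs : IsAdmissible R x y φ₀ φ₁ c₀ c₁ c₂ s) :
    HasDifferential R x y (fun p => √(c₀ + 2 * c₁ * y p + c₂ * y p ^ 2) /
        (natNum φ₀ φ₁ x y p * √(c₁ ^ 2 - c₀ * c₂)))
      (fun p => -(natDen φ₀ φ₁ x y p / natNum φ₀ φ₁ x y p *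
        (√(c₀ + 2 * c₁ * y p + c₂ * y p ^ 2) / (natNum φ₀ φ₁ x y p * √(c₁ ^ 2 - c₀ * c₂)))))
      (fun p => (c₀ * φ₀ (x p) + c₁ * (φ₁ (x p) + y p * φ₀ (x p)) + c₂ * y p * φ₁ (x p)) /
        (√(c₀ + 2 * c₁ * y p + c₂ * y p ^ 2) * natNum φ₀ φ₁ x y p ^ 2 *
          √(c₁ ^ 2 - c₀ * c₂))) := by
  have k := fun c : ℝ => HasDifferential.const (R := R) (x := x) (y := y) c
  have dy := hG.hasDifferential_y
  have hQ : HasDifferential R x y (fun p => c₀ + 2 * c₁ * y p + c₂ * y p ^ 2) 0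
      (fun p => 2 * c₁ + 2 * c₂ * y p) :=
    ((((k c₀).add ((k (2 * c₁)).mul dy)).add ((k c₂).mul (dy.mul dy))).congr_fun hG.isOpen
      (fun p _ => by ring)).congr (fun p _ => by simp) (fun p _ => by simp; ring)
  have hq := fun p (hp : p ∈ R) => h.quadratic_pos hs hp
  refine ((hQ.sqrt hq).div ((h.isNaturalPair hG).diff_F.mul (k √(c₁ ^ 2 - c₀ * c₂)))
    (fun p hp => ?_)).congr (fun p hp => ?_) (fun p hp => ?_)
  all_goals
    have hw := h.sqrt_discriminant_pos hs hp
    have hF := h.num_pos p hp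
    have hr := Real.sqrt_pos.2 (hq p hp)
  · positivity
  · simp only [Pi.zero_apply, zero_div, zero_mul, mul_zero, zero_add, zero_sub]
    field_simp
  · have e : (c₁ + c₂ * y p) * natNum φ₀ φ₁ x y p +
        √(c₀ + 2 * c₁ * y p + c₂ * y p ^ 2) ^ 2 * φ₀ (x p) =
        c₀ * φ₀ (x p) + c₁ * (φ₁ (x p) + y p * φ₀ (x p)) + c₂ * y p * φ₁ (x p) := by
      rw [Real.sq_sqrt (hq p hp).le, natNum]
      ring
    simp only [Pi.zero_apply, mul_zero, zero_add]
    generalize √(c₀ + 2 * c₁ * y p + c₂ * y p ^ 2) = rQ at *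
    generalize √(c₁ ^ 2 - c₀ * c₂) = w at *
    field_simp
    linear_combination e

theorem smooth_gaussMap (h : IsNaturalPrincipalCoordinates R S A B x y φ₀ φ₁)
    (hG : IsChartInverse R x y I J G) (hs : IsAdmissible R x y φ₀ φ₁ c₀ c₁ c₂ s) :
    ContDiffOn ℝ ∞ (gaussMap φ₀ φ₁ c₀ c₁ c₂ x y s) R := by
  have h1 := fun p (hp : p ∈ R) => (one_add_coeffA_pos hs hp).ne'
  have h2 := fun p (hp : p ∈ R) => (hs.pos_a p hp).ne'
  have h3 := fun p (hp : p ∈ R) => (h.sqrt_discriminant_pos hs hp).ne'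
  have h4 := fun p (hp : p ∈ R) => (h.num_pos p hp).ne'
  have r1 := fun p (hp : p ∈ R) => (Real.sqrt_pos.2 (one_add_coeffA_pos hs hp)).ne'
  have r2 := fun p (hp : p ∈ R) => (Real.sqrt_pos.2 (hs.pos_a p hp)).ne'
  have d0 := h.smooth_phi₀.comp hG.smooth_x (Set.mapsTo_image x R)
  have d1 := h.smooth_phi₁.comp hG.smooth_x (Set.mapsTo_image x R)
  have dy := hG.smooth_y
  have dF := (h.isNaturalPair hG).smooth_F
  have k := fun c : ℝ => contDiffOn_const (𝕜 := ℝ) (n := ∞) (s := R) (c := c)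
  have dA := h.smooth_coeffA (c₀ := c₀) (c₁ := c₁) (c₂ := c₂) hG
  have dh := (k 1).add dA
  have dra := dA.sqrt h2
  have drh := dh.sqrt h1
  have dσ : ContDiffOn ℝ ∞ (sigmaCoeff φ₀ φ₁ c₀ c₁ c₂ x) R :=
    (k _).div (dh.mul dra) fun p hp => mul_ne_zero (h1 p hp) (r2 p hp)
  have ds := hG.contDiffOn hs.quadrature dσ contDiffOn_const
  have dC : ContDiffOn ℝ ∞ (centerCoeff φ₀ φ₁ c₀ c₁ c₂ x) R := dra.div drh r1
  have dτ : ContDiffOn ℝ ∞ (tangentCoeff φ₀ φ₁ c₀ c₁ c₂ x y) R :=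
    ((((k c₀).mul d0).add ((k c₁).mul (d1.add (dy.mul d0)))).add (((k c₂).mul dy).mul d1)).div
      ((dF.mul drh).mul (k _)) fun p hp =>
        mul_ne_zero (mul_ne_zero (h4 p hp) (r1 p hp)) (h3 p hp)
  have dT : ContDiffOn ℝ ∞ (fun p => √(c₀ + 2 * c₁ * y p + c₂ * y p ^ 2) /
      (natNum φ₀ φ₁ x y p * √(c₁ ^ 2 - c₀ * c₂))) R :=
    ((((k c₀).add ((k (2 * c₁)).mul dy)).add ((k c₂).mul (dy.pow 2))).sqrt
      fun p hp => (h.quadratic_pos hs hp).ne').div (dF.mul (k _))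
        fun p hp => mul_ne_zero (h4 p hp) (h3 p hp)
  have dcos := Real.contDiff_cos.comp_contDiffOn ds
  have dsin := Real.contDiff_sin.comp_contDiffOn ds
  rw [contDiffOn_euclidean]
  intro i
  fin_cases i
  · exact (dcos.mul dC).sub (dsin.mul dτ)
  · exact dT
  · exact (dsin.mul dC).add (dcos.mul dτ)

/-- The center coefficient contributes a/(1 + a); `discriminant_identity` divided by (1 + a)F²(c₁² -
c₀c₂) shows that the other two squares add up to 1/(1 + a). -/
theorem unit_identity (h : IsNaturalPrincipalCoordinates R S A B x y φ₀ φ₁)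
    (hs : IsAdmissible R x y φ₀ φ₁ c₀ c₁ c₂ s) {p : ℝ × ℝ} (hp : p ∈ R) :
    centerCoeff φ₀ φ₁ c₀ c₁ c₂ x p ^ 2 + tangentCoeff φ₀ φ₁ c₀ c₁ c₂ x y p ^ 2 +
      (√(c₀ + 2 * c₁ * y p + c₂ * y p ^ 2) / (natNum φ₀ φ₁ x y p * √(c₁ ^ 2 - c₀ * c₂))) ^ 2 =
      1 := by
  have hF := h.num_pos p hp
  have ha := hs.pos_a p hp
  have hh := one_add_coeffA_pos hs hp
  have hW := h.discriminant_pos hs hp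
  have e := discriminant_identity (φ₀ (x p)) (φ₁ (x p)) c₀ c₁ c₂ (y p)
  rw [← coeffA, ← natNum] at e
  simp only [centerCoeff, tangentCoeff, div_pow, mul_pow, Real.sq_sqrt ha.le, Real.sq_sqrt hh.le,
    Real.sq_sqrt hW.le, Real.sq_sqrt (h.quadratic_pos hs hp).le]
  field_simp
  linear_combination e

theorem gaussField (h : IsNaturalPrincipalCoordinates R S A B x y φ₀ φ₁)
    (hG : IsChartInverse R x y I J G) (hs : IsAdmissible R x y φ₀ φ₁ c₀ c₁ c₂ s) :
    ∃ c v, IsGaussField R x y (natNum φ₀ φ₁ x y) (natDen φ₀ φ₁ x y)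
      (gaussMap φ₀ φ₁ c₀ c₁ c₂ x y s) c v (coeffA φ₀ φ₁ c₀ c₁ c₂ x)
      (fun p => c₀ + 2 * c₁ * y p + c₂ * y p ^ 2) := by
  set C := centerCoeff φ₀ φ₁ c₀ c₁ c₂ x with hC
  set τ := tangentCoeff φ₀ φ₁ c₀ c₁ c₂ x y with hτ
  set T : ℝ × ℝ → ℝ := fun p => √(c₀ + 2 * c₁ * y p + c₂ * y p ^ 2) /
    (natNum φ₀ φ₁ x y p * √(c₁ ^ 2 - c₀ * c₂)) with hT
  set σ := sigmaCoeff φ₀ φ₁ c₀ c₁ c₂ x with hσ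
  set τy : ℝ × ℝ → ℝ := fun p => -(√(1 + coeffA φ₀ φ₁ c₀ c₁ c₂ x p) /
        (natNum φ₀ φ₁ x y p ^ 2 * √(c₁ ^ 2 - c₀ * c₂))) with hτy
  set Ty : ℝ × ℝ → ℝ := fun p =>
    (c₀ * φ₀ (x p) + c₁ * (φ₁ (x p) + y p * φ₀ (x p)) + c₂ * y p * φ₁ (x p)) /
        (√(c₀ + 2 * c₁ * y p + c₂ * y p ^ 2) * natNum φ₀ φ₁ x y p ^ 2 *
          √(c₁ ^ 2 - c₀ * c₂)) with hTy
  -- The pole has the direction of the spherical center on the great circle; the factor 1/C is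
  -- forced by c·n = 1.
  set c : ℝ × ℝ → E3 := fun p => !₂[Real.cos (s p) * (C p)⁻¹, 0, Real.sin (s p) * (C p)⁻¹]
    with hc
  set v : ℝ × ℝ → E3 := fun p => !₂[-(Real.sin (s p) * τy p), Ty p, Real.cos (s p) * τy p]
    with hv
  have dC := h.diff_center hG hs
  have dτ := h.diff_tangent hG hs
  have dT := h.diff_height hG hs
  have dcos := hs.quadrature.cos
  have dsin := hs.quadrature.sin
  have hC0 : ∀ p ∈ R, 0 < C p := fun p hp =>
    div_pos (Real.sqrt_pos.2 (hs.pos_a p hp)) (Real.sqrt_pos.2 (one_add_coeffA_pos hs hp))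
  have dn : HasDifferential R x y (gaussMap φ₀ φ₁ c₀ c₁ c₂ x y s)
      (fun p => (natDen φ₀ φ₁ x y p / natNum φ₀ φ₁ x y p) •
        (c p - gaussMap φ₀ φ₁ c₀ c₁ c₂ x y s p)) v := by
    refine HasDifferential.of_components fun i => ?_
    fin_cases i
    · refine ((dcos.mul dC).sub (dsin.mul dτ)).congr (fun p hp => ?_) (fun p hp => ?_)
      · simp [gaussMap, hc, ← hC, ← hτ, ← hσ]; ring
      · simp [hv, hτy]
    · refine dT.congr (fun p hp => ?_) (fun p hp => ?_)
      · simp [gaussMap, hc]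
      · simp [hv, hTy]
    · refine ((dsin.mul dC).add (dcos.mul dτ)).congr (fun p hp => ?_) (fun p hp => ?_)
      · simp [gaussMap, hc, ← hC, ← hτ, ← hσ]; ring
      · simp [hv, hτy]
  have dc : ∃ c', HasDifferential R x y c c' 0 := by
    have d := dC.inv fun p hp => (hC0 p hp).ne'
    obtain ⟨P₁, h1⟩ : ∃ P, HasDifferential R x y (fun p => Real.cos (s p) * (C p)⁻¹) P 0 :=
      ⟨_, (dcos.mul d).congr (fun _ _ => rfl) (fun p hp => by simp)⟩
    obtain ⟨P₂, h2⟩ : ∃ P, HasDifferential R x y (fun p => Real.sin (s p) * (C p)⁻¹) P 0 :=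
      ⟨_, (dsin.mul d).congr (fun _ _ => rfl) (fun p hp => by simp)⟩
    refine ⟨fun p => !₂[P₁ p, 0, P₂ p], HasDifferential.of_components fun i => ?_⟩
    fin_cases i
    · exact h1
    · exact HasDifferential.const (0 : ℝ)
    · exact h2
  have sn := h.smooth_gaussMap hG hs
  have hN := h.isNaturalPair hG
  obtain ⟨s1, s2⟩ := hG.contDiffOn_partials sn dn
  refine ⟨c, v, sn, ?_, s2, dn, dc, hs.pos_a, fun p hp => h.quadratic_pos hs hp, fun p hp => ?_,
    fun p hp => ?_, fun p hp => ?_, fun p hp => ?_⟩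
  · refine (sn.add ((hN.smooth_F.div hN.smooth_H fun p hp => (hN.pos_H p hp).ne').smul
      s1)).congr fun p hp => ?_
    have hF := (hN.pos_F p hp).ne'
    have hH := (hN.pos_H p hp).ne'
    have hFH : natNum φ₀ φ₁ x y p / natDen φ₀ φ₁ x y p *
      (natDen φ₀ φ₁ x y p / natNum φ₀ φ₁ x y p) = 1 := by field_simp
    simp only [Pi.smul_apply', Pi.div_apply]
    rw [smul_smul, hFH, one_smul, add_sub_cancel]
  all_goals
    have hF := h.num_pos p hp
    have ha := hs.pos_a p hp
    have hh := one_add_coeffA_pos hs hp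
    have hW := h.discriminant_pos hs hp
    have hQ := h.quadratic_pos hs hp
    have hra := Real.sqrt_pos.2 ha
    have hrh := Real.sqrt_pos.2 hh
    have hw := Real.sqrt_pos.2 hW
    have hrQ := Real.sqrt_pos.2 hQ
    have hu := h.unit_identity hs hp
    have hsc := Real.cos_sq_add_sin_sq (s p)
    have hCp := hC0 p hp
    simp only [EuclideanSpace.inner_eq_star_dotProduct, dotProduct, Fin.sum_univ_three, gaussMap,
      hc, hv]
    simp
    simp only [← hC, ← hτ] at hu ⊢
  · linear_combination hu + (C p ^ 2 + τ p ^ 2) * hsc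
  · have e : τ p * τy p + Ty p * (√(c₀ + 2 * c₁ * y p + c₂ * y p ^ 2) /
        (natNum φ₀ φ₁ x y p * √(c₁ ^ 2 - c₀ * c₂))) = 0 := by
      simp only [hτ, hτy, hTy, tangentCoeff]
      generalize √(c₀ + 2 * c₁ * y p + c₂ * y p ^ 2) = q at hrQ ⊢
      field_simp
      ring
    linear_combination -e - τ p * τy p * hsc
  · have e1 : (C p)⁻¹ ^ 2 = 1 + (coeffA φ₀ φ₁ c₀ c₁ c₂ x p)⁻¹ := by
      simp only [hC, centerCoeff, inv_div, div_pow, Real.sq_sqrt ha.le, Real.sq_sqrt hh.le]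
      field_simp
      ring
    have e2 : (C p)⁻¹ * C p = 1 := inv_mul_cancel₀ hCp.ne'
    linear_combination hu + ((C p)⁻¹ ^ 2 - 2 * ((C p)⁻¹ * C p) + C p ^ 2 + τ p ^ 2) * hsc + e1 -
      2 * e2
  · have e : τy p ^ 2 + Ty p ^ 2 =
        (c₀ + 2 * c₁ * y p + c₂ * y p ^ 2)⁻¹ * (natNum φ₀ φ₁ x y p ^ 2)⁻¹ := by
      have e' := discriminant_identity (φ₀ (x p)) (φ₁ (x p)) c₀ c₁ c₂ (y p)
      rw [← coeffA, ← natNum] at e'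
      simp only [hτy, hTy, neg_sq, div_pow, mul_pow, Real.sq_sqrt hW.le, Real.sq_sqrt hh.le,
        Real.sq_sqrt hQ.le]
      generalize c₀ + 2 * c₁ * y p + c₂ * y p ^ 2 = q at hQ e' ⊢
      field_simp
      linear_combination e'
    linear_combination e + τy p ^ 2 * hsc
end GaussMap

end IsNaturalPrincipalCoordinates

/-! ### Every realization is explicit, and computable from natural coordinates -/

section Representation

variable {D R : Set (ℝ × ℝ)} {S : ℝ × ℝ → (ℝ × ℝ →L[ℝ] ℝ × ℝ)} {A B x y : ℝ × ℝ → ℝ}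
  {φ₀ φ₁ : ℝ → ℝ} {I J : Set ℝ} {G : ℝ × ℝ → ℝ × ℝ}

/-- Every Gauss map of a realization is an explicit one, up to an orthogonal transformation. -/
theorem IsNaturalPrincipalCoordinates.exists_representation
    (h : IsNaturalPrincipalCoordinates R S A B x y φ₀ φ₁) (hS : IsTypeI D S A B) (hR : R ⊆ D)
    {X n : ℝ × ℝ → E3} (hX : IsRealization R S X n) :
    ∃ (c₀ c₁ c₂ : ℝ) (s : ℝ × ℝ → ℝ) (M : E3 ≃ₗᵢ[ℝ] E3),
      IsAdmissible R x y φ₀ φ₁ c₀ c₁ c₂ s ∧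
      (∀ p ∈ R, n p = M (gaussMap φ₀ φ₁ c₀ c₁ c₂ x y s p)) ∧
      IsRealizationIntegral R A B x y n X := by
  have hpc := h.toIsPrincipalCoordinates
  obtain ⟨I, J, G, hG⟩ := hpc.isRectangularChart.exists_inverse
  have hint := hX.isRealizationIntegral hpc hS hR hG
  rcases R.eq_empty_or_nonempty with rfl | hne
  · exact ⟨0, 0, 0, 0, LinearIsometryEquiv.refl ℝ E3, ⟨by simp, by simp, fun p hp => hp.elim⟩,
      by simp, hint⟩
  have hN := h.isNaturalPair hG
  obtain ⟨c, v, a, Q, hn⟩ := hX.exists_gaussField hpc hS hR hG hN h.theta₁_eq h.theta₂_eq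
  obtain ⟨c₀, c₁, c₂, hc⟩ := hn.exists_constants (f₁ := fun p => φ₁ (x p))
    (g₁ := fun p => deriv φ₁ (x p)) hG hN (fun _ _ => rfl) (fun _ _ => rfl)
    (fun p _ p' _ hx => by simp only [hx, and_self]) hne
  have ha : ∀ p ∈ R, 0 < coeffA φ₀ φ₁ c₀ c₁ c₂ x p := fun p hp => by
    rw [coeffA, ← (hc p hp).1]
    exact hn.pos_a p hp
  have hb : ∀ p ∈ R, 0 < coeffB φ₀ φ₁ c₀ c₁ c₂ x y p := fun p hp => by
    rw [coeffB, ← (hc p hp).2]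
    exact div_pos (hn.pos_Q p hp) (pow_pos (h.den_pos p hp) 2)
  obtain ⟨s, hs⟩ := h.exists_admissible hG ha hb
  obtain ⟨c', v', hn'⟩ := h.gaussField hG hs
  -- The constants were chosen so that the explicit field has the same a and Q on `R` as the given
  -- one, which is the hypothesis for comparing them by an isometry.
  have hn'' : IsGaussField R x y (natNum φ₀ φ₁ x y) (natDen φ₀ φ₁ x y)
      (gaussMap φ₀ φ₁ c₀ c₁ c₂ x y s) c' v' a Q :=
    { hn' with
      pos_a := hn.pos_a
      pos_Q := hn.pos_Q
      inner_e := fun p hp => by rw [hn'.inner_e p hp, (hc p hp).1, coeffA]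
      inner_v := fun p hp => by rw [hn'.inner_v p hp, (hc p hp).2] }
  obtain ⟨M, hM⟩ := hn.exists_isometry hn'' hG hN hne
  exact ⟨c₀, c₁, c₂, s, M, hs, hM, hint⟩

/-! ### Computability by quadratures -/

namespace ByQuadratures

theorem swap {f : ℝ × ℝ → ℝ} (h : ByQuadratures R A B x y f) : ByQuadratures R B A y x f := by
  induction h with
  | coord_fst => exact coord_snd
  | coord_snd => exact coord_fst
  | curv_fst => exact curv_snd
  | curv_snd => exact curv_fst
  | const c => exact const c
  | add _ _ h1 h2 => exact h1.add h2
  | mul _ _ h1 h2 => exact h1.mul h2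
  | inv _ h0 h1 => exact h1.inv h0
  | sqrt _ h0 h1 => exact h1.sqrt h0
  | exp _ h1 => exact h1.exp
  | sin _ h1 => exact h1.sin
  | cos _ h1 => exact h1.cos
  | deriv_fst _ hd h1 => exact h1.deriv_snd hd.swap
  | deriv_snd _ hd h1 => exact h1.deriv_fst hd.swap
  | restrict_snd _ hq hr h1 => exact h1.restrict_fst hq hr
  | restrict_fst _ hq hr h1 => exact h1.restrict_snd hq hr
  | quadrature _ _ hd h1 h2 => exact h2.quadrature h1 hd.swap
  | congr _ he h1 => exact h1.congr he

variable {f g : ℝ × ℝ → ℝ}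

theorem neg (hf : ByQuadratures R A B x y f) : ByQuadratures R A B x y (fun p => -f p) :=
  ((const (-1)).mul hf).congr fun p _ => by ring

theorem sub (hf : ByQuadratures R A B x y f) (hg : ByQuadratures R A B x y g) :
    ByQuadratures R A B x y (fun p => f p - g p) :=
  (hf.add hg.neg).congr fun p _ => by ring

theorem div (hf : ByQuadratures R A B x y f) (hg : ByQuadratures R A B x y g)
    (h0 : ∀ p ∈ R, g p ≠ 0) : ByQuadratures R A B x y (fun p => f p / g p) :=
  (hf.mul (hg.inv h0)).congr fun p _ => by rw [div_eq_mul_inv]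

theorem of_isEmpty (f : ℝ × ℝ → ℝ) : ByQuadratures ∅ A B x y f :=
  (const 0).congr fun _ hp => hp.elim

/-- A primitive of `P dξ` when `ξ` and `P` have been computed. -/
theorem quadrature_of_diff {x' y' P : ℝ × ℝ → ℝ} (hG : IsChartInverse R x y I J G)
    (hx' : ContDiffOn ℝ ∞ x' R)
    (hx : ByQuadratures R A B x y x') (hP : ByQuadratures R A B x y P)
    (hf : HasDifferential R x' y' f P 0) : ByQuadratures R A B x y f := by
  obtain ⟨P', Q', -, -, hd⟩ := hG.exists_partials hx'
  refine (hP.mul (hx.deriv_fst hd)).quadrature (hP.mul (hx.deriv_snd hd)) (f := f) fun p hp => ?_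
  refine (hf p hp).congr_fderiv (ContinuousLinearMap.ext fun v => ?_)
  simp only [add_apply, ContinuousLinearMap.smulRight_apply, hd.fderiv_apply hp, smul_eq_mul,
    Pi.zero_apply]
  ring

/-- The natural coordinates `x'`, `y'` may differ from the chart in which quadratures are taken, and
their labels may be swapped; therefore s is obtained from σ through `quadrature_of_diff`. -/
theorem gaussMap {A' B' x' y' s : ℝ × ℝ → ℝ} {c₀ c₁ c₂ : ℝ} (hG : IsChartInverse R x y I J G)
    (h : IsNaturalPrincipalCoordinates R S A' B' x' y' φ₀ φ₁)
    (hs : IsAdmissible R x' y' φ₀ φ₁ c₀ c₁ c₂ s)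
    (hx : ByQuadratures R A B x y x') (hy : ByQuadratures R A B x y y')
    (h0 : ByQuadratures R A B x y (fun p => φ₀ (x' p)))
    (h1 : ByQuadratures R A B x y (fun p => φ₁ (x' p))) (i : Fin 3) :
    ByQuadratures R A B x y (fun p => gaussMap φ₀ φ₁ c₀ c₁ c₂ x' y' s p i) := by
  have pa := hs.pos_a
  have ph := fun p (hp : p ∈ R) =>
    IsNaturalPrincipalCoordinates.one_add_coeffA_pos hs hp
  have pF := h.num_pos
  have pw := fun p (hp : p ∈ R) => h.sqrt_discriminant_pos hs hp
  have pra := fun p (hp : p ∈ R) => Real.sqrt_pos.2 (pa p hp)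
  have prh := fun p (hp : p ∈ R) => Real.sqrt_pos.2 (ph p hp)
  have bA : ByQuadratures R A B x y (coeffA φ₀ φ₁ c₀ c₁ c₂ x') :=
    ((((const (-1)).sub ((const c₀).mul (h0.mul h0))).sub (((const (2 * c₁)).mul h0).mul h1)).sub
      ((const c₂).mul (h1.mul h1))).congr fun p _ => by rw [coeffA]; ring
  have bh := (const 1).add bA
  have bF : ByQuadratures R A B x y (natNum φ₀ φ₁ x' y') := h1.sub (hy.mul h0)
  have bw : ByQuadratures R A B x y (fun _ => √(c₁ ^ 2 - c₀ * c₂)) := const _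
  have bra := bA.sqrt pa
  have brh := bh.sqrt ph
  have bσ : ByQuadratures R A B x y (sigmaCoeff φ₀ φ₁ c₀ c₁ c₂ x') :=
    bw.div (bh.mul bra) fun p hp => (mul_pos (ph p hp) (pra p hp)).ne'
  have bs := quadrature_of_diff hG h.smooth_fst hx bσ hs.quadrature
  have bC : ByQuadratures R A B x y (centerCoeff φ₀ φ₁ c₀ c₁ c₂ x') :=
    bra.div brh fun p hp => (prh p hp).ne'
  have bτ : ByQuadratures R A B x y (tangentCoeff φ₀ φ₁ c₀ c₁ c₂ x' y') :=
    ((((const c₀).mul h0).add ((const c₁).mul (h1.add (hy.mul h0)))).add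
      (((const c₂).mul hy).mul h1)).div ((bF.mul brh).mul bw) fun p hp =>
        (mul_pos (mul_pos (pF p hp) (prh p hp)) (pw p hp)).ne'
  have bQ : ByQuadratures R A B x y (fun p => c₀ + 2 * c₁ * y' p + c₂ * y' p ^ 2) :=
    (((const c₀).add ((const (2 * c₁)).mul hy)).add ((const c₂).mul (hy.mul hy))).congr
      fun p _ => by ring
  have bT := (bQ.sqrt fun p hp => h.quadratic_pos hs hp).div (bF.mul bw) fun p hp =>
    (mul_pos (pF p hp) (pw p hp)).ne'
  fin_cases i
  · exact (bs.cos.mul bC).sub (bs.sin.mul bτ)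
  · exact bT
  · exact (bs.sin.mul bC).add (bs.cos.mul bτ)

theorem linearMap {n : ℝ × ℝ → E3} (hn : ∀ i, ByQuadratures R A B x y (fun p => n p i))
    (M : E3 ≃ₗᵢ[ℝ] E3) (i : Fin 3) : ByQuadratures R A B x y (fun p => M (n p) i) := by
  have key : ∀ p, M (n p) i = M (EuclideanSpace.single 0 1) i * n p 0 +
      M (EuclideanSpace.single 1 1) i * n p 1 + M (EuclideanSpace.single 2 1) i * n p 2 := by
    intro p
    have : n p = n p 0 • EuclideanSpace.single (0 : Fin 3) (1 : ℝ) +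
        n p 1 • EuclideanSpace.single (1 : Fin 3) (1 : ℝ) +
        n p 2 • EuclideanSpace.single (2 : Fin 3) (1 : ℝ) := by
      ext j
      fin_cases j <;> simp
    conv_lhs => rw [this]
    simp only [map_add, map_smul, PiLp.add_apply, PiLp.smul_apply, smul_eq_mul]
    ring
  exact ((((const _).mul (hn 0)).add ((const _).mul (hn 1))).add ((const _).mul (hn 2))).congr
    fun p _ => (key p).symm

end ByQuadratures

/-- The Gauss map and the immersion of a realization are computed by quadratures as soon as
natural principal coordinates are. -/
theorem IsRealization.byQuadratures (hpc : IsPrincipalCoordinates R S A B x y)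
    (hS : IsTypeI D S A B) (hR : R ⊆ D) {A' B' ξ η : ℝ × ℝ → ℝ} (hS' : IsTypeI D S A' B')
    (h : IsNaturalPrincipalCoordinates R S A' B' ξ η φ₀ φ₁)
    (hξ : ByQuadratures R A B x y ξ) (hη : ByQuadratures R A B x y η)
    (h0 : ByQuadratures R A B x y (fun p => φ₀ (ξ p)))
    (h1 : ByQuadratures R A B x y (fun p => φ₁ (ξ p)))
    {X n : ℝ × ℝ → E3} (hX : IsRealization R S X n) :
    (∀ i, ByQuadratures R A B x y (fun p => n p i)) ∧
      IsRealizationIntegral R A B x y n X ∧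
      (∀ i, ByQuadratures R A B x y (fun p => X p i)) := by
  obtain ⟨I, J, G, hG⟩ := hpc.isRectangularChart.exists_inverse
  have hint := hX.isRealizationIntegral hpc hS hR hG
  obtain ⟨c₀, c₁, c₂, s, M, hs, hM, -⟩ := h.exists_representation hS' hR hX
  have hn : ∀ i, ByQuadratures R A B x y (fun p => n p i) := fun i =>
    (ByQuadratures.linearMap (fun j => ByQuadratures.gaussMap hG h hs hξ hη h0 h1 j) M i).congr
      fun p hp => by rw [hM p hp]
  refine ⟨hn, hint, fun i => ?_⟩
  obtain ⟨nx, ny, hd, hdX⟩ := hint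
  have bA := ByQuadratures.curv_fst (R := R) (A := A) (B := B) (x := x) (y := y) |>.inv
    fun p hp => hS.fst_ne_zero p (hR hp)
  have bB := ByQuadratures.curv_snd (R := R) (A := A) (B := B) (x := x) (y := y) |>.inv
    fun p hp => hS.snd_ne_zero p (hR hp)
  exact (bA.mul ((hn i).deriv_fst (hd.component i))).neg.quadrature
    (bB.mul ((hn i).deriv_snd (hd.component i))).neg (hdX.component i)

end Representation

/-! ### Structure equations and changes of coordinates -/

section NaturalCoordinates

variable {D R : Set (ℝ × ℝ)} {S : ℝ × ℝ → (ℝ × ℝ →L[ℝ] ℝ × ℝ)} {A B x y : ℝ × ℝ → ℝ}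
  {I J : Set ℝ} {G : ℝ × ℝ → ℝ × ℝ}

/-- The exterior derivative of `P dx` is `dP ∧ dx`. -/
theorem extD_smul_fderiv (hR : IsOpen R) (hx : ContDiffOn ℝ ∞ x R) {P : ℝ × ℝ → ℝ}
    {p : ℝ × ℝ} (hp : p ∈ R) (hP : DifferentiableAt ℝ P p)
    {θ : ℝ × ℝ → (ℝ × ℝ →L[ℝ] ℝ)} (hθ : ∀ p ∈ R, θ p = P p • fderiv ℝ x p) (u v : ℝ × ℝ) :
    extD θ p u v = fderiv ℝ P p u * fderiv ℝ x p v - fderiv ℝ P p v * fderiv ℝ x p u := by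
  have hxp := hx.contDiffAt (hR.mem_nhds hp)
  have hdx : DifferentiableAt ℝ (fderiv ℝ x) p :=
    (((contDiffOn_infty_iff_fderiv_of_isOpen hR).1 hx).2.contDiffAt
      (hR.mem_nhds hp)).differentiableAt (by simp)
  have h1 := (hP.hasFDerivAt.smul hdx.hasFDerivAt).congr_of_eventuallyEq (f₁ := θ) (by
    filter_upwards [hR.mem_nhds hp] with q hq using hθ q hq)
  have hsymm : fderiv ℝ (fderiv ℝ x) p u v = fderiv ℝ (fderiv ℝ x) p v u :=
    hxp.isSymmSndFDerivAt (by
      rw [minSmoothness_of_isRCLikeNormedField]; exact WithTop.coe_le_coe.2 le_top) u v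
  simp only [extD, h1.fderiv, add_apply, _root_.smul_apply, ContinuousLinearMap.smulRight_apply,
    smul_eq_mul]
  rw [hsymm]
  ring

/-- The structure equations of an operator of Type I in principal coordinates. -/
theorem IsPrincipalCoordinates.structure_equations (h : IsPrincipalCoordinates R S A B x y)
    (hS : IsTypeI D S A B) (hsys : SatisfiesFirstSystem D (theta₁ S A B) (theta₂ S A B))
    (hR : R ⊆ D) (hG : IsChartInverse R x y I J G) :
    ∃ P Q K P₁ Q₂ K₁ : ℝ × ℝ → ℝ,
      ContDiffOn ℝ ∞ P R ∧ ContDiffOn ℝ ∞ Q R ∧ ContDiffOn ℝ ∞ K R ∧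
      ByQuadratures R A B x y P ∧ ByQuadratures R A B x y K ∧
      (∀ p ∈ R, theta₁ S A B p = P p • fderiv ℝ x p) ∧
      (∀ p ∈ R, theta₂ S A B p = Q p • fderiv ℝ y p) ∧
      (∀ p ∈ R, P p ≠ 0) ∧ (∀ p ∈ R, Q p ≠ 0) ∧
      HasDifferential R x y P P₁ (fun p => -(P p * Q p)) ∧
      HasDifferential R x y Q (fun p => -(K p * (P p * Q p))) Q₂ ∧
      HasDifferential R x y K K₁ (fun p => 2 * (K p - 1) * Q p) := by
  obtain ⟨K, K₂₁, hK, hsys⟩ := hsys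
  have hA := hS.curvatures.smooth_fst.mono hR
  have hB := hS.curvatures.smooth_snd.mono hR
  have hne := fun p (hp : p ∈ R) => hS.curvatures.ne p (hR hp)
  have hA0 := fun p (hp : p ∈ R) => hS.fst_ne_zero p (hR hp)
  have hB0 := fun p (hp : p ∈ R) => hS.snd_ne_zero p (hR hp)
  obtain ⟨A₁, A₂, -, sA₂, dA⟩ := hG.exists_partials hA
  obtain ⟨B₁, B₂, sB₁, -, dB⟩ := hG.exists_partials hB
  have n1 : ∀ p ∈ R, B p * (B p - A p) ≠ 0 := fun p hp =>
    mul_ne_zero (hB0 p hp) (sub_ne_zero.2 (hne p hp).symm)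
  have n2 : ∀ p ∈ R, A p * (A p - B p) ≠ 0 := fun p hp =>
    mul_ne_zero (hA0 p hp) (sub_ne_zero.2 (hne p hp))
  set P : ℝ × ℝ → ℝ := fun p => A p / (B p * (B p - A p)) * B₁ p with hP
  set Q : ℝ × ℝ → ℝ := fun p => B p / (A p * (A p - B p)) * A₂ p with hQ
  have sP : ContDiffOn ℝ ∞ P R := (hA.div (hB.mul (hB.sub hA)) n1).mul sB₁
  have sQ : ContDiffOn ℝ ∞ Q R := (hB.div (hA.mul (hA.sub hB)) n2).mul sA₂
  have bA : ByQuadratures R A B x y A := .curv_fst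
  have bB : ByQuadratures R A B x y B := .curv_snd
  have bP : ByQuadratures R A B x y P := (bA.div (bB.mul (bB.sub bA)) n1).mul (bB.deriv_fst dB)
  have bQ : ByQuadratures R A B x y Q := (bB.div (bA.mul (bA.sub bB)) n2).mul (bA.deriv_snd dA)
  have t1 : ∀ p ∈ R, theta₁ S A B p = P p • fderiv ℝ x p := fun p hp =>
    h.theta₁_eq dB hp (hne p hp)
  have t2 : ∀ p ∈ R, theta₂ S A B p = Q p • fderiv ℝ y p := fun p hp =>
    h.theta₂_eq dA hp (hne p hp)
  have P0 : ∀ p ∈ R, P p ≠ 0 := fun p hp => by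
    refine mul_ne_zero (div_ne_zero (hA0 p hp) (n1 p hp)) fun h0 => ?_
    have := hS.nondeg_snd p (hR hp)
    rw [h.dPrin_eq dB hp (hne p hp), h0, zero_smul] at this
    exact this rfl
  have Q0 : ∀ p ∈ R, Q p ≠ 0 := fun p hp => by
    refine mul_ne_zero (div_ne_zero (hB0 p hp) (n2 p hp)) fun h0 => ?_
    have := hS.nondeg_fst p (hR hp)
    rw [h.swap.dPrin_eq dA.swap hp (hne p hp).symm, h0, zero_smul] at this
    exact this rfl
  obtain ⟨P₁, P₂, -, -, dP⟩ := hG.exists_partials sP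
  obtain ⟨Q₁, Q₂, -, -, dQ⟩ := hG.exists_partials sQ
  obtain ⟨K₁, K₂, -, -, dK⟩ := hG.exists_partials (hK.mono hR)
  have key : ∀ p ∈ R, P₂ p = -(P p * Q p) ∧ Q₁ p = -(K p * (P p * Q p)) ∧
      K₂ p = 2 * (K p - 1) * Q p := by
    intro p hp
    obtain ⟨e₁, e₂, hx1, hy1, hx2, hy2, -⟩ := hG.exists_coordinate_vectors hp
    obtain ⟨s1, s2, s3⟩ := hsys p (hR hp)
    have s1 := s1 e₁ e₂
    have s2 := s2 e₁ e₂
    have s3 := congrArg (fun L => L e₂) s3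
    rw [extD_smul_fderiv h.isOpen h.smooth_fst hp (dP p hp).differentiableAt t1] at s1
    rw [extD_smul_fderiv h.isOpen h.smooth_snd hp (dQ p hp).differentiableAt t2] at s2
    simp only [wedge, t1 p hp, t2 p hp, dP.fderiv_apply hp, dQ.fderiv_apply hp,
      dK.fderiv_apply hp, add_apply, _root_.smul_apply, smul_eq_mul, hx1, hx2, hy1, hy2]
      at s1 s2 s3
    exact ⟨by linarith, by linarith, by linarith⟩
  have dQ' : HasDifferential R x y Q (fun p => -(K p * (P p * Q p))) Q₂ :=
    dQ.congr (fun p hp => (key p hp).2.1) (fun _ _ => rfl)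
  refine ⟨P, Q, K, P₁, Q₂, K₁, sP, sQ, hK.mono hR, bP, ?_, t1, t2, P0, Q0,
    dP.congr (fun _ _ => rfl) (fun p hp => (key p hp).1), dQ',
    dK.congr (fun _ _ => rfl) (fun p hp => (key p hp).2.2)⟩
  -- The invariant K is only given to exist, but Q_x = -KPQ with P, Q ≠ 0 recovers it by a
  -- differentiation and a division.
  refine ((bQ.deriv_fst dQ').neg.div (bP.mul bQ) fun p hp =>
    mul_ne_zero (P0 p hp) (Q0 p hp)).congr fun p hp => ?_
  have := P0 p hp
  have := Q0 p hp
  field_simp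

/-! ### Separate changes of the two coordinates -/

/-- Since ξ depends only on x, both points can be moved to a common x-line, where Rolle's theorem
would produce a zero of ρ. -/
theorem IsChartInverse.injective_of_diff (hG : IsChartInverse R x y I J G) {ξ ρ : ℝ × ℝ → ℝ}
    (dξ : HasDifferential R x y ξ ρ 0) (hρ : ∀ p ∈ R, ρ p ≠ 0) {p p' : ℝ × ℝ} (hp : p ∈ R)
    (hp' : p' ∈ R) (he : ξ p = ξ p') : x p = x p' := by
  wlog hlt : x p < x p' generalizing p p'
  · rcases lt_or_eq_of_le (not_lt.1 hlt) with h1 | h1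
    · exact (this hp' hp he.symm h1).symm
    · exact h1.symm
  have hy := hG.y_mem p hp
  have hI : ∀ t ∈ Set.Icc (x p) (x p'), t ∈ I := fun t ht =>
    hG.ordConnected_fst.out (hG.x_mem p hp) (hG.x_mem p' hp') ht
  have hd : ∀ t ∈ I, HasDerivAt (fun t => ξ (G (t, y p))) (ρ (G (t, y p))) t := by
    intro t ht
    have := (hG.hasFDerivAt_comp dξ ht hy).comp_hasDerivAt t
      ((hasDerivAt_id t).prodMk (hasDerivAt_const t (y p)))
    simpa [Function.comp_def] using this
  have hq := hG.maps _ (hG.x_mem p' hp') _ hy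
  obtain ⟨c, hc, h0⟩ := exists_hasDerivAt_eq_zero hlt
    (fun t ht => (hd t (hI t ht)).continuousAt.continuousWithinAt)
    (by
      rw [hG.left_inv p hp, he]
      exact hG.eq_of_x_eq dξ hp' hq (hG.x_apply _ (hG.x_mem p' hp') _ hy).symm)
    (fun t ht => hd t (hI t (Set.Ioo_subset_Icc_self ht)))
  exact absurd h0 (hρ _ (hG.maps _ (hI c (Set.Ioo_subset_Icc_self hc)) _ hy))

theorem HasDifferential.fderiv_eq {ξ ρ : ℝ × ℝ → ℝ} (dξ : HasDifferential R x y ξ ρ 0)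
    {p : ℝ × ℝ} (hp : p ∈ R) : fderiv ℝ ξ p = ρ p • fderiv ℝ x p := by
  refine ContinuousLinearMap.ext fun v => ?_
  rw [dξ.fderiv_apply hp]
  simp [mul_comm]

theorem IsChartInverse.isOpen_image (hG : IsChartInverse R x y I J G) {ξ ρ : ℝ × ℝ → ℝ}
    (sξ : ContDiffOn ℝ ∞ ξ R)
    (dξ : HasDifferential R x y ξ ρ 0) (hρ : ∀ p ∈ R, ρ p ≠ 0) : IsOpen (ξ '' R) := by
  rw [isOpen_iff_mem_nhds]
  rintro _ ⟨p, hp, rfl⟩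
  have h1 := (sξ.contDiffAt (hG.isOpen.mem_nhds hp)).hasStrictFDerivAt (by simp)
  have h2 : (fderiv ℝ ξ p : ℝ × ℝ →ₗ[ℝ] ℝ).range = ⊤ := by
    obtain ⟨e₁, -, hx1, -⟩ := hG.exists_coordinate_vectors hp
    rw [LinearMap.range_eq_top]
    intro t
    refine ⟨(t / ρ p) • e₁, ?_⟩
    have := hρ p hp
    simp [dξ.fderiv_eq hp, hx1]
    field_simp
  rw [← h1.map_nhds_eq_of_surj h2]
  exact Filter.image_mem_map (hG.isOpen.mem_nhds hp)

/-- Here ξ is a function of x alone and η of y alone, so values of the two can be prescribed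
independently: the image is the product of two open intervals. -/
theorem IsChartInverse.isRectangularChart_of_diff (hG : IsChartInverse R x y I J G)
    {ξ ρ η ε : ℝ × ℝ → ℝ} (sξ : ContDiffOn ℝ ∞ ξ R) (sη : ContDiffOn ℝ ∞ η R)
    (dξ : HasDifferential R x y ξ ρ 0) (hρ : ∀ p ∈ R, ρ p ≠ 0)
    (dη : HasDifferential R x y η 0 ε) (hε : ∀ p ∈ R, ε p ≠ 0) :
    IsRectangularChart R ξ η where
  isOpen := hG.isOpen
  smooth_fst := sξ
  smooth_snd := sη
  indep := fun p hp => by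
    obtain ⟨e₁, e₂, hx1, hy1, hx2, hy2, -⟩ := hG.exists_coordinate_vectors hp
    rw [LinearIndependent.pair_iff]
    intro s t hst
    have h1 := congrArg (fun L => L e₁) hst
    have h2 := congrArg (fun L => L e₂) hst
    simpa [dξ.fderiv_eq hp, dη.swap.fderiv_eq hp, hx1, hy1, hx2, hy2, hρ p hp, hε p hp]
      using And.intro h1 h2
  injOn := fun p hp q hq hpq => by
    have h1 := hG.injective_of_diff dξ hρ hp hq (congrArg Prod.fst hpq)
    have h2 := hG.swap.injective_of_diff dη.swap hε hp hq (congrArg Prod.snd hpq)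
    rw [← hG.left_inv p hp, h1, h2, hG.left_inv q hq]
  rectangle := by
    refine ⟨ξ '' R, η '' R, hG.isOpen_image sξ dξ hρ,
      (hG.isPreconnected.image ξ sξ.continuousOn).ordConnected,
      hG.swap.isOpen_image sη dη.swap hε,
      (hG.isPreconnected.image η sη.continuousOn).ordConnected, ?_⟩
    ext ⟨a, b⟩
    constructor
    · rintro ⟨p, hp, hpe⟩
      rw [Prod.mk.injEq] at hpe
      exact ⟨⟨p, hp, hpe.1⟩, ⟨p, hp, hpe.2⟩⟩
    · rintro ⟨⟨p, hp, rfl⟩, ⟨q, hq, rfl⟩⟩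
      have hx := hG.x_mem p hp
      have hy := hG.y_mem q hq
      have hm := hG.maps _ hx _ hy
      exact ⟨_, hm, Prod.ext (hG.eq_of_x_eq dξ hm hp (hG.x_apply _ hx _ hy))
        (hG.eq_of_y_eq dη hm hq (hG.y_apply _ hx _ hy))⟩

/-- A function with vanishing `y`-derivative is a smooth function of `x`. -/
theorem IsChartInverse.exists_factor (hG : IsChartInverse R x y I J G) {f P : ℝ × ℝ → ℝ}
    (sf : ContDiffOn ℝ ∞ f R) (df : HasDifferential R x y f P 0) :
    ∃ φ : ℝ → ℝ, ContDiffOn ℝ ∞ φ (x '' R) ∧ ∀ p ∈ R, φ (x p) = f p ∧ deriv φ (x p) = P p := by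
  rcases R.eq_empty_or_nonempty with rfl | ⟨p₀, hp₀⟩
  · exact ⟨0, by simp, by simp⟩
  have hy := hG.y_mem p₀ hp₀
  have hval : ∀ p ∈ R, ∀ {g g' : ℝ × ℝ → ℝ}, HasDifferential R x y g g' 0 →
      g (G (x p, y p₀)) = g p := fun p hp g g' hg =>
    hG.eq_of_x_eq hg (hG.maps _ (hG.x_mem p hp) _ hy) hp (hG.x_apply _ (hG.x_mem p hp) _ hy)
  obtain ⟨P₁, P₂, -, -, dP⟩ := hG.exists_partials (hG.contDiffOn_partials sf df).1
  have dP' : HasDifferential R x y P P₁ 0 := dP.congr (fun _ _ => rfl) fun p hp =>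
    hG.mixed_partials df dP (HasDifferential.const 0) hp
  refine ⟨fun t => f (G (t, y p₀)), ?_, fun p hp => ⟨hval p hp df, ?_⟩⟩
  · have : ContDiffOn ℝ ∞ (fun t : ℝ => G (t, y p₀)) (x '' R) :=
      hG.smooth.comp (contDiffOn_id.prodMk contDiffOn_const) (by
        rintro _ ⟨p, hp, rfl⟩
        exact ⟨hG.x_mem p hp, hy⟩)
    refine sf.comp this ?_
    rintro _ ⟨p, hp, rfl⟩
    exact hG.maps _ (hG.x_mem p hp) _ hy
  · have := (hG.hasFDerivAt_comp df (hG.x_mem p hp) hy).comp_hasDerivAt (x p)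
      ((hasDerivAt_id (x p)).prodMk (hasDerivAt_const (x p) (y p₀)))
    have hd : HasDerivAt (fun t => f (G (t, y p₀))) (P (G (x p, y p₀))) (x p) := by
      simpa [Function.comp_def] using this
    rw [hd.deriv, hval p hp dP']

theorem HasDifferential.change {f P ξ ρ η : ℝ × ℝ → ℝ} (df : HasDifferential R x y f P 0)
    (dξ : HasDifferential R x y ξ ρ 0) (hρ : ∀ p ∈ R, ρ p ≠ 0) :
    HasDifferential R ξ η f (fun p => P p / ρ p) 0 := fun p hp => by
  refine (df p hp).congr_fderiv (ContinuousLinearMap.ext fun v => ?_)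
  have := hρ p hp
  simp [dξ.fderiv_eq hp]
  field_simp

/-- Solutions of the linear equation `u_x = g u` do not change sign along the `x`-lines. -/
theorem IsChartInverse.neg_of_diff (hG : IsChartInverse R x y I J G) {u g u₂ g₁ g₂ : ℝ × ℝ → ℝ}
    (du : HasDifferential R x y u (fun p => g p * u p) u₂)
    (dg : HasDifferential R x y g g₁ g₂) {p q : ℝ × ℝ} (hp : p ∈ R) (hq : q ∈ R)
    (hy : y p = y q) (hneg : u q < 0) : u p < 0 := by
  -- Integrating factor on the single x-line through q: u e^{-Λ} is constant there.
  obtain ⟨Λ, hΛ⟩ := hG.exists_primitive (hG.restrict hq dg) (HasDifferential.const (0 : ℝ))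
    (fun _ _ => rfl)
  have h1 : HasDifferential R x y (fun p => u (G (x p, y q)) * Real.exp (-Λ p)) 0 0 :=
    ((hG.restrict hq du).mul hΛ.neg.exp).congr (fun p _ => by simp; ring) (fun p _ => by simp)
  have h2 := hG.eq_of_hasDifferential_zero h1 hp hq
  simp only [← hy, hG.left_inv p hp] at h2
  rw [hy, hG.left_inv q hq] at h2
  have e1 := Real.exp_pos (-Λ p)
  have e2 := Real.exp_pos (-Λ q)
  by_contra hcon
  have h3 : 0 ≤ u p * Real.exp (-Λ p) := mul_nonneg (not_lt.1 hcon) e1.le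
  have h4 : u q * Real.exp (-Λ q) < 0 := mul_neg_of_neg_of_pos hneg e2
  linarith

/-- A change of sign would force a zero of P by the intermediate value theorem. -/
theorem div_pos_of_isPreconnected (hR : IsPreconnected R) {P : ℝ × ℝ → ℝ}
    (hc : ContinuousOn P R) (h0 : ∀ p ∈ R, P p ≠ 0) {p q : ℝ × ℝ} (hp : p ∈ R) (hq : q ∈ R) :
    0 < P p / P q := by
  by_contra hcon
  have hle : P p / P q ≤ 0 := not_lt.1 hcon
  have h1 : (0 : ℝ) ∈ Set.Icc (P p / P q) (P q / P q) :=
    ⟨hle, by rw [div_self (h0 q hq)]; exact zero_le_one⟩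
  obtain ⟨z, hz, hz0⟩ := hR.intermediate_value hp hq (hc.div_const (P q)) h1
  exact (div_ne_zero (h0 z hz) (h0 q hq)) hz0

end NaturalCoordinates

/-! ### Natural principal coordinates from a Riccati equation -/

section NaturalCoordinates

variable {D R : Set (ℝ × ℝ)} {S : ℝ × ℝ → (ℝ × ℝ →L[ℝ] ℝ × ℝ)} {A B x y : ℝ × ℝ → ℝ}

/-- Natural principal coordinates are computed by quadratures. -/
theorem IsPrincipalCoordinates.exists_natural (h : IsPrincipalCoordinates R S A B x y)
    (hS : IsTypeI D S A B) (hsys : SatisfiesFirstSystem D (theta₁ S A B) (theta₂ S A B))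
    (hR : R ⊆ D) : ∃ (ξ η : ℝ × ℝ → ℝ) (φ₀ φ₁ : ℝ → ℝ),
      IsNaturalPrincipalCoordinates R S A B ξ η φ₀ φ₁ ∧
      ByQuadratures R A B x y ξ ∧ ByQuadratures R A B x y η ∧
      ByQuadratures R A B x y (fun p => φ₀ (ξ p)) ∧
      ByQuadratures R A B x y (fun p => φ₁ (ξ p)) := by
  rcases R.eq_empty_or_nonempty with rfl | ⟨q, hq⟩
  · exact ⟨x, y, 0, 0, ⟨h, by simp, by simp, by simp, by simp, by simp, by simp, by simp⟩,
      .of_isEmpty _, .of_isEmpty _, .of_isEmpty _, .of_isEmpty _⟩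
  obtain ⟨I, J, G, hG⟩ := h.isRectangularChart.exists_inverse
  obtain ⟨P, Q, K, P₁, Q₂, K₁, sP, sQ, sK, bP, bK, t1, t2, P0, Q0, dP, dQ, dK⟩ :=
    h.structure_equations hS hsys hR hG
  have k0 := HasDifferential.const (R := R) (x := x) (y := y) (0 : ℝ)
  have c := fun c : ℝ => HasDifferential.const (R := R) (x := x) (y := y) c
  have sc : ∀ c : ℝ, ContDiffOn ℝ ∞ (fun _ : ℝ × ℝ => c) R := fun _ => contDiffOn_const
  -- the Riccati equation `P_x = - P ^ 2 + k P + m`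
  have sP₁ := (hG.contDiffOn_partials sP dP).1
  obtain ⟨P₁₁, P₁₂, -, -, dP₁⟩ := hG.exists_partials sP₁
  set k : ℝ × ℝ → ℝ := fun p => P₁ p / P p + (2 - K p) * P p with hk
  set m : ℝ × ℝ → ℝ := fun p => (K p - 1) * (P p * P p) with hm
  have hP₁ : ∀ p ∈ R, P₁ p = -P p ^ 2 + k p * P p + m p := fun p hp => by
    have := P0 p hp
    simp only [hk, hm]
    field_simp
    ring
  -- Independence of y: (log P)_xy = -Q_x = KPQ cancels the y-derivative -KPQ of (2 - K)P, by the
  -- equations for P_y and K_y.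
  obtain ⟨k₁, dk⟩ : ∃ k₁, HasDifferential R x y k k₁ 0 := by
    refine ⟨_, ((dP₁.div dP P0).add (((c 2).sub dK).mul dP)).congr (fun _ _ => rfl)
      fun p hp => ?_⟩
    have hmix := hG.mixed_partials dP dP₁ (dP.mul dQ).neg hp
    have := P0 p hp
    simp only [Pi.zero_apply]
    rw [hmix]
    field_simp
    ring
  obtain ⟨m₁, dm⟩ : ∃ m₁, HasDifferential R x y m m₁ 0 :=
    ⟨_, ((dK.sub (c 1)).mul (dP.mul dP)).congr (fun _ _ => rfl) fun p hp => by
      simp only [Pi.zero_apply]; ring⟩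
  have sk : ContDiffOn ℝ ∞ k R := (sP₁.div sP P0).add (((sc 2).sub sK).mul sP)
  have bk : ByQuadratures R A B x y k :=
    ((bP.deriv_fst dP).div bP P0).add (((ByQuadratures.const 2).sub bK).mul bP)
  -- the parameter `ξ`
  obtain ⟨κ, dκ⟩ := hG.exists_primitive dk k0 (fun _ _ => rfl)
  have bκ : ByQuadratures R A B x y κ := bk.quadrature (.const 0) dκ
  -- Taking ξ_x = ρ with ρ_x = kρ removes the first-order term from f'' = kf' + mf. The
  -- normalization ρ(q) = P(q) makes P/ρ positive, whatever the sign of P.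
  set ρ : ℝ × ℝ → ℝ := fun p => P q * Real.exp (κ p - κ q) with hρ
  have dρ : HasDifferential R x y ρ (fun p => k p * ρ p) 0 :=
    ((c (P q)).mul (dκ.sub (c (κ q))).exp).congr (fun p hp => by simp [hρ]; ring)
      (fun p hp => by simp)
  have ρ0 : ∀ p ∈ R, ρ p ≠ 0 := fun p hp => mul_ne_zero (P0 q hq) (Real.exp_pos _).ne'
  have ρq : ρ q = P q := by simp [hρ]
  have sρ : ContDiffOn ℝ ∞ ρ R :=
    (sc _).mul (((hG.contDiffOn dκ sk (sc 0)).sub (sc _)).exp)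
  have bρ : ByQuadratures R A B x y ρ :=
    (ByQuadratures.const _).mul (bκ.sub (.const _)).exp
  obtain ⟨ξ, dξ⟩ := hG.exists_primitive dρ k0 (fun _ _ => rfl)
  have sξ := hG.contDiffOn dξ sρ (sc 0)
  -- two solutions of the linear equation
  set r : ℝ × ℝ → ℝ := fun p => P (G (x p, y q)) with hr
  have hrm : ∀ p ∈ R, G (x p, y q) ∈ R := fun p hp =>
    hG.maps _ (hG.x_mem p hp) _ (hG.y_mem q hq)
  have hrx : ∀ p ∈ R, x (G (x p, y q)) = x p := fun p hp =>
    hG.x_apply _ (hG.x_mem p hp) _ (hG.y_mem q hq)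
  have dr : HasDifferential R x y r (fun p => -r p ^ 2 + k p * r p + m p) 0 :=
    (hG.restrict hq dP).congr (fun p hp => by
      rw [hP₁ _ (hrm p hp), hG.eq_of_x_eq dk (hrm p hp) hp (hrx p hp),
        hG.eq_of_x_eq dm (hrm p hp) hp (hrx p hp)]) (fun _ _ => rfl)
  have rq : r q = P q := by simp only [hr, hG.left_inv q hq]
  have sr : ContDiffOn ℝ ∞ r R := sP.comp (hG.smooth.comp (hG.smooth_x.prodMk (sc _))
    fun p hp => ⟨hG.x_mem p hp, hG.y_mem q hq⟩) hrm
  have br : ByQuadratures R A B x y r :=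
    bP.restrict_snd hq fun p hp p' hp' hx hy => by
      simp only [hr]
      rw [← hx, ← hy, hG.left_inv p' hp']
  obtain ⟨Λ, dΛ⟩ := hG.exists_primitive dr k0 (fun _ _ => rfl)
  set f₁ : ℝ × ℝ → ℝ := fun p => Real.exp (Λ p) with hf₁
  have df₁ : HasDifferential R x y f₁ (fun p => f₁ p * r p) 0 :=
    dΛ.exp.congr (fun _ _ => rfl) (fun p _ => by simp)
  have f₁0 : ∀ p, 0 < f₁ p := fun p => Real.exp_pos _
  have sf₁ : ContDiffOn ℝ ∞ f₁ R := (hG.contDiffOn dΛ sr (sc 0)).exp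
  have bf₁ : ByQuadratures R A B x y f₁ := (br.quadrature (.const 0) dΛ).exp
  -- Reduction of order: a second solution is f₁ times a primitive of -ρ/f₁², which gives Wronskian
  -- 1 with respect to ξ.
  have dι' : HasDifferential R x y (fun p => ρ p / (f₁ p * f₁ p)) _ _ :=
    dρ.div (df₁.mul df₁) fun p _ => (mul_pos (f₁0 p) (f₁0 p)).ne'
  obtain ⟨ι, dι⟩ := hG.exists_primitive dι' k0 (fun p _ => by simp)
  have sι' : ContDiffOn ℝ ∞ (fun p => ρ p / (f₁ p * f₁ p)) R :=
    sρ.div (sf₁.mul sf₁) fun p _ => (mul_pos (f₁0 p) (f₁0 p)).ne'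
  have bι : ByQuadratures R A B x y ι :=
    (bρ.div (bf₁.mul bf₁) fun p _ => (mul_pos (f₁0 p) (f₁0 p)).ne').quadrature (.const 0) dι
  -- The constant is fixed by f₀(q) = 1/f₁(q), which simplifies N₀ on the line x = x(q) and settles
  -- its sign.
  set C : ℝ := ι q + 1 / f₁ q ^ 2 with hC
  set f₀ : ℝ × ℝ → ℝ := fun p => f₁ p * (C - ι p) with hf₀
  have df₀ : HasDifferential R x y f₀ (fun p => f₀ p * r p - ρ p / f₁ p) 0 :=
    (df₁.mul ((c C).sub dι)).congr (fun p hp => by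
      have := f₁0 p
      simp only [hf₀, Pi.zero_apply]
      field_simp
      ring) (fun p hp => by simp)
  have sf₀ : ContDiffOn ℝ ∞ f₀ R := sf₁.mul ((sc C).sub (hG.contDiffOn dι sι' (sc 0)))
  have bf₀ : ByQuadratures R A B x y f₀ := bf₁.mul ((ByQuadratures.const C).sub bι)
  have f₀q : f₀ q = 1 / f₁ q := by
    have := f₁0 q
    simp only [hf₀, hC]
    field_simp
    ring
  -- the parameter `η`
  set N₀ : ℝ × ℝ → ℝ := fun p => (r p - P p) / ρ p * f₀ p - 1 / f₁ p with hN₀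
  set N₁ : ℝ × ℝ → ℝ := fun p => (r p - P p) / ρ p * f₁ p with hN₁
  have dN₀ : HasDifferential R x y N₀ (fun p => -P p * N₀ p)
      (fun p => P p * Q p / ρ p * f₀ p) := by
    refine ((((dr.sub dP).div dρ ρ0).mul df₀).sub ((c 1).div df₁ fun p _ =>
      (f₁0 p).ne')).congr (fun p hp => ?_) (fun p hp => ?_)
    all_goals
      have := f₁0 p
      have := ρ0 p hp
    · rw [hP₁ p hp]
      simp only [hN₀, Pi.zero_apply]
      field_simp
      ring
    · simp only [Pi.zero_apply]
      field_simp
      ring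
  have dN₁ : HasDifferential R x y N₁ (fun p => -P p * N₁ p)
      (fun p => P p * Q p / ρ p * f₁ p) := by
    refine (((dr.sub dP).div dρ ρ0).mul df₁).congr (fun p hp => ?_) (fun p hp => ?_)
    all_goals
      have := ρ0 p hp
    · rw [hP₁ p hp]
      simp only [hN₁]
      field_simp
      ring
    · simp only [Pi.zero_apply]
      field_simp
      ring
  have hpos := fun p (hp : p ∈ R) p' (hp' : p' ∈ R) =>
    div_pos_of_isPreconnected hG.isPreconnected sP.continuousOn P0 hp hp'
  have hN₀neg : ∀ p ∈ R, N₀ p < 0 := by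
    intro p hp
    -- Compare with the point on the same x-line having x = x(q). There r = ρ = P(q) and f₀ = 1/f₁,
    -- so N₀ = -(P/P(q))/f₁(q) is negative; N₀ solves a linear equation along the x-line and keeps
    -- its sign.
    have hb := hG.maps _ (hG.x_mem q hq) _ (hG.y_mem p hp)
    have hbx := hG.x_apply _ (hG.x_mem q hq) _ (hG.y_mem p hp)
    refine hG.neg_of_diff dN₀ dP.neg hp hb (hG.y_apply _ (hG.x_mem q hq) _ (hG.y_mem p hp)).symm ?_
    have e := hpos _ hb q hq
    have e1 := f₁0 q
    have e2 := P0 q hq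
    simp only [hN₀]
    rw [hG.eq_of_x_eq dr hb hq hbx, hG.eq_of_x_eq dρ hb hq hbx, hG.eq_of_x_eq df₀ hb hq hbx,
      hG.eq_of_x_eq df₁ hb hq hbx, f₀q, ρq, rq, sub_div, div_self e2]
    have : (1 - P (G (x q, y p)) / P q) * (1 / f₁ q) - 1 / f₁ q =
      -(P (G (x q, y p)) / P q * (1 / f₁ q)) := by ring
    rw [this, neg_lt_zero]
    positivity
  have N₀0 := fun p hp => (hN₀neg p hp).ne
  -- Obtained by solving P = (f₁ - ηf₀)_x/(f₁ - ηf₀) for η with η constant in x: it labels the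
  -- Riccati solution that P follows on each x-line.
  set η : ℝ × ℝ → ℝ := fun p => N₁ p / N₀ p with hη
  -- Divided by N₀ this reads f₁ - ηf₀ = -1/N₀, so positivity of F is negativity of N₀.
  have hdet : ∀ p ∈ R, f₁ p * N₀ p - N₁ p * f₀ p = -1 := fun p hp => by
    have := f₁0 p
    have := ρ0 p hp
    simp only [hN₀, hN₁]
    field_simp
    ring
  have dη : HasDifferential R x y η 0 (fun p => -(P p * Q p / ρ p) / N₀ p ^ 2) :=
    (dN₁.div dN₀ N₀0).congr (fun p hp => by simp only [Pi.zero_apply]; ring) (fun p hp => by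
      congr 1
      linear_combination (P p * Q p / ρ p) * hdet p hp)
  have sN₀ : ContDiffOn ℝ ∞ N₀ R := (((sr.sub sP).div sρ ρ0).mul sf₀).sub
    ((sc 1).div sf₁ fun p _ => (f₁0 p).ne')
  have sN₁ : ContDiffOn ℝ ∞ N₁ R := ((sr.sub sP).div sρ ρ0).mul sf₁
  have sη : ContDiffOn ℝ ∞ η R := sN₁.div sN₀ N₀0
  have bη : ByQuadratures R A B x y η := (((br.sub bP).div bρ ρ0).mul bf₁).div
    ((((br.sub bP).div bρ ρ0).mul bf₀).sub ((ByQuadratures.const 1).div bf₁ fun p _ =>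
      (f₁0 p).ne')) N₀0
  have η0 : ∀ p ∈ R, -(P p * Q p / ρ p) / N₀ p ^ 2 ≠ 0 := fun p hp =>
    div_ne_zero (neg_ne_zero.2 (div_ne_zero (mul_ne_zero (P0 p hp) (Q0 p hp)) (ρ0 p hp)))
      (pow_ne_zero 2 (N₀0 p hp))
  have hchart := hG.isRectangularChart_of_diff sξ sη dξ ρ0 dη η0
  obtain ⟨I', J', G', hG'⟩ := hchart.exists_inverse
  obtain ⟨φ₀, sφ₀, hφ₀⟩ := hG'.exists_factor sf₀ (df₀.change dξ ρ0)
  obtain ⟨φ₁, sφ₁, hφ₁⟩ := hG'.exists_factor sf₁ (df₁.change dξ ρ0)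
  have eF : ∀ p ∈ R, natNum φ₀ φ₁ ξ η p = -1 / N₀ p := fun p hp => by
    rw [natNum, (hφ₀ p hp).1, (hφ₁ p hp).1, eq_div_iff (N₀0 p hp), ← hdet p hp]
    simp only [hη]
    have := N₀0 p hp
    field_simp
  have eH : ∀ p ∈ R, natDen φ₀ φ₁ ξ η p = P p / ρ p * (-1 / N₀ p) := fun p hp => by
    rw [← eF p hp, natNum, natDen, (hφ₀ p hp).2, (hφ₁ p hp).2, (hφ₀ p hp).1, (hφ₁ p hp).1]
    have e : η p * N₀ p = N₁ p := div_mul_cancel₀ _ (N₀0 p hp)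
    have := f₁0 p
    have := ρ0 p hp
    simp only [hN₀, hN₁] at e
    generalize η p = t at e ⊢
    field_simp at e ⊢
    linear_combination -e
  have hPρ : ∀ p ∈ R, 0 < P p / ρ p := fun p hp => by
    have := hpos p hp q hq
    simp only [hρ]
    rw [← div_div]
    exact div_pos this (Real.exp_pos _)
  have hF : ∀ p ∈ R, 0 < -1 / N₀ p := fun p hp =>
    div_pos_of_neg_of_neg (by norm_num) (hN₀neg p hp)
  refine ⟨ξ, η, φ₀, φ₁, { hchart with
    diag_fst := fun p hp => ?_
    diag_snd := fun p hp => ?_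
    smooth_phi₀ := sφ₀
    smooth_phi₁ := sφ₁
    wronskian := ?_
    num_pos := fun p hp => by rw [eF p hp]; exact hF p hp
    den_pos := fun p hp => by rw [eH p hp]; exact mul_pos (hPρ p hp) (hF p hp)
    theta₁_eq := fun p hp => ?_
    theta₂_eq := fun p hp => ?_ }, bρ.quadrature (.const 0) dξ, bη,
    bf₀.congr fun p hp => (hφ₀ p hp).1.symm, bf₁.congr fun p hp => (hφ₁ p hp).1.symm⟩
  · rw [dξ.fderiv_eq hp, ContinuousLinearMap.smul_comp, h.diag_fst p hp, smul_comm]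
  · rw [dη.swap.fderiv_eq hp, ContinuousLinearMap.smul_comp, h.diag_snd p hp, smul_comm]
  · rintro _ ⟨p, hp, rfl⟩
    rw [(hφ₀ p hp).2, (hφ₁ p hp).2, (hφ₀ p hp).1, (hφ₁ p hp).1]
    have := f₁0 p
    have := ρ0 p hp
    field_simp
    ring
  · have := N₀0 p hp
    have := ρ0 p hp
    rw [t1 p hp, dξ.fderiv_eq hp, eF p hp, eH p hp, smul_smul]
    congr 1
    field_simp
  · have := N₀0 p hp
    have := ρ0 p hp
    have := P0 p hp
    rw [t2 p hp, dη.swap.fderiv_eq hp, eF p hp, eH p hp, smul_smul]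
    congr 1
    field_simp

end NaturalCoordinates

theorem mainTheorem9 (D : Set (ℝ × ℝ)) (hD : IsOpen D)
    (S : ℝ × ℝ → (ℝ × ℝ →L[ℝ] ℝ × ℝ)) (A B : ℝ × ℝ → ℝ) (hS : IsTypeI D S A B) :
    -- arbitrary principal coordinates
    (∀ (R : Set (ℝ × ℝ)) (x y : ℝ × ℝ → ℝ), R ⊆ D → IsPrincipalCoordinates R S A B x y →
      -- natural principal coordinates (for one of the two labellings of the principal families)
      -- are computed by quadratures
      (∃ (ξ η : ℝ × ℝ → ℝ) (φ₀ φ₁ : ℝ → ℝ),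
        (IsNaturalPrincipalCoordinates R S A B ξ η φ₀ φ₁ ∨
          IsNaturalPrincipalCoordinates R S B A ξ η φ₀ φ₁) ∧
        ByQuadratures R A B x y ξ ∧ ByQuadratures R A B x y η ∧
        ByQuadratures R A B x y (fun p => φ₀ (ξ p)) ∧
        ByQuadratures R A B x y (fun p => φ₁ (ξ p))) ∧
      -- every realization is computed by quadratures, the immersion from the Gauss map
      (∀ X n : ℝ × ℝ → E3, IsRealization R S X n →
        (∀ i, ByQuadratures R A B x y (fun p => n p i)) ∧
        IsRealizationIntegral R A B x y n X ∧
        (∀ i, ByQuadratures R A B x y (fun p => X p i)))) ∧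
    -- in natural principal coordinates the computation is explicit
    (∀ (R : Set (ℝ × ℝ)) (x y : ℝ × ℝ → ℝ) (φ₀ φ₁ : ℝ → ℝ), R ⊆ D →
      IsNaturalPrincipalCoordinates R S A B x y φ₀ φ₁ →
      -- the quadrature for `s` is possible
      (∀ c₀ c₁ c₂ : ℝ, (∀ p ∈ R, 0 < coeffA φ₀ φ₁ c₀ c₁ c₂ x p) →
        (∀ p ∈ R, 0 < coeffB φ₀ φ₁ c₀ c₁ c₂ x y p) →
        ∃ s : ℝ × ℝ → ℝ, IsAdmissible R x y φ₀ φ₁ c₀ c₁ c₂ s) ∧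
      -- the quadrature for the immersion is possible, and its results are realizations
      (∀ (c₀ c₁ c₂ : ℝ) (s : ℝ × ℝ → ℝ), IsAdmissible R x y φ₀ φ₁ c₀ c₁ c₂ s →
        (∃ X, IsRealizationIntegral R A B x y (gaussMap φ₀ φ₁ c₀ c₁ c₂ x y s) X) ∧
        ∀ X, IsRealizationIntegral R A B x y (gaussMap φ₀ φ₁ c₀ c₁ c₂ x y s) X →
          IsRealization R S X (gaussMap φ₀ φ₁ c₀ c₁ c₂ x y s)) ∧
      -- every realization arises in this way, up to an orthogonal transformation of `e₃`
      (∀ X n : ℝ × ℝ → E3, IsRealization R S X n →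
        ∃ (c₀ c₁ c₂ : ℝ) (s : ℝ × ℝ → ℝ) (M : E3 ≃ₗᵢ[ℝ] E3),
          IsAdmissible R x y φ₀ φ₁ c₀ c₁ c₂ s ∧
          (∀ p ∈ R, n p = M (gaussMap φ₀ φ₁ c₀ c₁ c₂ x y s p)) ∧
          IsRealizationIntegral R A B x y n X)) := by

  constructor
  · intro R x y hR h
    obtain ⟨ξ, η, φ₀, φ₁, hnat, hξ, hη, h0, h1⟩ : ∃ (ξ η : ℝ × ℝ → ℝ) (φ₀ φ₁ : ℝ → ℝ),
        (IsNaturalPrincipalCoordinates R S A B ξ η φ₀ φ₁ ∨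
          IsNaturalPrincipalCoordinates R S B A ξ η φ₀ φ₁) ∧
        ByQuadratures R A B x y ξ ∧ ByQuadratures R A B x y η ∧
        ByQuadratures R A B x y (fun p => φ₀ (ξ p)) ∧
        ByQuadratures R A B x y (fun p => φ₁ (ξ p)) := by
      rcases hS.system with hsys | hsys
      · obtain ⟨ξ, η, φ₀, φ₁, hn, h1, h2, h3, h4⟩ := h.exists_natural hS hsys hR
        exact ⟨ξ, η, φ₀, φ₁, Or.inl hn, h1, h2, h3, h4⟩
      -- The dual system is the first system for the swapped labels; the computations are carried
      -- back because computability by quadratures is symmetric in the two families.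
      · obtain ⟨ξ, η, φ₀, φ₁, hn, h1, h2, h3, h4⟩ := h.swap.exists_natural hS.swap hsys hR
        exact ⟨ξ, η, φ₀, φ₁, Or.inr hn, h1.swap, h2.swap, h3.swap, h4.swap⟩
    refine ⟨⟨ξ, η, φ₀, φ₁, hnat, hξ, hη, h0, h1⟩, fun X n hX => ?_⟩
    rcases hnat with hn | hn
    · exact hX.byQuadratures h hS hR hS hn hξ hη h0 h1
    · exact hX.byQuadratures h hS hR hS.swap hn hξ hη h0 h1
  · intro R x y φ₀ φ₁ hR h
    have hpc := h.toIsPrincipalCoordinates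
    obtain ⟨I, J, G, hG⟩ := hpc.isRectangularChart.exists_inverse
    have hN := h.isNaturalPair hG
    refine ⟨fun c₀ c₁ c₂ ha hb => h.exists_admissible hG ha hb, fun c₀ c₁ c₂ s hs => ?_,
      fun X n hX => h.exists_representation hS hR hX⟩
    obtain ⟨c, v, hn⟩ := h.gaussField hG hs
    exact ⟨hn.exists_integral hpc hS hR hG hN h.theta₁_eq h.theta₂_eq,
      fun X hX => hn.isRealization hpc hS hR hG hN hX⟩
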